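/- Let $\alpha\ge 0$ and $\lambda>0$. On $L^2(\mathbb R^3)$ let $G_\lambda(x)=\frac{e^{-\sqrt\lambda|x|}}{4\pi|x|}$ and let $-\Delta_\alpha$ be the non-negative self-adjoint operator with $$\mathcal D(-\Delta_\alpha)=\Big\{g=f+\frac{f(0)}{\alpha+\frac{\sqrt\mu}{4\pi}}\,G_\mu\ \Big|\ f\in H^2(\mathbb R^3)\Big\},\qquad(-\Delta_\alpha+\mu)g=(-\Delta+\mu)f,$$ which does not depend on the choice of $\mu>0$; its fractional powers are those given by the spectral theorem. With $\widehat F(p)=(2\pi)^{-3/2}\int e^{-ip\cdot x}F(x)\,dx$ and $s=\frac32$, define for $F\in H^{3/2}(\mathbb R^3)$ $$\kappa_F(t)=\frac1{(2\pi)^{3/2}}\int_{\mathbb R^3}\frac{\widehat F(p)}{p^2+\lambda+t}\,dp,\qquad \widehat{I_F}(p)=-\frac{4\sin\frac{s\pi}2}{(2\pi)^{3/2}}\int_0^{\infty}\frac{t^{s/2}\,\kappa_F(t)}{4\pi\alpha+\sqrt{\lambda+t}}\,\frac{dt}{p^2+\lambda+t},$$ $$\widehat{J_\lambda}(p)=\frac{\sin\frac{s\pi}2}{\pi(2\pi)^{3/2}}\int_0^\infty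 \frac{t^{\frac s2-1}}{p^2+\lambda+t}\,\frac{4\pi\alpha+\sqrt\lambda}{4\pi\alpha+\sqrt{\lambda+t}}\,dt,\qquad F^{(0)}=\lim_{R\to\infty}\frac1{(2\pi)^{3/2}}\int_{|p|<R}\widehat F(p)\,dp,$$ the last one whenever the limit exists in $\mathbb C$. Let $$\mathcal D_0^{(3/2)}=\Big\{F\in H^{3/2}(\mathbb R^3)\ \Big|\ F^{(0)}\text{ exists in }\mathbb C\ \text{ and }\ I_F+\frac{F^{(0)}}{\alpha+\frac{\sqrt\lambda}{4\pi}}\,J_\lambda\in L^2(\mathbb R^3)\Big\}.$$ Then $$\mathcal D\big((-\Delta_\alpha)^{3/4}\big)=\Big\{F+\frac{F^{(0)}}{\alpha+\frac{\sqrt\lambda}{4\pi}}\,G_\lambda\ \Big|\ F\in\mathcal D_0^{(3/2)}\Big\},$$ and $\mathcal D_0^{(3/2)}$ is a linear subspace strictly contained in $H^{3/2}(\mathbb R^3)$. Consequently the regular part cannot be a generic $H^{3/2}$ function: if $F\in H^{3/2}(\mathbb R^3)$, $q\in\mathbb C$ and $F+q\,G_\lambda\in\mathcal D((-\Delta_\alpha)^{3/4})$,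 then $F\in\mathcal D_0^{(3/2)}$ and $q=F^{(0)}/(\alpha+\frac{\sqrt\lambda}{4\pi})$. -/

import Mathlib

open MeasureTheory Filter Topology Real Set
open scoped FourierTransform SchwartzMap Laplacian ENNReal

noncomputable section

namespace PointInteraction

/-! ### Domains of fractional powers of a nonnegative self-adjoint operator -/

section Spectral

variable {H : Type*} [NormedAddCommGroup H] [InnerProductSpace ℂ H]

/-- An operator `T` on `H` is given by its graph: `T u v` means `u ∈ D(T)` and `T u = v`.

`μ` is the spectral measure `B ↦ ⟨g, E(B) g⟩` of the nonnegative self-adjoint operator `T` at the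
vector `g`: the finite Borel measure carried by `[0, ∞)` such that
`⟨g, (T + z)⁻¹ g⟩ = ∫ (x + z)⁻¹ dμ(x)` for every `z > 0` (by Stieltjes inversion there is exactly
one such measure). Below, `u = (T + z)⁻¹ g`. -/
def IsSpectralMeasure (T : H → H → Prop) (g : H) (μ : Measure ℝ) : Prop :=
  IsFiniteMeasure μ ∧ μ (Iio 0) = 0 ∧
    ∀ z : ℝ, 0 < z → ∃ u v : H, T u v ∧ v + (z : ℂ) • u = g ∧
      inner ℂ g u = ((∫ x, (x + z)⁻¹ ∂μ : ℝ) : ℂ)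

/-- The domain of the power `T ^ β` given by the spectral theorem:
the vectors `g` with `∫ x ^ (2 β) dμ_g(x) < ∞`, where `μ_g` is the spectral measure of `T` at `g`. -/
def fracPowDomain (T : H → H → Prop) (β : ℝ) : Set H :=
  {g | ∃ μ : Measure ℝ, IsSpectralMeasure T g μ ∧ ∫⁻ x, ENNReal.ofReal (x ^ (2 * β)) ∂μ < ∞}

end Spectral

/-- The space `ℝ³`. -/
abbrev R3 : Type := EuclideanSpace ℝ (Fin 3)

/-- The Hilbert space `L²(ℝ³)`. -/
abbrev L2 : Type := Lp ℂ 2 (volume : Measure R3)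

/-- The Sobolev space `H^s(ℝ³)`, `s ≥ 0`, as a set of `L²` functions. -/
def Hs (s : ℝ) : Set L2 :=
  {F | TemperedDistribution.MemSobolev s 2 (F : 𝓢'(R3, ℂ))}

/-- The Green function `G_λ(x) = exp (-√λ |x|) / (4 π |x|)`. -/
def green (lam : ℝ) (x : R3) : ℂ :=
  ((exp (-√lam * ‖x‖) / (4 * π * ‖x‖) : ℝ) : ℂ)

/-- The constant `α + √λ / (4 π)`. -/
def coupling (α lam : ℝ) : ℝ := α + √lam / (4 * π)

/-- The graph of the operator `-Δ_α` on `L²(ℝ³)`: `g ∈ D(-Δ_α)` and `-Δ_α g = h` when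
`g = f + f(0) / (α + √μ / 4π) G_μ` and `(-Δ_α + μ) g = (-Δ + μ) f` with `f ∈ H²(ℝ³)`, for some
(equivalently, for every) `μ > 0`. Here `f₀` is the continuous representative of `f`, and `Δ f`
is the distributional Laplacian. -/
def PointLaplacian (α : ℝ) (g h : L2) : Prop :=
  ∃ μ : ℝ, 0 < μ ∧ ∃ (f : L2) (f₀ : R3 → ℂ),
    f ∈ Hs 2 ∧ Continuous f₀ ∧ f =ᵐ[volume] f₀ ∧
    g =ᵐ[volume] (fun x => f₀ x + f₀ 0 / (coupling α μ : ℂ) * green μ x) ∧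
    ((h + (μ : ℂ) • g : L2) : 𝓢'(R3, ℂ)) = (μ : ℂ) • (f : 𝓢'(R3, ℂ)) - Δ (f : 𝓢'(R3, ℂ))

/-- The Fourier transform on `L²(ℝ³)` with the normalization
`F̂(p) = (2π)^{-3/2} ∫ exp(-i p·x) F(x) dx`. Mathlib's `𝓕` has the kernel `exp(-2π i ξ·x)`,
so `F̂(p) = (2π)^{-3/2} 𝓕 F (p / 2π)`. -/
def hat (F : L2) (p : R3) : ℂ :=
  (((2 * π) ^ (3 / 2 : ℝ))⁻¹ : ℝ) * (𝓕 F : L2) ((2 * π)⁻¹ • p)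

/-- `κ_F(t) = (2π)^{-3/2} ∫ F̂(p) / (p² + λ + t) dp`. -/
def kappa (lam : ℝ) (F : L2) (t : ℝ) : ℂ :=
  (((2 * π) ^ (3 / 2 : ℝ))⁻¹ : ℝ) * ∫ p : R3, hat F p / ((‖p‖ ^ 2 + lam + t : ℝ) : ℂ)

/-- The Fourier transform of `I_F`:
`Î_F(p) = -(4 sin(sπ/2) / (2π)^{3/2}) ∫₀^∞ t^{s/2} κ_F(t) / ((4πα + √(λ+t)) (p² + λ + t)) dt`. -/
def hatI (s α lam : ℝ) (F : L2) (p : R3) : ℂ :=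
  -((4 * sin (s * π / 2) / (2 * π) ^ (3 / 2 : ℝ) : ℝ) : ℂ) *
    ∫ t in Ioi (0 : ℝ), ((t ^ (s / 2) : ℝ) : ℂ) * kappa lam F t /
      (((4 * π * α + √(lam + t)) * (‖p‖ ^ 2 + lam + t) : ℝ) : ℂ)

/-- `φ(t) = (4πα + √λ) / (4πα + √(λ+t))`. -/
def phi (α lam t : ℝ) : ℝ :=
  (4 * π * α + √lam) / (4 * π * α + √(lam + t))

/-- The Fourier transform of `J_λ`:
`Ĵ_λ(p) = (sin(sπ/2) / (π (2π)^{3/2})) ∫₀^∞ t^{s/2-1} φ(t) / (p² + λ + t) dt`. -/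
def hatJ (s α lam : ℝ) (p : R3) : ℝ :=
  sin (s * π / 2) / (π * (2 * π) ^ (3 / 2 : ℝ)) *
    ∫ t in Ioi (0 : ℝ), t ^ (s / 2 - 1) * phi α lam t / (‖p‖ ^ 2 + lam + t)

/-- `F^{(0)} = (2π)^{-3/2} ∫ F̂(p) dp` exists and equals `c`, the integral over `ℝ³` being the limit
of the integrals over the balls `|p| < R` as `R → ∞`. -/
def HasValueAtZero (F : L2) (c : ℂ) : Prop :=
  Tendsto (fun R : ℝ => (((2 * π) ^ (3 / 2 : ℝ))⁻¹ : ℝ) * ∫ p in Metric.ball (0 : R3) R, hat F p)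
    atTop (𝓝 c)

/-- The space `D₀^{(s)}` of all `F ∈ H^s(ℝ³)` such that `F^{(0)}` is finite and
`I_F + F^{(0)} / (α + √λ/4π) J_λ ∈ L²(ℝ³)`; the second condition is expressed on the
Fourier side, where `I_F` and `J_λ` are defined. -/
def D0 (s α lam : ℝ) : Set L2 :=
  {F | F ∈ Hs s ∧ ∃ c : ℂ, HasValueAtZero F c ∧
    MemLp (fun p => hatI s α lam F p + c / (coupling α lam : ℂ) * (hatJ s α lam p : ℂ)) 2
      (volume : Measure R3)}

end PointInteraction

end

open MeasureTheory Filter Topology Real Set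
open scoped FourierTransform SchwartzMap Laplacian ENNReal

noncomputable section

namespace PointInteraction

/-! ### Spectral measures obtained from a resolvent family -/

section Spectral

variable {H : Type*} [NormedAddCommGroup H] [InnerProductSpace ℂ H] [CompleteSpace H]

/-! Write A for the operator, y = p² + λ, and work on the Fourier side. By Krein's formula (`krein`)
the resolvent of A at −z multiplies ĝ + charge · (2π)^{-3/2} by 1/(p² + z); this is checked against
the graph of A in `hat_eq_krein_of_pointLaplacian` and `exists_pointLaplacian`. The operators form a
resolvent family (`isResolventFamily`), so every g has a spectral measure μ, and the inner products
of the vectors (A+λ)(A+λ+t)⁻¹g, called `wav`, are explicit integrals against μ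
(`integral_conj_wav_mul_wav`). Everything is deduced from these vectors.

Existence of a regular part (`exists_regular_part`). If ∫ (x+λ)^{3/2} dμ is finite, the dyadic sum
of t^{3/2} ‖`wav` t‖² over t = 4^n is finite. The increments of t · charge(λ+t) are controlled by
‖`wav` t‖, so these numbers converge to some q, with a rate given by a discrete Hardy inequality.
Subtracting q G_λ from g leaves F, whose dyadic square function for H^{3/2} is bounded by the two
sums.

The charge is forced (`tendsto_mul_kappa_of_mem`). The deviation of t · charge(λ+t) from q, times
the L² norm of a Green function, is bounded by one spectral and one H^{3/2} quantity, both
o(t^{-3/4}). This gives t κ_F(t) → q (α + √λ/4π). The quantity t κ_F(t) is the value of F at 0 with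
the smooth cutoff t/(p²+λ+t); for H^{3/2} functions it may be replaced by the sharp cutoff
(`tendsto_integral_mul_cutoffDiff`), so q is F⁽⁰⁾ divided by the coupling.

The L² condition. The integral of t^{-1/4} y/(y+t) over (0,∞) is a multiple of y^{3/4}, so
(A+λ)^{3/4} g is formally a multiple of the integral of t^{-1/4} `wav` t. Cut at N, this integral
has squared norm ∫ `truncSymbol` N (x+λ)² dμ, and pointwise in p it tends to `powSymbol`(y) F̂ +
`defectInt`. The first summand is in L² because F ∈ H^{3/2}; the second is a nonzero multiple of the
transform of I_F + q J_λ. Fatou's lemma shows that the limit is in L² if g is in the domain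
(`memLp_limit_of_mem`). Conversely, if the limit is in L², pairing a fixed truncation with later
ones and using Cauchy–Schwarz bounds all truncations uniformly (`integral_truncSymbol_sq_le`), and
the spectral moment is finite.

Strictness (`exists_mem_Hs_not_hasValueAtZero`) comes from a radial function in H^{3/2} whose
transform has ball integrals growing like log log R. -/

/-- The functional `f ↦ ⟨g, f(T) g⟩` on continuous functions on the spectrum is represented by a
finite measure. -/
theorem exists_measure_cfcHom {T : H →L[ℂ] H} (hT : IsSelfAdjoint T) (g : H) :
    ∃ ν : Measure (spectrum ℝ T), IsFiniteMeasure ν ∧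
      ∀ f : C(spectrum ℝ T, ℝ), ∫ x, f x ∂ν = (inner ℂ g (cfcHom hT f g)).re := by
  have hc : CompactSpace (spectrum ℝ T) :=
    isCompact_iff_compactSpace.mp (ContinuousFunctionalCalculus.isCompact_spectrum T)
  let Λ₀ : CompactlySupportedContinuousMap (spectrum ℝ T) ℝ →ₗ[ℝ] ℝ :=
    { toFun := fun f => (inner ℂ g (cfcHom hT (f : C(spectrum ℝ T, ℝ)) g)).re
      map_add' := fun f h => by
        have : ((f + h : CompactlySupportedContinuousMap (spectrum ℝ T) ℝ) : C(spectrum ℝ T, ℝ)) =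
          (f : C(spectrum ℝ T, ℝ)) + (h : C(spectrum ℝ T, ℝ)) := rfl
        rw [this, map_add, add_apply, inner_add_right, Complex.add_re]
      map_smul' := fun c f => by
        have : ((c • f : CompactlySupportedContinuousMap (spectrum ℝ T) ℝ) : C(spectrum ℝ T, ℝ)) =
          c • (f : C(spectrum ℝ T, ℝ)) := rfl
        rw [this, map_smul, smul_apply, inner_smul_right_eq_smul]
        simp }
  let Λ : CompactlySupportedContinuousMap (spectrum ℝ T) ℝ →ₚ[ℝ] ℝ :=
    PositiveLinearMap.mk₀ Λ₀ (by
      intro f hf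
      -- A nonnegative function is the square of its root, so the functional takes the value ‖s(T)
      -- g‖² on it. This positivity is what the Riesz–Markov–Kakutani theorem needs.
      let s : C(spectrum ℝ T, ℝ) := ⟨fun x => √(f x), by fun_prop⟩
      have hs : (f : C(spectrum ℝ T, ℝ)) = star s * s := by
        ext x
        have : 0 ≤ f x := hf x
        simp [s, Real.mul_self_sqrt this]
      change 0 ≤ (inner ℂ g (cfcHom hT (f : C(spectrum ℝ T, ℝ)) g)).re
      rw [hs, map_mul, map_star, ContinuousLinearMap.star_eq_adjoint,
        mul_apply_eq_comp, ContinuousLinearMap.adjoint_inner_right]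
      exact inner_self_nonneg (𝕜 := ℂ))
  refine ⟨RealRMK.rieszMeasure Λ, ⟨?_⟩, fun f => ?_⟩
  · let one : CompactlySupportedContinuousMap (spectrum ℝ T) ℝ :=
      CompactlySupportedContinuousMap.continuousMapEquiv 1
    exact (RealRMK.rieszMeasure_le_of_eq_one Λ (f := one) (fun _ => zero_le_one) isCompact_univ
      (fun _ _ => rfl)).trans_lt ENNReal.ofReal_lt_top
  · exact RealRMK.integral_rieszMeasure Λ (CompactlySupportedContinuousMap.continuousMapEquiv f)

/-- The family of resolvents `z ↦ (A + z)⁻¹`, `z > 0`, of a nonnegative self-adjoint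
operator `A`. -/
structure IsResolventFamily (R : ℝ → H →L[ℂ] H) : Prop where
  isSelfAdjoint : ∀ z, 0 < z → IsSelfAdjoint (R z)
  sub_eq : ∀ z w, 0 < z → 0 < w → R z - R w = ((w - z : ℝ) : ℂ) • (R z * R w)
  tendsto : ∀ g, Tendsto (fun z : ℝ => (z : ℂ) * inner ℂ g (R z g)) atTop (𝓝 (inner ℂ g g))

namespace IsResolventFamily

variable {R : ℝ → H →L[ℂ] H} (hR : IsResolventFamily R)
include hR

/-- Formally r − (A+1)⁻¹ = r (A+z)(A+1)⁻¹ with z = 1 − 1/r, and z is positive exactly when r lies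
outside [0,1] (r ≠ 0). The inverse r⁻¹(1 + r⁻¹ R z) is then verified from the resolvent identity
alone. -/
theorem spectrum_one_subset : spectrum ℝ (R 1) ⊆ Icc 0 1 := by
  intro r hr
  by_contra hr'
  apply hr
  have hr0 : r ≠ 0 := by rintro rfl; simp at hr'
  have hz : 0 < 1 - r⁻¹ := by
    rcases lt_or_gt_of_ne hr0 with h | h
    · have := inv_lt_zero.mpr h
      linarith
    · have h1 : 1 < r := by
        by_contra h2
        exact hr' ⟨h.le, not_lt.mp h2⟩
      have := inv_lt_one_of_one_lt₀ h1
      linarith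
  set z := 1 - r⁻¹ with hzdef
  have e1 := hR.sub_eq z 1 hz one_pos
  have e2 := hR.sub_eq 1 z one_pos hz
  have hzr : ((1 - z : ℝ) : ℂ) = (r : ℂ)⁻¹ := by simp [hzdef]
  have hzr' : ((z - 1 : ℝ) : ℂ) = -(r : ℂ)⁻¹ := by simp [hzdef]
  rw [hzr] at e1
  rw [hzr'] at e2
  have hrc : (r : ℂ) ≠ 0 := by exact_mod_cast hr0
  have key : algebraMap ℝ (H →L[ℂ] H) r = (r : ℂ) • (1 : H →L[ℂ] H) := by
    ext x; simp [Algebra.algebraMap_eq_smul_one]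
  rw [spectrum.mem_resolventSet_iff, key]
  have a1 : ((r : ℂ) • (1 : H →L[ℂ] H) - R 1) * ((r : ℂ)⁻¹ • (1 + (r : ℂ)⁻¹ • R z)) = 1 := by
    have : R 1 * R z = (r : ℂ) • (R z - R 1) := by
      rw [← neg_sub (R 1), e2, smul_neg, smul_smul, mul_neg, mul_inv_cancel₀ hrc]; simp
    simp only [mul_smul_comm, mul_add, sub_mul, smul_mul_assoc, one_mul, mul_one, this]
    simp only [smul_sub, smul_add, smul_smul, inv_mul_cancel₀ hrc, one_smul]
    abel
  have a2 : ((r : ℂ)⁻¹ • (1 + (r : ℂ)⁻¹ • R z)) * ((r : ℂ) • (1 : H →L[ℂ] H) - R 1) = 1 := by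
    have : R z * R 1 = (r : ℂ) • (R z - R 1) := by
      rw [e1, smul_smul, mul_inv_cancel₀ hrc, one_smul]
    simp only [mul_smul_comm, mul_sub, add_mul, smul_mul_assoc, one_mul, mul_one, this]
    simp only [smul_sub, smul_add, smul_smul, inv_mul_cancel₀ hrc, mul_inv_cancel₀ hrc,
      mul_inv_cancel_left₀ hrc, one_smul]
    abel
  exact ⟨⟨_, _, a1, a2⟩, rfl⟩

/-- In the variable x = 1/(a+1) the function 1/(a+z) becomes x/(1+(z−1)x). The resolvent identity
gives R z (1 + (z−1) R 1) = R 1, and the second factor is inverted inside the functional calculus.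
-/
theorem apply_eq_cfcHom {z : ℝ} (hz : 0 < z) (f : C(spectrum ℝ (R 1), ℝ))
    (hf : ∀ x, f x = x / (1 + (z - 1) * x)) :
    cfcHom (hR.isSelfAdjoint 1 one_pos) f = R z := by
  have hpos : ∀ x : spectrum ℝ (R 1), 0 < 1 + (z - 1) * (x : ℝ) := by
    intro x
    obtain ⟨h0, h1⟩ := hR.spectrum_one_subset x.2
    rcases h0.eq_or_lt with h | h
    · simp [← h]
    · nlinarith [mul_pos hz h]
  set hT := hR.isSelfAdjoint 1 one_pos
  let i : C(spectrum ℝ (R 1), ℝ) := (ContinuousMap.id ℝ).restrict (spectrum ℝ (R 1))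
  let h : C(spectrum ℝ (R 1), ℝ) := ⟨fun x => (1 + (z - 1) * (x : ℝ))⁻¹,
    Continuous.inv₀ (by fun_prop) (fun x => (hpos x).ne')⟩
  have hi : cfcHom hT i = R 1 := cfcHom_id hT
  have e1 : f = i * h := by
    ext x; simp [hf, i, h, div_eq_mul_inv]
  have e2 : (1 + (z - 1) • i) * h = 1 := by
    ext x; simp [i, h, (hpos x).ne']
  have e3 := hR.sub_eq z 1 hz one_pos
  have e4 : R z * (1 + (z - 1) • R 1) = R 1 := by
    have : R 1 = R z - ((1 - z : ℝ) : ℂ) • (R z * R 1) := by rw [← e3]; abel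
    conv_rhs => rw [this]
    have hs : ∀ X : H →L[ℂ] H, (z - 1) • X = ((z - 1 : ℝ) : ℂ) • X := fun _ => rfl
    rw [mul_add, mul_one, mul_smul_comm, hs]
    push_cast
    module
  calc cfcHom hT f = R 1 * cfcHom hT h := by rw [e1, map_mul, hi]
    _ = R z * cfcHom hT ((1 + (z - 1) • i) * h) := by
        rw [map_mul, map_add, map_one, map_smul, hi, ← mul_assoc, e4]
    _ = R z := by rw [e2, map_one, mul_one]


/-- Every vector has a spectral measure. -/
theorem exists_measure (g : H) : ∃ μ : Measure ℝ, IsFiniteMeasure μ ∧ μ (Iio 0) = 0 ∧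
    ∀ z : ℝ, 0 < z → (inner ℂ g (R z g)).re = ∫ x, (x + z)⁻¹ ∂μ := by
  obtain ⟨ν, hν, hint⟩ := exists_measure_cfcHom (hR.isSelfAdjoint 1 one_pos) g
  have hmem : ∀ x : spectrum ℝ (R 1), 0 ≤ (x : ℝ) ∧ (x : ℝ) ≤ 1 :=
    fun x => hR.spectrum_one_subset x.2
  have hpos : ∀ z : ℝ, 0 < z → ∀ x : spectrum ℝ (R 1), 0 < 1 + (z - 1) * (x : ℝ) := by
    intro z hz x
    obtain ⟨h0, h1⟩ := hmem x
    rcases h0.eq_or_lt with h | h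
    · simp [← h]
    · nlinarith [mul_pos hz h]
  have hRz : ∀ z : ℝ, 0 < z → ∫ x : spectrum ℝ (R 1), (x : ℝ) / (1 + (z - 1) * x) ∂ν =
      (inner ℂ g (R z g)).re := by
    intro z hz
    let f : C(spectrum ℝ (R 1), ℝ) := ⟨fun x => (x : ℝ) / (1 + (z - 1) * x),
      Continuous.div (by fun_prop) (by fun_prop) (fun x => (hpos z hz x).ne')⟩
    have := hint f
    rw [hR.apply_eq_cfcHom hz f (fun _ => rfl)] at this
    exact this
  have hmass : ∫ _ : spectrum ℝ (R 1), (1 : ℝ) ∂ν = (inner ℂ g g).re := by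
    have := hint 1
    rw [map_one] at this
    simpa using this
  -- An atom at x = 0 would be spectral mass at a = ∞. The integrals of 1 − (n+1) x/(1+nx) =
  -- (1−x)/(1+nx) tend to the mass of this atom, and also to 0 because z ⟨g, R z g⟩ → ⟨g, g⟩.
  have hzero : ν {x | (x : ℝ) = 0} = 0 := by
    have hms : MeasurableSet {x : spectrum ℝ (R 1) | (x : ℝ) = 0} :=
      measurable_subtype_coe (measurableSet_singleton 0)
    have t1 : Tendsto (fun n : ℕ => ∫ x : spectrum ℝ (R 1),
        (1 - ((n : ℝ) + 1) * ((x : ℝ) / (1 + (((n : ℝ) + 1) - 1) * x))) ∂ν) atTop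
        (𝓝 (∫ x, {x : spectrum ℝ (R 1) | (x : ℝ) = 0}.indicator (fun _ => (1 : ℝ)) x ∂ν)) := by
      refine tendsto_integral_of_dominated_convergence (fun _ => 1) ?_ (integrable_const _) ?_ ?_
      · intro n
        exact (Measurable.aestronglyMeasurable (by fun_prop))
      · intro n
        refine Eventually.of_forall fun x => ?_
        obtain ⟨h0, h1⟩ := hmem x
        have hp := hpos (n + 1) (by positivity) x
        have e : 1 - ((n : ℝ) + 1) * ((x : ℝ) / (1 + (((n : ℝ) + 1) - 1) * x)) =
            (1 - x) / (1 + (((n : ℝ) + 1) - 1) * x) := by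
          rw [eq_div_iff hp.ne', sub_mul, mul_assoc, div_mul_cancel₀ _ hp.ne']
          ring
        rw [e, Real.norm_eq_abs, abs_of_nonneg (div_nonneg (by linarith) hp.le), div_le_one hp]
        have : 0 ≤ (n : ℝ) * x := by positivity
        linarith
      · refine Eventually.of_forall fun x => ?_
        obtain ⟨h0, h1⟩ := hmem x
        by_cases hx : (x : ℝ) = 0
        · simp [hx]
        · have hx' : 0 < (x : ℝ) := lt_of_le_of_ne h0 (Ne.symm hx)
          simp only [mem_ofPred_eq, hx, not_false_eq_true, indicator_of_notMem]
          have e : ∀ n : ℕ, 1 - ((n : ℝ) + 1) * ((x : ℝ) / (1 + (((n : ℝ) + 1) - 1) * x)) =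
              (1 - x) / (1 + n * (x : ℝ)) := by
            intro n
            have hp := hpos (n + 1) (by positivity) x
            rw [add_sub_cancel_right] at hp ⊢
            rw [eq_div_iff hp.ne', sub_mul, mul_assoc, div_mul_cancel₀ _ hp.ne']
            ring
          simp_rw [e]
          refine Tendsto.div_atTop tendsto_const_nhds ?_
          exact tendsto_atTop_add_const_left _ _
            (tendsto_natCast_atTop_atTop.atTop_mul_const hx')
    have t2 : Tendsto (fun n : ℕ => ∫ x : spectrum ℝ (R 1),
        (1 - ((n : ℝ) + 1) * ((x : ℝ) / (1 + (((n : ℝ) + 1) - 1) * x))) ∂ν) atTop (𝓝 0) := by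
      have h1 : Tendsto (fun n : ℕ => (n : ℝ) + 1) atTop atTop :=
        tendsto_atTop_add_const_right _ _ tendsto_natCast_atTop_atTop
      have h2 := (Complex.continuous_re.tendsto _).comp ((hR.tendsto g).comp h1)
      have h3 := h2.const_sub (inner ℂ g g).re
      rw [sub_self] at h3
      refine h3.congr fun n => ?_
      have hc : CompactSpace (spectrum ℝ (R 1)) :=
        isCompact_iff_compactSpace.mp (ContinuousFunctionalCalculus.isCompact_spectrum _)
      have hi : Integrable (fun x : spectrum ℝ (R 1) =>
          (x : ℝ) / (1 + (((n : ℝ) + 1) - 1) * x)) ν := by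
        refine Continuous.integrable_of_hasCompactSupport ?_ (HasCompactSupport.of_compactSpace _)
        exact Continuous.div (by fun_prop) (by fun_prop)
          (fun x => (hpos (n + 1) (by positivity) x).ne')
      rw [integral_sub (integrable_const _) (hi.const_mul _), hmass, integral_const_mul,
        hRz (n + 1) (by positivity)]
      simp only [Function.comp, Complex.mul_re, Complex.ofReal_re, Complex.ofReal_im, zero_mul,
        sub_zero]
    have := tendsto_nhds_unique t1 t2
    rw [integral_indicator hms, setIntegral_const, smul_eq_mul, mul_one] at this
    exact (measureReal_eq_zero_iff).mp this
  have hmeas : Measurable fun x : spectrum ℝ (R 1) => (x : ℝ)⁻¹ - 1 := by fun_prop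
  -- Undo x = 1/(a+1). At x = 0 the convention 0⁻¹ = 0 produces the spurious value −1, which carries
  -- no mass by `hzero`.
  refine ⟨Measure.map (fun x : spectrum ℝ (R 1) => (x : ℝ)⁻¹ - 1) ν, Measure.isFiniteMeasure_map _ _, ?_, ?_⟩
  · rw [Measure.map_apply hmeas measurableSet_Iio]
    refine measure_mono_null (fun x hx => ?_) hzero
    obtain ⟨h0, h1⟩ := hmem x
    by_contra hne
    have hx' : 0 < (x : ℝ) := lt_of_le_of_ne h0 (Ne.symm hne)
    have := (one_le_inv₀ hx').mpr h1
    simp only [mem_preimage, mem_Iio] at hx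
    linarith
  · intro z hz
    rw [integral_map hmeas.aemeasurable (Measurable.aestronglyMeasurable (by fun_prop)),
      ← hRz z hz]
    refine integral_congr_ae ?_
    have hae : ∀ᵐ x : spectrum ℝ (R 1) ∂ν, (x : ℝ) ≠ 0 := by
      rw [ae_iff]; simpa using hzero
    filter_upwards [hae] with x hx
    have hp := (hpos z hz x).ne'
    have e : (x : ℝ)⁻¹ - 1 + z = (1 + (z - 1) * x) / x := by field_simp; ring
    rw [e, inv_div]

theorem inner_comm_apply {z : ℝ} (hz : 0 < z) (g h : H) :
    inner ℂ (R z g) h = inner ℂ g (R z h) := by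
  have := (hR.isSelfAdjoint z hz)
  rw [ContinuousLinearMap.isSelfAdjoint_iff_isSymmetric] at this
  exact this g h

theorem inner_self_im {z : ℝ} (hz : 0 < z) (g : H) : (inner ℂ g (R z g)).im = 0 := by
  have h := hR.inner_comm_apply hz g g
  rw [← inner_conj_symm] at h
  exact Complex.conj_eq_iff_im.mp h

/-- The Stieltjes transform of `μ` is the resolvent function of `g`. -/
def Represents (R : ℝ → H →L[ℂ] H) (g : H) (μ : Measure ℝ) : Prop :=
  ∀ z : ℝ, 0 < z → inner ℂ g (R z g) = ((∫ x, (x + z)⁻¹ ∂μ : ℝ) : ℂ)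

theorem exists_represents (g : H) : ∃ μ : Measure ℝ, IsFiniteMeasure μ ∧ μ (Iio 0) = 0 ∧
    Represents R g μ := by
  obtain ⟨μ, h1, h2, h3⟩ := hR.exists_measure g
  refine ⟨μ, h1, h2, fun z hz => ?_⟩
  apply Complex.ext
  · rw [h3 z hz, Complex.ofReal_re]
  · rw [hR.inner_self_im hz, Complex.ofReal_im]

section Represents

omit hR in
theorem ae_nonneg_of_measure_Iio {μ : Measure ℝ} (h0 : μ (Iio 0) = 0) : ∀ᵐ x ∂μ, 0 ≤ x := by
  rw [ae_iff]
  simpa [Iio] using h0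

omit hR in
theorem integrable_inv_add {μ : Measure ℝ} [IsFiniteMeasure μ] (h0 : μ (Iio 0) = 0) {z : ℝ}
    (hz : 0 < z) : Integrable (fun x => (x + z)⁻¹) μ := by
  refine Integrable.of_bound (Measurable.aestronglyMeasurable (by fun_prop)) z⁻¹ ?_
  filter_upwards [ae_nonneg_of_measure_Iio h0] with x hx
  rw [Real.norm_eq_abs, abs_of_nonneg (by positivity)]
  exact inv_anti₀ hz (by linarith)

omit hR in
theorem integrable_inv_add_mul_inv_add {μ : Measure ℝ} [IsFiniteMeasure μ] (h0 : μ (Iio 0) = 0)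
    {z w : ℝ} (hz : 0 < z) (hw : 0 < w) : Integrable (fun x => (x + z)⁻¹ * (x + w)⁻¹) μ := by
  refine (integrable_inv_add h0 hw).bdd_mul (c := z⁻¹)
    (Measurable.aestronglyMeasurable (by fun_prop)) ?_
  filter_upwards [ae_nonneg_of_measure_Iio h0] with x hx
  rw [Real.norm_eq_abs, abs_of_nonneg (by positivity)]
  exact inv_anti₀ hz (by linarith)

variable {g : H} {μ : Measure ℝ} [IsFiniteMeasure μ] (h0 : μ (Iio 0) = 0) (hμ : Represents R g μ)
include h0 hμ

/-- The total mass is the limit of n times the Stieltjes transform at n, since n/(x+n) → 1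
boundedly. -/
theorem measureReal_univ : inner ℂ g g = ((∫ _, (1 : ℝ) ∂μ : ℝ) : ℂ) := by
  refine tendsto_nhds_unique ((hR.tendsto g).comp
    (tendsto_natCast_atTop_atTop (R := ℝ))) ?_
  have t : Tendsto (fun n : ℕ => ∫ x, (n : ℝ) * (x + n)⁻¹ ∂μ) atTop (𝓝 (∫ _, (1 : ℝ) ∂μ)) := by
    refine tendsto_integral_of_dominated_convergence (fun _ => 1) ?_ (integrable_const _) ?_ ?_
    · exact fun n => Measurable.aestronglyMeasurable (by fun_prop)
    · intro n
      filter_upwards [ae_nonneg_of_measure_Iio h0] with x hx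
      rw [Real.norm_eq_abs, abs_of_nonneg (by positivity), ← div_eq_mul_inv]
      exact div_le_one_of_le₀ (by linarith) (by positivity)
    · refine Eventually.of_forall fun x => ?_
      have h := (tendsto_natCast_div_add_atTop (𝕜 := ℝ) x)
      refine h.congr fun n => ?_
      rw [div_eq_mul_inv, add_comm]
  have t' := (Complex.continuous_ofReal.tendsto _).comp t
  refine t'.congr' ?_
  filter_upwards [eventually_gt_atTop 0] with n hn
  have hn' : (0 : ℝ) < n := by exact_mod_cast hn
  simp only [Function.comp]
  rw [hμ n hn', integral_const_mul]
  push_cast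
  rfl

/-- The resolvent identity on the Hilbert space side and partial fractions on the measure side both
turn the product into a difference quotient; dividing by w − z is why the diagonal is excluded here.
-/
theorem inner_apply_apply_of_ne {z w : ℝ} (hz : 0 < z) (hw : 0 < w) (hne : z ≠ w) :
    inner ℂ (R z g) (R w g) = ((∫ x, (x + z)⁻¹ * (x + w)⁻¹ ∂μ : ℝ) : ℂ) := by
  have h1 : ((w - z : ℝ) : ℂ) * inner ℂ (R z g) (R w g) =
      inner ℂ g (R z g) - inner ℂ g (R w g) := by
    rw [hR.inner_comm_apply hz, ← inner_sub_right, ← sub_apply,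
      hR.sub_eq z w hz hw, smul_apply, inner_smul_right,
      mul_apply_eq_comp]
  have hne' : w - z ≠ 0 := sub_ne_zero.mpr hne.symm
  have h2 : (w - z) * ∫ x, (x + z)⁻¹ * (x + w)⁻¹ ∂μ = ∫ x, (x + z)⁻¹ ∂μ - ∫ x, (x + w)⁻¹ ∂μ := by
    rw [← integral_const_mul, ← integral_sub (integrable_inv_add h0 hz) (integrable_inv_add h0 hw)]
    refine integral_congr_ae ?_
    filter_upwards [ae_nonneg_of_measure_Iio h0] with x hx
    have : x + z ≠ 0 := by positivity
    have : x + w ≠ 0 := by positivity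
    field_simp
    ring
  rw [hμ z hz, hμ w hw, ← Complex.ofReal_sub, ← h2, Complex.ofReal_mul] at h1
  exact mul_left_cancel₀ (by exact_mod_cast hne') h1

-- Norm continuity from the right, used to reach the diagonal z = w. The resolvent identity bounds
-- the difference by ε ‖R (z+ε)‖ ‖R z‖, and once ε ‖R z‖ ≤ 1/2 the unknown norm is absorbed.
omit h0 hμ in
theorem tendsto_resolvent {z : ℝ} (hz : 0 < z) :
    Tendsto (fun n : ℕ => R (z + 1 / ((n : ℝ) + 1))) atTop (𝓝 (R z)) := by
  have hlim : Tendsto (fun n : ℕ => 1 / ((n : ℝ) + 1)) atTop (𝓝 0) :=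
    tendsto_one_div_add_atTop_nhds_zero_nat
  rw [tendsto_iff_norm_sub_tendsto_zero]
  have hle : ∀ᶠ n : ℕ in atTop, 1 / ((n : ℝ) + 1) * ‖R z‖ ≤ 1 / 2 := by
    have := hlim.mul_const ‖R z‖
    rw [zero_mul] at this
    exact this.eventually_le_const (by norm_num)
  have t : Tendsto (fun n : ℕ => 1 / ((n : ℝ) + 1) * (2 * ‖R z‖ * ‖R z‖)) atTop (𝓝 0) := by
    simpa using hlim.mul_const (2 * ‖R z‖ * ‖R z‖)
  refine squeeze_zero' (Eventually.of_forall fun _ => norm_nonneg _) ?_ t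
  filter_upwards [hle] with n hn
  set ε := 1 / ((n : ℝ) + 1) with hε
  have hε0 : 0 < ε := by positivity
  have h1 : ‖R (z + ε) - R z‖ ≤ ε * (‖R (z + ε)‖ * ‖R z‖) := by
    rw [hR.sub_eq (z + ε) z (by positivity) hz, norm_smul]
    refine mul_le_mul (le_of_eq ?_) (norm_mul_le _ _) (norm_nonneg _) hε0.le
    simp [abs_of_pos hε0]
  have h2 : ‖R (z + ε)‖ ≤ 2 * ‖R z‖ := by
    have h3 : ‖R (z + ε)‖ ≤ ‖R (z + ε) - R z‖ + ‖R z‖ := by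
      simpa using norm_add_le (R (z + ε) - R z) (R z)
    nlinarith [norm_nonneg (R (z + ε)), norm_nonneg (R z)]
  calc _ ≤ ε * (‖R (z + ε)‖ * ‖R z‖) := h1
    _ ≤ _ := by gcongr

theorem inner_apply_apply {z w : ℝ} (hz : 0 < z) (hw : 0 < w) :
    inner ℂ (R z g) (R w g) = ((∫ x, (x + z)⁻¹ * (x + w)⁻¹ ∂μ : ℝ) : ℂ) := by
  rcases ne_or_eq z w with hne | rfl
  · exact hR.inner_apply_apply_of_ne h0 hμ hz hw hne
  have hlim : Tendsto (fun n : ℕ => 1 / ((n : ℝ) + 1)) atTop (𝓝 0) :=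
    tendsto_one_div_add_atTop_nhds_zero_nat
  have t1 : Tendsto (fun n : ℕ => inner ℂ (R z g) (R (z + 1 / ((n : ℝ) + 1)) g)) atTop
      (𝓝 (inner ℂ (R z g) (R z g))) := by
    have : Tendsto (fun n : ℕ => R (z + 1 / ((n : ℝ) + 1)) g) atTop (𝓝 (R z g)) :=
      ((ContinuousLinearMap.apply ℂ H g).continuous.tendsto _).comp (hR.tendsto_resolvent hz)
    exact tendsto_const_nhds.inner this
  have t2 : Tendsto (fun n : ℕ => ∫ x, (x + z)⁻¹ * (x + (z + 1 / ((n : ℝ) + 1)))⁻¹ ∂μ) atTop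
      (𝓝 (∫ x, (x + z)⁻¹ * (x + z)⁻¹ ∂μ)) := by
    refine tendsto_integral_of_dominated_convergence (fun _ => z⁻¹ * z⁻¹) ?_
      (integrable_const _) ?_ ?_
    · exact fun n => Measurable.aestronglyMeasurable (by fun_prop)
    · intro n
      filter_upwards [ae_nonneg_of_measure_Iio h0] with x hx
      rw [Real.norm_eq_abs, abs_of_nonneg (by positivity)]
      have : 0 < 1 / ((n : ℝ) + 1) := by positivity
      gcongr <;> linarith
    · filter_upwards [ae_nonneg_of_measure_Iio h0] with x hx
      refine tendsto_const_nhds.mul (Tendsto.inv₀ ?_ (by positivity))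
      simpa using (hlim.const_add z).const_add x
  refine tendsto_nhds_unique t1 ?_
  refine ((Complex.continuous_ofReal.tendsto _).comp t2).congr fun n => ?_
  have hn : 0 < 1 / ((n : ℝ) + 1) := by positivity
  exact (hR.inner_apply_apply_of_ne h0 hμ hz (by positivity) (by linarith)).symm

/-- The inner products of the vectors `(A + λ) (A + λ + t)⁻¹ g`. -/
theorem inner_sub_smul {lam s t : ℝ} (hlam : 0 < lam) (hs : 0 ≤ s) (ht : 0 ≤ t) :
    inner ℂ (g - (s : ℂ) • R (lam + s) g) (g - (t : ℂ) • R (lam + t) g) =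
      ((∫ x, ((x + lam) / (x + lam + s)) * ((x + lam) / (x + lam + t)) ∂μ : ℝ) : ℂ) := by
  have hs' : 0 < lam + s := by positivity
  have ht' : 0 < lam + t := by positivity
  -- Each factor is 1 − s/(x+λ+s), so the expansion has the same four terms as the inner product on
  -- the left.
  have e : ∫ x, ((x + lam) / (x + lam + s)) * ((x + lam) / (x + lam + t)) ∂μ =
      ∫ _, (1 : ℝ) ∂μ - s * ∫ x, (x + (lam + s))⁻¹ ∂μ - t * ∫ x, (x + (lam + t))⁻¹ ∂μ +
        s * t * ∫ x, (x + (lam + s))⁻¹ * (x + (lam + t))⁻¹ ∂μ := by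
    rw [← integral_const_mul, ← integral_const_mul, ← integral_const_mul,
      ← integral_sub (integrable_const _) ((integrable_inv_add h0 hs').const_mul _),
      ← integral_sub _ ((integrable_inv_add h0 ht').const_mul _),
      ← integral_add _ ((integrable_inv_add_mul_inv_add h0 hs' ht').const_mul _)]
    · refine integral_congr_ae ?_
      filter_upwards [ae_nonneg_of_measure_Iio h0] with x hx
      rw [← add_assoc, ← add_assoc]
      have : x + lam + s ≠ 0 := by positivity
      have : x + lam + t ≠ 0 := by positivity
      field_simp
      ring
    · exact ((integrable_const _).sub ((integrable_inv_add h0 hs').const_mul _)).sub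
        ((integrable_inv_add h0 ht').const_mul _)
    · exact (integrable_const _).sub ((integrable_inv_add h0 hs').const_mul _)
  rw [e]
  push_cast
  rw [← hR.inner_apply_apply h0 hμ hs' ht', ← hμ _ hs', ← hμ _ ht', inner_sub_left,
    inner_sub_right, inner_sub_right, inner_smul_left, inner_smul_right, inner_smul_right,
    inner_smul_left, hR.inner_comm_apply hs' g g, hR.measureReal_univ h0 hμ]
  simp only [Complex.conj_ofReal]
  ring

end Represents
end IsResolventFamily
end Spectral

/-! ### The Fourier transform on `L²(ℝ³)` -/

section FourierL2

/-- Two `L²` functions which define the same tempered distribution after multiplication by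
functions of temperate growth. -/
theorem smulLeftCLM_eq_iff {m : R3 → ℂ} (hm : m.HasTemperateGrowth) (h k : L2) :
    TemperedDistribution.smulLeftCLM ℂ m (h : 𝓢'(R3, ℂ)) = (k : 𝓢'(R3, ℂ)) ↔
      k =ᵐ[volume] fun x => m x * h x := by
  have hmc : Continuous m := hm.1.continuous
  constructor
  · intro H
    have hloc : LocallyIntegrable (fun x => m x * h x) (volume : Measure R3) := by
      have := ((Lp.memLp h).locallyIntegrable (by norm_num))
      rw [← locallyIntegrableOn_univ] at this ⊢
      exact this.continuousOn_mul hmc.continuousOn isOpen_univ.isLocallyClosed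
    refine ae_eq_of_integral_contDiff_smul_eq ((Lp.memLp k).locallyIntegrable (by norm_num))
      hloc ?_
    intro g hg hgc
    have hg₁ : HasCompactSupport (Complex.ofRealCLM ∘ g) := hgc.comp_left rfl
    have hg₂ : ContDiff ℝ (⊤ : ℕ∞) (Complex.ofRealCLM ∘ g) := by fun_prop
    have := congrArg (fun T => T (hg₁.toSchwartzMap hg₂)) H
    simp only [TemperedDistribution.smulLeftCLM_apply_apply, Lp.toTemperedDistribution_apply] at this
    rw [show (∫ x, g x • k x) = ∫ x, (hg₁.toSchwartzMap hg₂) x • k x from by simp, ← this]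
    refine integral_congr_ae (Eventually.of_forall fun x => ?_)
    simp [SchwartzMap.smulLeftCLM_apply_apply hm]
    ring
  · intro H
    ext u
    simp only [TemperedDistribution.smulLeftCLM_apply_apply, Lp.toTemperedDistribution_apply]
    refine integral_congr_ae ?_
    filter_upwards [H] with x hx
    rw [hx, SchwartzMap.smulLeftCLM_apply_apply hm]
    simp
    ring

theorem memSobolev_iff_memLp_fourier (s : ℝ) (F : L2) :
    F ∈ Hs s ↔ MemLp (fun ξ : R3 => (((1 + ‖ξ‖ ^ 2) ^ (s / 2) : ℝ) : ℂ) * (𝓕 F : L2) ξ) 2 := by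
  have hm : (fun x : R3 => (((1 + ‖x‖ ^ 2) ^ (s / 2) : ℝ) : ℂ)).HasTemperateGrowth := by fun_prop
  change TemperedDistribution.MemSobolev s 2 (F : 𝓢'(R3, ℂ)) ↔ _
  rw [TemperedDistribution.memSobolev_iff_exists_smulLeftCLM_fourier,
    Lp.fourier_toTemperedDistribution_eq]
  constructor
  · rintro ⟨k, hk⟩
    rw [smulLeftCLM_eq_iff hm] at hk
    exact (memLp_congr_ae hk).mp (Lp.memLp k)
  · intro h
    exact ⟨h.toLp _, (smulLeftCLM_eq_iff hm _ _).mpr h.coeFn_toLp⟩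

theorem fourierChar_continuous_fourier {f : R3 → ℂ} (hf : Integrable f) : Continuous (𝓕 f) :=
  VectorFourier.fourierIntegral_continuous Real.continuous_fourierChar
    (by exact continuous_inner) hf

/-- Against a test function, both the distributional and the integral Fourier transform can be moved
onto the test function. Hence the L² transform of an integrable function is given by the Fourier
integral. -/
theorem fourier_ae_eq {h : L2} {f : R3 → ℂ} (hf : Integrable f) (hfh : h =ᵐ[volume] f) :
    (𝓕 h : L2) =ᵐ[volume] 𝓕 f := by
  refine ae_eq_of_integral_contDiff_smul_eq ((Lp.memLp _).locallyIntegrable (by norm_num))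
      (fourierChar_continuous_fourier hf).locallyIntegrable ?_
  intro g hg hgc
  have hg₁ : HasCompactSupport (Complex.ofRealCLM ∘ g) := hgc.comp_left rfl
  have hg₂ : ContDiff ℝ (⊤ : ℕ∞) (Complex.ofRealCLM ∘ g) := by fun_prop
  set φ := hg₁.toSchwartzMap hg₂
  have h1 := congrArg (fun T => T φ) (Lp.fourier_toTemperedDistribution_eq h)
  simp only [TemperedDistribution.fourier_apply, Lp.toTemperedDistribution_apply] at h1
  have h2 : ∫ x, (𝓕 (φ : R3 → ℂ)) x • f x = ∫ x, φ x • (𝓕 f) x := by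
    have := VectorFourier.integral_fourierIntegral_smul_eq_flip (L := innerₗ R3) (μ := volume)
      (ν := volume) Real.continuous_fourierChar (by exact continuous_inner)
      (φ.integrable (μ := volume)) hf
    rw [flip_innerₗ] at this
    exact this
  have e1 : (∫ x, g x • (𝓕 h : L2) x) = ∫ x, φ x • (𝓕 h : L2) x := by simp [φ]
  have e2 : (∫ x, g x • 𝓕 f x) = ∫ x, φ x • 𝓕 f x := by simp [φ]
  rw [e1, e2, ← h1, ← h2]
  refine integral_congr_ae ?_
  filter_upwards [hfh] with x hx
  rw [hx, SchwartzMap.fourier_coe]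

theorem fourierInv_ae_eq {h : L2} {f : R3 → ℂ} (hf : Integrable f) (hfh : h =ᵐ[volume] f) :
    (𝓕⁻ h : L2) =ᵐ[volume] 𝓕⁻ f := by
  have hc : Continuous (𝓕⁻ f) := by
    have := (fourierChar_continuous_fourier hf).comp continuous_neg
    refine this.congr fun x => ?_
    rw [Real.fourierInv_eq_fourier_neg]; rfl
  refine ae_eq_of_integral_contDiff_smul_eq ((Lp.memLp _).locallyIntegrable (by norm_num))
      hc.locallyIntegrable ?_
  intro g hg hgc
  have hg₁ : HasCompactSupport (Complex.ofRealCLM ∘ g) := hgc.comp_left rfl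
  have hg₂ : ContDiff ℝ (⊤ : ℕ∞) (Complex.ofRealCLM ∘ g) := by fun_prop
  set φ := hg₁.toSchwartzMap hg₂
  have h1 := congrArg (fun T => T φ) (Lp.fourierInv_toTemperedDistribution_eq h)
  simp only [TemperedDistribution.fourierInv_apply, Lp.toTemperedDistribution_apply] at h1
  have h2 : ∫ x, (𝓕⁻ (φ : R3 → ℂ)) x • f x = ∫ x, φ x • (𝓕⁻ f) x := by
    have := VectorFourier.integral_fourierIntegral_smul_eq_flip (L := -innerₗ R3) (μ := volume)
      (ν := volume) Real.continuous_fourierChar (by exact continuous_inner.neg)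
      (φ.integrable (μ := volume)) hf
    have hflip : (-innerₗ R3).flip = -innerₗ R3 := by
      ext x y
      simp [real_inner_comm]
    rw [hflip] at this
    exact this
  have e1 : (∫ x, g x • (𝓕⁻ h : L2) x) = ∫ x, φ x • (𝓕⁻ h : L2) x := by simp [φ]
  have e2 : (∫ x, g x • 𝓕⁻ f x) = ∫ x, φ x • 𝓕⁻ f x := by simp [φ]
  rw [e1, e2, ← h1, ← h2]
  refine integral_congr_ae ?_
  filter_upwards [hfh] with x hx
  rw [hx, SchwartzMap.fourierInv_coe]

end FourierL2

/-! ### Gaussian subordination of the Green function -/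

section Subordination

/-- The error function, up to normalization. -/
def gaussPrimitive (x : ℝ) : ℝ := ∫ v in (0 : ℝ)..x, exp (-v ^ 2)

theorem hasDerivAt_gaussPrimitive (x : ℝ) : HasDerivAt gaussPrimitive (exp (-x ^ 2)) x := by
  have hc : Continuous fun v : ℝ => exp (-v ^ 2) := by fun_prop
  exact intervalIntegral.integral_hasDerivAt_right (hc.intervalIntegrable _ _)
    (hc.stronglyMeasurableAtFilter _ _) hc.continuousAt

theorem tendsto_gaussPrimitive_atTop : Tendsto gaussPrimitive atTop (𝓝 (√π / 2)) := by
  have h := integral_gaussian_Ioi 1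
  have hi : IntegrableOn (fun v : ℝ => exp (-v ^ 2)) (Ioi 0) := by
    have := (integrable_exp_neg_mul_sq (b := 1) one_pos).integrableOn (s := Ioi 0)
    simpa using this
  have := intervalIntegral_tendsto_integral_Ioi 0 hi tendsto_id
  simp only [neg_mul, one_mul, div_one] at h
  rwa [h] at this

theorem gaussPrimitive_neg (x : ℝ) : gaussPrimitive (-x) = -gaussPrimitive x := by
  have h := intervalIntegral.integral_comp_neg (fun v : ℝ => exp (-v ^ 2)) (a := 0) (b := x)
  simp only [neg_zero, even_two, Even.neg_pow] at h
  rw [gaussPrimitive, intervalIntegral.integral_symm, ← h, gaussPrimitive]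

theorem tendsto_gaussPrimitive_atBot : Tendsto gaussPrimitive atBot (𝓝 (-(√π / 2))) := by
  have := (tendsto_gaussPrimitive_atTop.comp tendsto_neg_atBot_atTop).neg
  refine this.congr fun x => ?_
  simp [gaussPrimitive_neg]

variable {a b : ℝ}

/-- There is an explicit primitive Ψ. Completing the square, b²/t + a²t = (b/√t ± a√t)² ∓ 2ab, so
both error functions in Ψ have the same exponential in their derivative; the contributions of a√t
cancel and those of b/√t add up to t^{-3/2}. -/
theorem integral_subordination (ha : 0 < a) (hb : 0 < b) :
    ∫ t in Ioi (0 : ℝ), t ^ (-(3 / 2) : ℝ) * exp (-(b ^ 2 / t) - a ^ 2 * t) =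
      √π / b * exp (-(2 * a * b)) := by
  let Ψ : ℝ → ℝ := fun t => -(1 / b) * (exp (2 * a * b) * gaussPrimitive (b / √t + a * √t) +
    exp (-(2 * a * b)) * gaussPrimitive (b / √t - a * √t))
  set L₀ : ℝ := -(1 / b) * (exp (2 * a * b) * (√π / 2) + exp (-(2 * a * b)) * (√π / 2))
  set L₁ : ℝ := -(1 / b) * (exp (2 * a * b) * (√π / 2) + exp (-(2 * a * b)) * (-(√π / 2)))
  have hs0 : Tendsto (fun t : ℝ => √t) (𝓝[>] 0) (𝓝[>] 0) := by
    refine tendsto_nhdsWithin_iff.mpr ⟨?_, ?_⟩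
    · have := (Real.continuous_sqrt.tendsto 0).mono_left (nhdsWithin_le_nhds (s := Ioi 0))
      simpa using this
    · filter_upwards [self_mem_nhdsWithin] with t ht
      exact Real.sqrt_pos.mpr ht
  have hs0' : Tendsto (fun t : ℝ => a * √t) (𝓝[>] 0) (𝓝 0) := by
    simpa using (tendsto_nhds_of_tendsto_nhdsWithin hs0).const_mul a
  have hb0 : Tendsto (fun t : ℝ => b / √t) (𝓝[>] 0) atTop := by
    simp_rw [div_eq_mul_inv]
    exact (tendsto_inv_nhdsGT_zero.comp hs0).const_mul_atTop hb
  have hsi : Tendsto (fun t : ℝ => a * √t) atTop atTop :=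
    Real.tendsto_sqrt_atTop.const_mul_atTop ha
  have hbi : Tendsto (fun t : ℝ => b / √t) atTop (𝓝 0) :=
    tendsto_const_nhds.div_atTop Real.tendsto_sqrt_atTop
  have hΨ0 : Tendsto Ψ (𝓝[>] 0) (𝓝 L₀) := by
    refine Tendsto.const_mul _ (Tendsto.add (Tendsto.const_mul _ ?_) (Tendsto.const_mul _ ?_))
    · exact tendsto_gaussPrimitive_atTop.comp (hb0.atTop_add hs0')
    · refine tendsto_gaussPrimitive_atTop.comp ?_
      simp_rw [sub_eq_add_neg]
      exact hb0.atTop_add hs0'.neg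
  have hΨ1 : Tendsto Ψ atTop (𝓝 L₁) := by
    refine Tendsto.const_mul _ (Tendsto.add (Tendsto.const_mul _ ?_) (Tendsto.const_mul _ ?_))
    · exact tendsto_gaussPrimitive_atTop.comp (hbi.add_atTop hsi)
    · refine tendsto_gaussPrimitive_atBot.comp ?_
      simp_rw [sub_eq_add_neg]
      exact hbi.add_atBot (tendsto_neg_atTop_atBot.comp hsi)
  have hderiv : ∀ t ∈ Ioi (0 : ℝ),
      HasDerivAt Ψ (t ^ (-(3 / 2) : ℝ) * exp (-(b ^ 2 / t) - a ^ 2 * t)) t := by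
    intro t ht
    have ht : 0 < t := ht
    have hs : 0 < √t := Real.sqrt_pos.mpr ht
    have hst : √t ^ 2 = t := Real.sq_sqrt ht.le
    have d1 : HasDerivAt (fun t : ℝ => √t) (1 / (2 * √t)) t := Real.hasDerivAt_sqrt ht.ne'
    have d2 : HasDerivAt (fun t : ℝ => b / √t) (-(b * (1 / (2 * √t)) / √t ^ 2)) t := by
      have := (hasDerivAt_const t b).div d1 hs.ne'
      refine this.congr_deriv ?_
      ring
    have dp := (hasDerivAt_gaussPrimitive (b / √t + a * √t)).comp t (d2.add (d1.const_mul a))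
    have dm := (hasDerivAt_gaussPrimitive (b / √t - a * √t)).comp t (d2.sub (d1.const_mul a))
    have := ((dp.const_mul (exp (2 * a * b))).add (dm.const_mul (exp (-(2 * a * b))))).const_mul
      (-(1 / b))
    refine this.congr_deriv ?_
    have e1 : exp (2 * a * b) * exp (-(b / √t + a * √t) ^ 2) = exp (-(b ^ 2 / t) - a ^ 2 * t) := by
      rw [← Real.exp_add]
      congr 1
      field_simp
      rw [hst]
      ring_nf
    have e2 : exp (-(2 * a * b)) * exp (-(b / √t - a * √t) ^ 2) =
        exp (-(b ^ 2 / t) - a ^ 2 * t) := by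
      rw [← Real.exp_add]
      congr 1
      field_simp
      rw [hst]
      ring_nf
    have e3 : t ^ (-(3 / 2) : ℝ) = 1 / (√t * t) := by
      rw [Real.rpow_neg ht.le, show (3 / 2 : ℝ) = 1 / 2 + 1 by norm_num, Real.rpow_add ht,
        Real.rpow_one, ← Real.sqrt_eq_rpow, one_div]
    rw [← mul_assoc, ← mul_assoc, e1, e2, e3, hst]
    field_simp
    ring
  -- At t = 0 division by zero gives Ψ a value unrelated to its right limit, so the endpoint value
  -- is replaced by that limit.
  let g : ℝ → ℝ := Function.update Ψ 0 L₀
  have hcont : ContinuousWithinAt g (Ici 0) 0 := by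
    rw [continuousWithinAt_update_same, Ici_sdiff_left]
    exact hΨ0
  have hgΨ : ∀ t ∈ Ioi (0 : ℝ), g =ᶠ[𝓝 t] Ψ := by
    intro t ht
    filter_upwards [Ioi_mem_nhds ht] with u hu
    exact Function.update_of_ne (ne_of_gt hu) _ _
  have hgt : Tendsto g atTop (𝓝 L₁) := by
    refine hΨ1.congr' ?_
    filter_upwards [eventually_gt_atTop 0] with u hu
    exact (Function.update_of_ne (ne_of_gt hu) _ _).symm
  rw [integral_Ioi_of_hasDerivAt_of_nonneg hcont
    (fun t ht => (hderiv t ht).congr_of_eventuallyEq (hgΨ t ht))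
    (fun t ht => mul_nonneg (Real.rpow_nonneg (le_of_lt ht) _) (exp_pos _).le) hgt]
  simp only [g, Function.update_self, L₀, L₁]
  ring

/-- The Green function as a superposition of heat kernels. -/
theorem integral_heat_kernel {lam : ℝ} (hlam : 0 < lam) {r : ℝ} (hr : 0 < r) :
    ∫ t in Ioi (0 : ℝ), (4 * π * t) ^ (-(3 / 2) : ℝ) * exp (-(lam * t)) *
      exp (-(1 / (4 * t)) * r ^ 2) = exp (-√lam * r) / (4 * π * r) := by
  have h := integral_subordination (Real.sqrt_pos.mpr hlam) (half_pos hr)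
  have e : ∀ t ∈ Ioi (0 : ℝ), (4 * π * t) ^ (-(3 / 2) : ℝ) * exp (-(lam * t)) *
      exp (-(1 / (4 * t)) * r ^ 2) = (4 * π) ^ (-(3 / 2) : ℝ) *
        (t ^ (-(3 / 2) : ℝ) * exp (-((r / 2) ^ 2 / t) - √lam ^ 2 * t)) := by
    intro t ht
    have ht : 0 < t := ht
    rw [Real.mul_rpow (by positivity) ht.le, Real.sq_sqrt hlam.le, mul_assoc, mul_assoc,
      ← Real.exp_add]
    congr 3
    field_simp
    ring
  rw [setIntegral_congr_fun measurableSet_Ioi e, integral_const_mul, h]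
  have e3 : (4 * π) ^ (-(3 / 2) : ℝ) = 1 / (2 * √π * (4 * π)) := by
    rw [Real.rpow_neg (by positivity), show (3 / 2 : ℝ) = 1 / 2 + 1 by norm_num,
      Real.rpow_add (by positivity), Real.rpow_one, ← Real.sqrt_eq_rpow, one_div,
      Real.sqrt_mul (by norm_num), show (4 : ℝ) = 2 ^ 2 by norm_num, Real.sqrt_sq (by norm_num)]
  have hpi : 0 < √π := Real.sqrt_pos.mpr Real.pi_pos
  rw [e3, show -(2 * √lam * (r / 2)) = -√lam * r by ring]
  field_simp

end Subordination

/-! ### The Fourier transform of the Green function -/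

section Green

variable {lam : ℝ}

/-- The heat kernel damped by `exp (-λ t)`. -/
def dampedHeat (lam : ℝ) (x : R3) (t : ℝ) : ℝ :=
  (4 * π * t) ^ (-(3 / 2) : ℝ) * exp (-(lam * t)) * exp (-(1 / (4 * t)) * ‖x‖ ^ 2)

theorem dampedHeat_nonneg (lam : ℝ) (x : R3) {t : ℝ} (ht : 0 < t) : 0 ≤ dampedHeat lam x t := by
  unfold dampedHeat; positivity

theorem green_eq_integral (hlam : 0 < lam) {x : R3} (hx : x ≠ 0) :
    green lam x = ∫ t in Ioi (0 : ℝ), (dampedHeat lam x t : ℂ) := by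
  rw [integral_complex_ofReal, green, ← integral_heat_kernel hlam (norm_pos_iff.mpr hx)]
  rfl

theorem integral_gaussian_R3 {t : ℝ} (ht : 0 < t) :
    ∫ x : R3, exp (-(1 / (4 * t)) * ‖x‖ ^ 2) = (4 * π * t) ^ (3 / 2 : ℝ) := by
  rw [GaussianFourier.integral_rexp_neg_mul_sq_norm (V := R3) (by positivity : 0 < 1 / (4 * t))]
  have : (Module.finrank ℝ R3 : ℝ) = 3 := by simp
  rw [this]
  congr 1
  field_simp

theorem integral_dampedHeat (lam : ℝ) {t : ℝ} (ht : 0 < t) :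
    ∫ x : R3, dampedHeat lam x t = exp (-(lam * t)) := by
  simp only [dampedHeat]
  rw [integral_const_mul, integral_gaussian_R3 ht, mul_assoc, mul_comm (exp _), ← mul_assoc,
    ← Real.rpow_add (by positivity)]
  simp

theorem integrable_dampedHeat (lam : ℝ) {t : ℝ} (ht : 0 < t) :
    Integrable fun x : R3 => dampedHeat lam x t := by
  -- A non-integrable function has integral 0 by convention, whereas this integral has the positive
  -- value exp(−λt).
  by_contra h
  have := integral_dampedHeat lam ht
  rw [integral_undef h] at this
  exact (exp_pos _).ne this

theorem measurable_dampedHeat (lam : ℝ) : Measurable fun q : R3 × ℝ => dampedHeat lam q.1 q.2 := by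
  unfold dampedHeat
  fun_prop

theorem integrable_dampedHeat_prod (hlam : 0 < lam) :
    Integrable (fun q : R3 × ℝ => dampedHeat lam q.1 q.2)
      ((volume : Measure R3).prod (volume.restrict (Ioi 0))) := by
  rw [integrable_prod_iff' (measurable_dampedHeat lam).aestronglyMeasurable]
  constructor
  · filter_upwards [ae_restrict_mem measurableSet_Ioi] with t ht
    exact integrable_dampedHeat lam ht
  · have h : IntegrableOn (fun t => exp (-lam * t)) (Ioi 0) := exp_neg_integrableOn_Ioi 0 hlam
    refine h.congr ?_
    filter_upwards [ae_restrict_mem measurableSet_Ioi] with t ht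
    rw [← neg_mul_eq_neg_mul, ← integral_dampedHeat lam ht]
    refine integral_congr_ae (Eventually.of_forall fun x => ?_)
    simp only [Real.norm_eq_abs]
    rw [abs_of_nonneg (dampedHeat_nonneg lam x ht)]

theorem ae_ne_zero : ∀ᵐ x : R3, x ≠ 0 := by
  rw [ae_iff]
  simp

theorem integrable_green (hlam : 0 < lam) : Integrable (green lam) := by
  refine (integrable_dampedHeat_prod hlam).ofReal.integral_prod_left.congr ?_
  filter_upwards [ae_ne_zero] with x hx
  exact (green_eq_integral hlam hx).symm

/-- In polar coordinates the volume factor r² cancels the singularity r⁻² of the square, leaving a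
decaying exponential. -/
theorem memLp_green (hlam : 0 < lam) : MemLp (green lam) 2 := by
  have hl := Real.sqrt_pos.mpr hlam
  rw [memLp_two_iff_integrable_sq_norm (integrable_green hlam).aestronglyMeasurable]
  have h := integrable_fun_norm_addHaar (E := R3) (volume : Measure R3)
    (f := fun r : ℝ => (exp (-√lam * r) / (4 * π * r)) ^ 2)
  have h2 : Integrable (fun x : R3 => (exp (-√lam * ‖x‖) / (4 * π * ‖x‖)) ^ 2) := by
    refine h.mpr ?_
    have h3 : IntegrableOn (fun r => ((4 * π) ^ 2)⁻¹ * exp (-(2 * √lam) * r)) (Ioi 0) :=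
      (exp_neg_integrableOn_Ioi 0 (by positivity)).const_mul _
    refine h3.congr_fun (fun r hr => ?_) measurableSet_Ioi
    have hr : 0 < r := hr
    simp only [finrank_euclideanSpace, Fintype.card_fin, smul_eq_mul]
    rw [div_pow, ← Real.exp_nat_mul]
    field_simp
    congr 1
    push_cast
    ring_nf
  refine h2.congr (Eventually.of_forall fun x => ?_)
  simp only [green, Complex.norm_real, Real.norm_eq_abs, sq_abs]

theorem fourier_dampedHeat {t : ℝ} (ht : 0 < t) (ξ : R3) :
    ∫ x : R3, Real.fourierChar (-inner ℝ x ξ) • (dampedHeat lam x t : ℂ) =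
      ((exp (-((2 * π) ^ 2 * ‖ξ‖ ^ 2 + lam) * t) : ℝ) : ℂ) := by
  have hb : 0 < (((1 / (4 * t) : ℝ)) : ℂ).re := by
    rw [Complex.ofReal_re]; positivity
  have h := fourier_gaussian_innerProductSpace hb ξ
  rw [Real.fourier_eq] at h
  have e : ∀ x : R3, Real.fourierChar (-inner ℝ x ξ) • (dampedHeat lam x t : ℂ) =
      (((4 * π * t) ^ (-(3 / 2) : ℝ) * exp (-(lam * t)) : ℝ) : ℂ) *
        (Real.fourierChar (-inner ℝ x ξ) •
          Complex.exp (-((1 / (4 * t) : ℝ) : ℂ) * (‖x‖ : ℂ) ^ 2)) := by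
    intro x
    rw [mul_smul_comm]
    congr 1
    simp only [dampedHeat]
    push_cast
    ring
  simp_rw [e]
  rw [integral_const_mul, h]
  have e1 : ((π : ℂ) / ((1 / (4 * t) : ℝ) : ℂ)) ^ ((Module.finrank ℝ R3 : ℂ) / 2) =
      (((4 * π * t) ^ (3 / 2 : ℝ) : ℝ) : ℂ) := by
    rw [Complex.ofReal_cpow (by positivity)]
    congr 1
    · push_cast; field_simp
    · simp
  have e2 : Complex.exp (-(π : ℂ) ^ 2 * (‖ξ‖ : ℂ) ^ 2 / ((1 / (4 * t) : ℝ) : ℂ)) =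
      ((exp (-(2 * π) ^ 2 * ‖ξ‖ ^ 2 * t) : ℝ) : ℂ) := by
    push_cast
    congr 1
    field_simp
    ring
  rw [e1, e2, ← Complex.ofReal_mul, ← Complex.ofReal_mul]
  congr 1
  calc _ = ((4 * π * t) ^ (-(3 / 2) : ℝ) * (4 * π * t) ^ (3 / 2 : ℝ)) *
        (exp (-(lam * t)) * exp (-(2 * π) ^ 2 * ‖ξ‖ ^ 2 * t)) := by ring
    _ = _ := by
      rw [← Real.rpow_add (by positivity), ← Real.exp_add, neg_add_cancel, Real.rpow_zero, one_mul]
      congr 1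
      ring

/-- Fubini over the heat-kernel representation: each Gaussian transforms to exp(−(4π²|ξ|² + λ)t),
and the integral over t is the reciprocal of the rate. -/
theorem fourier_green (hlam : 0 < lam) (ξ : R3) :
    𝓕 (green lam) ξ = ((((2 * π) ^ 2 * ‖ξ‖ ^ 2 + lam)⁻¹ : ℝ) : ℂ) := by
  have hpos : 0 < (2 * π) ^ 2 * ‖ξ‖ ^ 2 + lam := by positivity
  rw [Real.fourier_eq]
  have e : ∫ x : R3, Real.fourierChar (-inner ℝ x ξ) • green lam x =
      ∫ x : R3, ∫ t in Ioi (0 : ℝ), Real.fourierChar (-inner ℝ x ξ) • (dampedHeat lam x t : ℂ) := by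
    refine integral_congr_ae ?_
    filter_upwards [ae_ne_zero] with x hx
    simp only [Circle.smul_def, smul_eq_mul]
    rw [green_eq_integral hlam hx, integral_const_mul]
  have hint : Integrable (fun q : R3 × ℝ =>
      Real.fourierChar (-inner ℝ q.1 ξ) • (dampedHeat lam q.1 q.2 : ℂ))
      ((volume : Measure R3).prod (volume.restrict (Ioi 0))) := by
    refine Integrable.mono ((integrable_dampedHeat_prod hlam).ofReal (𝕜 := ℂ)) ?_ (Eventually.of_forall fun q => ?_)
    · refine AEStronglyMeasurable.smul (𝕜 := Circle) ?_
        (Complex.measurable_ofReal.comp (measurable_dampedHeat lam)).aestronglyMeasurable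
      refine Continuous.aestronglyMeasurable ?_
      exact Real.continuous_fourierChar.comp (by fun_prop)
    · simp
  rw [e, integral_integral_swap hint]
  have e2 : ∀ t ∈ Ioi (0 : ℝ), (∫ x : R3, Real.fourierChar (-inner ℝ x ξ) •
      (dampedHeat lam x t : ℂ)) = ((exp (-((2 * π) ^ 2 * ‖ξ‖ ^ 2 + lam) * t) : ℝ) : ℂ) :=
    fun t ht => fourier_dampedHeat ht ξ
  rw [setIntegral_congr_fun measurableSet_Ioi e2, integral_complex_ofReal]
  congr 1
  rw [integral_exp_mul_Ioi (by linarith), mul_zero, Real.exp_zero, neg_div_neg_eq, one_div]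

end Green

/-! ### The unitary Fourier transform `hat` -/

section Hat

/-- The constant `(2π)^{-3/2}`. -/
def gam : ℝ := ((2 * π) ^ (3 / 2 : ℝ))⁻¹

theorem gam_pos : 0 < gam := by unfold gam; positivity

theorem gam_sq : gam ^ 2 = ((2 * π) ^ 3)⁻¹ := by
  rw [gam, inv_pow, ← Real.rpow_natCast, ← Real.rpow_mul (by positivity),
    ← Real.rpow_natCast (2 * π) 3]
  norm_num

theorem hat_apply (F : L2) (p : R3) : hat F p = (gam : ℂ) * (𝓕 F : L2) ((2 * π)⁻¹ • p) := rfl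

theorem two_pi_inv_ne : (2 * π)⁻¹ ≠ 0 := by positivity

theorem ae_comp_smul {P : R3 → Prop} (h : ∀ᵐ x, P x) {c : ℝ} (hc : c ≠ 0) :
    ∀ᵐ x, P (c • x) := by
  have hq : Measure.QuasiMeasurePreserving (fun x : R3 => c • x) volume volume := by
    refine ⟨measurable_const_smul c, ?_⟩
    rw [Measure.map_addHaar_smul _ hc]
    exact Measure.smul_absolutelyContinuous
  exact hq.ae h

theorem memLp_comp_smul {f : R3 → ℂ} (hf : MemLp f 2) {c : ℝ} (hc : c ≠ 0) :
    MemLp (fun x => f (c • x)) 2 := by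
  have h : MemLp f 2 (Measure.map (fun x : R3 => c • x) volume) := by
    rw [Measure.map_addHaar_smul _ hc]
    exact hf.smul_measure ENNReal.ofReal_ne_top
  exact h.comp_of_map (measurable_const_smul c).aemeasurable

theorem ae_comp_smul_iff {P : R3 → Prop} {c : ℝ} (hc : c ≠ 0) :
    (∀ᵐ x, P (c • x)) ↔ ∀ᵐ x, P x := by
  refine ⟨fun h => ?_, fun h => ae_comp_smul h hc⟩
  filter_upwards [ae_comp_smul h (inv_ne_zero hc)] with x hx
  rwa [smul_inv_smul₀ hc] at hx

theorem memLp_comp_smul_iff {f : R3 → ℂ} {c : ℝ} (hc : c ≠ 0) :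
    MemLp (fun x => f (c • x)) 2 ↔ MemLp f 2 := by
  refine ⟨fun h => ?_, fun h => memLp_comp_smul h hc⟩
  have := memLp_comp_smul h (inv_ne_zero hc)
  simpa only [smul_inv_smul₀ hc] using this

theorem memLp_hat (F : L2) : MemLp (hat F) 2 :=
  (memLp_comp_smul (Lp.memLp _) two_pi_inv_ne).const_mul _

theorem hat_add (F G : L2) : hat (F + G) =ᵐ[volume] fun p => hat F p + hat G p := by
  have h : (𝓕 (F + G) : L2) = 𝓕 F + 𝓕 G := FourierTransform.fourier_add F G
  filter_upwards [ae_comp_smul (Lp.coeFn_add (𝓕 F : L2) (𝓕 G)) two_pi_inv_ne] with p hp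
  simp only [hat_apply, h, hp, Pi.add_apply, mul_add]

theorem hat_smul (c : ℂ) (F : L2) : hat (c • F) =ᵐ[volume] fun p => c * hat F p := by
  have h : (𝓕 (c • F) : L2) = c • 𝓕 F := FourierTransform.fourier_smul c F
  filter_upwards [ae_comp_smul (Lp.coeFn_smul c (𝓕 F : L2)) two_pi_inv_ne] with p hp
  simp only [hat_apply, h, hp, Pi.smul_apply, smul_eq_mul]
  ring

theorem hat_sub (F G : L2) : hat (F - G) =ᵐ[volume] fun p => hat F p - hat G p := by
  have h : F - G = F + (-1 : ℂ) • G := by rw [neg_one_smul, sub_eq_add_neg]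
  rw [h]
  filter_upwards [hat_add F ((-1 : ℂ) • G), hat_smul (-1) G] with p h1 h2
  rw [h1, h2]
  ring

theorem integral_comp_two_pi_inv (f : R3 → ℂ) :
    ∫ p : R3, f ((2 * π)⁻¹ • p) = ((2 * π) ^ 3 : ℝ) * ∫ ξ, f ξ := by
  rw [Measure.integral_comp_smul]
  have : (Module.finrank ℝ R3) = 3 := by simp
  rw [this, inv_pow, inv_inv, abs_of_pos (by positivity), Complex.real_smul]

/-- Plancherel in the normalization of `hat`: the Jacobian (2π)³ of the rescaling cancels against
`gam` squared. -/
theorem inner_eq_integral_hat (F G : L2) :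
    inner ℂ F G = ∫ p, (starRingEnd ℂ) (hat F p) * hat G p := by
  rw [← Lp.inner_fourier_eq, L2.inner_def]
  have h := integral_comp_two_pi_inv fun ξ => inner ℂ ((𝓕 F : L2) ξ) ((𝓕 G : L2) ξ)
  have e : ∀ p, (starRingEnd ℂ) (hat F p) * hat G p = (gam ^ 2 : ℝ) *
      inner ℂ ((𝓕 F : L2) ((2 * π)⁻¹ • p)) ((𝓕 G : L2) ((2 * π)⁻¹ • p)) := by
    intro p
    simp only [hat_apply, RCLike.inner_apply, map_mul, Complex.conj_ofReal]
    push_cast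
    ring
  simp_rw [e]
  rw [integral_const_mul, h, ← mul_assoc, ← Complex.ofReal_mul, gam_sq,
    inv_mul_cancel₀ (by positivity), Complex.ofReal_one, one_mul]

theorem exists_hat_eq {h : R3 → ℂ} (hh : MemLp h 2) : ∃ F : L2, hat F =ᵐ[volume] h := by
  have h1 : MemLp (fun ξ : R3 => (gam : ℂ)⁻¹ * h ((2 * π) • ξ)) 2 :=
    (memLp_comp_smul hh (by positivity)).const_mul _
  refine ⟨𝓕⁻ (h1.toLp _), ?_⟩
  have h2 : (𝓕 (𝓕⁻ (h1.toLp _)) : L2) = h1.toLp _ := FourierTransform.fourier_fourierInv_eq _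
  filter_upwards [ae_comp_smul h1.coeFn_toLp two_pi_inv_ne] with p hp
  rw [hat_apply, h2, hp, smul_inv_smul₀ (by positivity), mul_inv_cancel_left₀]
  exact_mod_cast gam_pos.ne'

theorem hat_congr_iff {F G : L2} :
    hat F =ᵐ[volume] hat G ↔ (𝓕 F : L2) = 𝓕 G := by
  rw [Lp.ext_iff]
  refine Iff.trans ?_ (ae_comp_smul_iff two_pi_inv_ne)
  have hg : (gam : ℂ) ≠ 0 := by exact_mod_cast gam_pos.ne'
  simp only [EventuallyEq, hat_apply, mul_right_inj' hg]

theorem hat_injective {F G : L2} (h : hat F =ᵐ[volume] hat G) : F = G := by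
  have := congrArg (fun x : L2 => (𝓕⁻ x : L2)) (hat_congr_iff.mp h)
  simpa [FourierTransform.fourierInv_fourier_eq] using this

theorem norm_sq_eq_integral_hat (F : L2) : ‖F‖ ^ 2 = ∫ p, ‖hat F p‖ ^ 2 := by
  have h := inner_eq_integral_hat F F
  rw [inner_self_eq_norm_sq_to_K] at h
  have e : ∀ p, (starRingEnd ℂ) (hat F p) * hat F p = ((‖hat F p‖ ^ 2 : ℝ) : ℂ) := by
    intro p
    rw [Complex.conj_mul']
    push_cast
    rfl
  simp_rw [e] at h
  rw [integral_complex_ofReal] at h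
  apply Complex.ofReal_injective
  rw [← h]
  push_cast
  rfl

/-- Comparable weights. -/
theorem memLp_weight_iff {v w : R3 → ℝ} (hv : Continuous v) (hw : Continuous w) {c C : ℝ}
    (hvpos : ∀ p, 0 < v p) (hwpos : ∀ p, 0 < w p)
    (h1 : ∀ p, v p ≤ C * w p) (h2 : ∀ p, w p ≤ c * v p) (f : R3 → ℂ) :
    MemLp (fun p => (v p : ℂ) * f p) 2 ↔ MemLp (fun p => (w p : ℂ) * f p) 2 := by
  have key : ∀ {v w : R3 → ℝ} (_ : Continuous v) (_ : Continuous w) {C : ℝ}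
      (_ : ∀ p, 0 < v p) (_ : ∀ p, 0 < w p) (_ : ∀ p, v p ≤ C * w p),
      MemLp (fun p => (w p : ℂ) * f p) 2 → MemLp (fun p => (v p : ℂ) * f p) 2 := by
    intro v w hv hw C hv0 hw0 hC h
    have hm : AEStronglyMeasurable (fun p => (v p : ℂ) * f p) (volume : Measure R3) := by
      have h3 : Continuous fun p => ((v p / w p : ℝ) : ℂ) :=
        Complex.continuous_ofReal.comp (hv.div hw fun p => (hw0 p).ne')
      refine (h3.aestronglyMeasurable.mul h.1).congr (Eventually.of_forall fun p => ?_)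
      have : (w p : ℂ) ≠ 0 := by exact_mod_cast (hw0 p).ne'
      simp only [Pi.mul_apply]
      push_cast
      field_simp
    refine h.of_le_mul (c := C) hm (Eventually.of_forall fun p => ?_)
    rw [norm_mul, norm_mul, Complex.norm_real, Complex.norm_real, Real.norm_eq_abs,
      Real.norm_eq_abs, abs_of_pos (hv0 p), abs_of_pos (hw0 p), ← mul_assoc]
    exact mul_le_mul_of_nonneg_right (hC p) (norm_nonneg _)
  exact ⟨key hw hv hwpos hvpos h2, key hv hw hvpos hwpos h1⟩

/-- The weights 1 + |p/2π|² and |p|² + λ are comparable, so the parameter λ may be chosen freely in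
the Sobolev condition. -/
theorem mem_Hs_iff {s lam : ℝ} (hs : 0 ≤ s) (hlam : 0 < lam) (F : L2) :
    F ∈ Hs s ↔ MemLp (fun p => (((‖p‖ ^ 2 + lam) ^ (s / 2) : ℝ) : ℂ) * hat F p) 2 := by
  rw [memSobolev_iff_memLp_fourier, ← memLp_comp_smul_iff two_pi_inv_ne]
  have hg : (gam : ℂ) ≠ 0 := by exact_mod_cast gam_pos.ne'
  have hpi : 1 ≤ (2 * π) ^ 2 := by nlinarith [Real.pi_gt_three]
  have hn : ∀ p : R3, ‖(2 * π)⁻¹ • p‖ ^ 2 = ((2 * π) ^ 2)⁻¹ * ‖p‖ ^ 2 := by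
    intro p
    rw [norm_smul, mul_pow, Real.norm_eq_abs, sq_abs, inv_pow]
  have hcont : ∀ {u : R3 → ℝ}, Continuous u → (∀ p, 0 < u p) →
      Continuous fun p => u p ^ (s / 2) := fun hu hu0 =>
    hu.rpow_const fun p => Or.inl (hu0 p).ne'
  have hpos1 : ∀ p : R3, 0 < 1 + ‖(2 * π)⁻¹ • p‖ ^ 2 := fun p => by positivity
  have hpos2 : ∀ p : R3, 0 < ‖p‖ ^ 2 + lam := fun p => by positivity
  set D := (2 * π) ^ 2 with hD
  have hDpos : 0 < D := by positivity
  rw [memLp_weight_iff (v := fun p => (1 + ‖(2 * π)⁻¹ • p‖ ^ 2) ^ (s / 2))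
    (w := fun p => (‖p‖ ^ 2 + lam) ^ (s / 2)) (C := ((1 + lam⁻¹)) ^ (s / 2))
    (c := ((D + lam)) ^ (s / 2))
    (hcont (by fun_prop) hpos1) (hcont (by fun_prop) hpos2)
    (fun p => Real.rpow_pos_of_pos (hpos1 p) _) (fun p => Real.rpow_pos_of_pos (hpos2 p) _)]
  · constructor
    · intro h
      refine (h.const_mul (gam : ℂ)).ae_eq (Eventually.of_forall fun p => ?_)
      simp only [hat_apply]
      ring
    · intro h
      refine (h.const_mul (gam : ℂ)⁻¹).ae_eq (Eventually.of_forall fun p => ?_)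
      simp only [hat_apply]
      field_simp
  · intro p
    rw [← Real.mul_rpow (by positivity) (hpos2 p).le]
    refine Real.rpow_le_rpow (hpos1 p).le ?_ (by positivity)
    rw [hn p]
    have : D⁻¹ ≤ 1 := inv_le_one_of_one_le₀ hpi
    have h3 : D⁻¹ * ‖p‖ ^ 2 ≤ 1 * ‖p‖ ^ 2 := by gcongr
    have h4 : lam⁻¹ * lam = 1 := inv_mul_cancel₀ hlam.ne'
    have h5 : 0 ≤ lam⁻¹ * ‖p‖ ^ 2 := by positivity
    nlinarith
  · intro p
    rw [← Real.mul_rpow (by positivity) (hpos1 p).le]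
    refine Real.rpow_le_rpow (hpos2 p).le ?_ (by positivity)
    rw [hn p]
    have h3 : D * (D⁻¹ * ‖p‖ ^ 2) = ‖p‖ ^ 2 := by rw [mul_inv_cancel_left₀ hDpos.ne']
    have h5 : 0 ≤ lam * (D⁻¹ * ‖p‖ ^ 2) := by positivity
    nlinarith

end Hat

/-! ### The operator `-Δ_α` on the Fourier side -/

section FourierForm

theorem two_pi_sq_mul_norm_sq (p : R3) : (2 * π) ^ 2 * ‖(2 * π)⁻¹ • p‖ ^ 2 = ‖p‖ ^ 2 := by
  rw [← mul_pow, norm_smul, Real.norm_eq_abs, abs_of_pos (by positivity), ← mul_assoc,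
    mul_inv_cancel₀ (by positivity), one_mul]

theorem hat_green {lam : ℝ} (hlam : 0 < lam) :
    hat ((memLp_green hlam).toLp (green lam)) =ᵐ[volume]
      fun p => ((gam / (‖p‖ ^ 2 + lam) : ℝ) : ℂ) := by
  have h := fourier_ae_eq (integrable_green hlam) (memLp_green hlam).coeFn_toLp
  filter_upwards [ae_comp_smul h two_pi_inv_ne] with p hp
  rw [hat_apply, hp, fourier_green hlam, ← Complex.ofReal_mul, div_eq_mul_inv,
    two_pi_sq_mul_norm_sq]

theorem ae_eq_add_green_iff {lam : ℝ} (hlam : 0 < lam) (g F : L2) (q : ℂ) :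
    g =ᵐ[volume] (fun x => F x + q * green lam x) ↔
      hat g =ᵐ[volume] fun p => hat F p + q * ((gam / (‖p‖ ^ 2 + lam) : ℝ) : ℂ) := by
  set G : L2 := (memLp_green hlam).toLp (green lam) with hG
  have h1 : (F + q • G : L2) =ᵐ[volume] fun x => F x + q * green lam x := by
    filter_upwards [Lp.coeFn_add F (q • G), Lp.coeFn_smul q G, (memLp_green hlam).coeFn_toLp]
      with x h1 h2 h3
    rw [h1, Pi.add_apply, h2, Pi.smul_apply, h3, smul_eq_mul]
  have h2 : hat (F + q • G) =ᵐ[volume]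
      fun p => hat F p + q * ((gam / (‖p‖ ^ 2 + lam) : ℝ) : ℂ) := by
    filter_upwards [hat_add F (q • G), hat_smul q G, hat_green hlam] with p h1 h2 h3
    rw [h1, h2, h3]
  constructor
  · intro h
    have : g = F + q • G := Lp.ext (h.trans h1.symm)
    rwa [this]
  · intro h
    have : g = F + q • G := hat_injective (h.trans h2.symm)
    rwa [this]

/-- The order 2 exceeds half the dimension, 3/2. This makes the value at the origin an absolutely
convergent integral. -/
theorem integrable_fourier_of_mem_Hs_two {f : L2} (hf : f ∈ Hs 2) :
    Integrable (𝓕 f : L2) := by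
  obtain ⟨v, hv⟩ := TemperedDistribution.MemSobolev.fourier_memL1 (s := 2)
    (by simp; norm_num) (show TemperedDistribution.MemSobolev 2 2 (f : 𝓢'(R3, ℂ)) from hf)
  rw [Lp.fourier_toTemperedDistribution_eq] at hv
  have hae : (𝓕 f : L2) =ᵐ[volume] v := by
    refine ae_eq_of_integral_contDiff_smul_eq ((Lp.memLp _).locallyIntegrable (by norm_num))
      ((Lp.memLp _).locallyIntegrable (by norm_num)) ?_
    intro g hg hgc
    have hg₁ : HasCompactSupport (Complex.ofRealCLM ∘ g) := hgc.comp_left rfl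
    have hg₂ : ContDiff ℝ (⊤ : ℕ∞) (Complex.ofRealCLM ∘ g) := by fun_prop
    have := congrArg (fun T => T (hg₁.toSchwartzMap hg₂)) hv
    simpa [Lp.toTemperedDistribution_apply] using this
  exact ((memLp_one_iff_integrable).mp (Lp.memLp v)).congr hae.symm

theorem continuous_fourierInv {f : R3 → ℂ} (hf : Integrable f) : Continuous (𝓕⁻ f) := by
  have := (fourierChar_continuous_fourier hf).comp continuous_neg
  refine this.congr fun x => ?_
  rw [Real.fourierInv_eq_fourier_neg]; rfl

/-- The value at zero of the continuous representative of an `H²` function. -/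
theorem exists_continuous_ae_eq_of_mem_Hs_two {f : L2} (hf : f ∈ Hs 2) :
    ∃ f₀ : R3 → ℂ, Continuous f₀ ∧ f =ᵐ[volume] f₀ ∧ f₀ 0 = gam * ∫ p, hat f p := by
  have hi := integrable_fourier_of_mem_Hs_two hf
  refine ⟨𝓕⁻ ((𝓕 f : L2) : R3 → ℂ), continuous_fourierInv hi, ?_, ?_⟩
  · have := fourierInv_ae_eq (h := (𝓕 f : L2)) hi (ae_eq_refl _)
    rwa [FourierTransform.fourierInv_fourier_eq] at this
  · rw [Real.fourierInv_eq]
    have h := integral_comp_two_pi_inv (𝓕 f : L2)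
    simp only [hat_apply]
    rw [integral_const_mul, h, ← mul_assoc, ← mul_assoc, ← Complex.ofReal_mul, ← pow_two, gam_sq,
      ← Complex.ofReal_mul, inv_mul_cancel₀ (by positivity), Complex.ofReal_one, one_mul]
    simp

theorem toTemperedDistribution_eq_sub_laplacian_iff (μ : ℝ) (f k : L2) :
    (k : 𝓢'(R3, ℂ)) = (μ : ℂ) • (f : 𝓢'(R3, ℂ)) - Δ (f : 𝓢'(R3, ℂ)) ↔
      hat k =ᵐ[volume] fun p => ((‖p‖ ^ 2 + μ : ℝ) : ℂ) * hat f p := by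
  set m : R3 → ℂ := fun x => Complex.ofReal (‖x‖ ^ 2) with hm
  have hmg : m.HasTemperateGrowth := by fun_prop
  have hF : 𝓕 ((μ : ℂ) • (f : 𝓢'(R3, ℂ)) - Δ (f : 𝓢'(R3, ℂ))) =
      TemperedDistribution.smulLeftCLM ℂ (fun x => (μ : ℂ) + ((2 * π) ^ 2 : ℝ) * m x)
        ((𝓕 f : L2) : 𝓢'(R3, ℂ)) := by
    rw [TemperedDistribution.laplacian_eq_fourierMultiplierCLM,
      TemperedDistribution.fourierMultiplierCLM_apply]
    have e : (fun x => (μ : ℂ) + ((2 * π) ^ 2 : ℝ) * m x) =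
      (fun _ => (μ : ℂ)) + (((2 * π) ^ 2 : ℝ) : ℂ) • m := by ext x; simp
    rw [e, TemperedDistribution.smulLeftCLM_add (by fun_prop) (by fun_prop),
      TemperedDistribution.smulLeftCLM_smul hmg, add_apply, smul_apply,
      TemperedDistribution.smulLeftCLM_const, ← Lp.fourier_toTemperedDistribution_eq, sub_eq_add_neg,
      FourierTransform.fourier_add, FourierTransform.fourier_smul]
    congr 1
    have hs : ∀ T : 𝓢'(R3, ℂ), -(-(2 * π) ^ 2 • T) = (((2 * π) ^ 2 : ℝ) : ℂ) • T := by
      intro T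
      have : (-(2 * π) ^ 2) • T = ((-(2 * π) ^ 2 : ℝ) : ℂ) • T := rfl
      rw [this]
      ext u
      change -((((-(2 * π) ^ 2 : ℝ)) : ℂ) * T u) = (((2 * π) ^ 2 : ℝ) : ℂ) * T u
      push_cast
      ring
    rw [hs, FourierTransform.fourier_smul, FourierTransform.fourier_fourierInv_eq]
  have hmg2 : (fun x => (μ : ℂ) + ((2 * π) ^ 2 : ℝ) * m x).HasTemperateGrowth := by fun_prop
  have h1 : (k : 𝓢'(R3, ℂ)) = (μ : ℂ) • (f : 𝓢'(R3, ℂ)) - Δ (f : 𝓢'(R3, ℂ)) ↔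
      TemperedDistribution.smulLeftCLM ℂ (fun x => (μ : ℂ) + ((2 * π) ^ 2 : ℝ) * m x)
        ((𝓕 f : L2) : 𝓢'(R3, ℂ)) = ((𝓕 k : L2) : 𝓢'(R3, ℂ)) := by
    rw [← hF, ← Lp.fourier_toTemperedDistribution_eq]
    constructor
    · intro h
      rw [h]
    · intro h
      have := congrArg (fun T : 𝓢'(R3, ℂ) => 𝓕⁻ T) h
      simpa only [FourierTransform.fourierInv_fourier_eq] using this.symm
  rw [h1, smulLeftCLM_eq_iff hmg2, EventuallyEq, ← ae_comp_smul_iff two_pi_inv_ne]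
  have hg : (gam : ℂ) ≠ 0 := by exact_mod_cast gam_pos.ne'
  refine eventually_congr (Eventually.of_forall fun p => ?_)
  simp only [hat_apply, hm]
  rw [← Complex.ofReal_mul, two_pi_sq_mul_norm_sq, ← Complex.ofReal_add, add_comm μ]
  constructor
  · intro h
    rw [h]; ring
  · intro h
    refine mul_left_cancel₀ hg ?_
    rw [h]; ring

/-- The continuous representative is unique, so f(0) becomes the integral of the transform, and the
distributional equation becomes multiplication by p² + μ. -/
theorem pointLaplacian_iff {α : ℝ} {g h : L2} :
    PointLaplacian α g h ↔ ∃ μ : ℝ, 0 < μ ∧ ∃ f ∈ Hs 2,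
      hat g =ᵐ[volume] (fun p => hat f p + (gam * ∫ p, hat f p) / (coupling α μ : ℂ) *
        ((gam / (‖p‖ ^ 2 + μ) : ℝ) : ℂ)) ∧
      hat (h + (μ : ℂ) • g) =ᵐ[volume] fun p => ((‖p‖ ^ 2 + μ : ℝ) : ℂ) * hat f p := by
  constructor
  · rintro ⟨μ, hμ, f, f₀, hf, hc, hff, hg, hd⟩
    obtain ⟨f₁, hc₁, hff₁, h0⟩ := exists_continuous_ae_eq_of_mem_Hs_two hf
    have hf01 : f₀ = f₁ :=
      MeasureTheory.Measure.eq_of_ae_eq (hff.symm.trans hff₁) hc hc₁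
    refine ⟨μ, hμ, f, hf, ?_, (toTemperedDistribution_eq_sub_laplacian_iff μ f _).mp hd⟩
    rw [← ae_eq_add_green_iff hμ, ← h0, ← hf01]
    filter_upwards [hg, hff] with x h1 h2
    rw [h1, h2]
  · rintro ⟨μ, hμ, f, hf, hg, hd⟩
    obtain ⟨f₁, hc₁, hff₁, h0⟩ := exists_continuous_ae_eq_of_mem_Hs_two hf
    rw [← ae_eq_add_green_iff hμ, ← h0] at hg
    refine ⟨μ, hμ, f, f₁, hf, hc₁, hff₁, ?_,
      (toTemperedDistribution_eq_sub_laplacian_iff μ f _).mpr hd⟩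
    filter_upwards [hg, hff₁] with x h1 h2
    rw [h1, h2]

end FourierForm

/-! ### Integrals of products of free resolvents -/

section FreeIntegrals

/-- Primitives built from arctan(r/a): partial fractions when a ≠ b, and a separate primitive with a
rational correction when a = b. -/
theorem integral_radial_aux {a b : ℝ} (ha : 0 < a) (hb : 0 < b) :
    IntegrableOn (fun r : ℝ => r ^ 2 * ((r ^ 2 + a ^ 2)⁻¹ * (r ^ 2 + b ^ 2)⁻¹)) (Ioi 0) ∧
      ∫ r in Ioi (0 : ℝ), r ^ 2 * ((r ^ 2 + a ^ 2)⁻¹ * (r ^ 2 + b ^ 2)⁻¹) =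
        π / (2 * (a + b)) := by
  have hat : ∀ {c : ℝ}, 0 < c → Tendsto (fun r : ℝ => arctan (r / c)) atTop (𝓝 (π / 2)) := by
    intro c hc
    exact (tendsto_nhds_of_tendsto_nhdsWithin tendsto_arctan_atTop).comp
      (tendsto_id.atTop_div_const hc)
  have had : ∀ {c : ℝ}, 0 < c → ∀ r : ℝ,
      HasDerivAt (fun r : ℝ => arctan (r / c)) (c * (r ^ 2 + c ^ 2)⁻¹) r := by
    intro c hc r
    have := (hasDerivAt_arctan (r / c)).comp r ((hasDerivAt_id r).div_const c)
    refine this.congr_deriv ?_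
    have : r ^ 2 + c ^ 2 ≠ 0 := by positivity
    have : 1 + (r / c) ^ 2 ≠ 0 := by positivity
    field_simp
    ring
  rcases ne_or_eq a b with hab | rfl
  · have hab2 : a ^ 2 - b ^ 2 ≠ 0 := by
      rw [sq_sub_sq]
      exact mul_ne_zero (by positivity) (sub_ne_zero.mpr hab)
    have hd : ∀ r ∈ Ici (0 : ℝ), HasDerivAt
        (fun r : ℝ => (a ^ 2 - b ^ 2)⁻¹ * (a * arctan (r / a) - b * arctan (r / b)))
        (r ^ 2 * ((r ^ 2 + a ^ 2)⁻¹ * (r ^ 2 + b ^ 2)⁻¹)) r := by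
      intro r _
      refine ((((had ha r).const_mul a).sub ((had hb r).const_mul b)).const_mul _).congr_deriv ?_
      have : r ^ 2 + a ^ 2 ≠ 0 := by positivity
      have : r ^ 2 + b ^ 2 ≠ 0 := by positivity
      field_simp
      ring
    have ht : Tendsto (fun r : ℝ => (a ^ 2 - b ^ 2)⁻¹ * (a * arctan (r / a) - b * arctan (r / b)))
        atTop (𝓝 ((a ^ 2 - b ^ 2)⁻¹ * (a * (π / 2) - b * (π / 2)))) :=
      (((hat ha).const_mul a).sub ((hat hb).const_mul b)).const_mul _
    refine ⟨integrableOn_Ioi_deriv_of_nonneg' hd (fun r _ => by positivity) ht, ?_⟩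
    rw [integral_Ioi_of_hasDerivAt_of_nonneg' hd (fun r _ => by positivity) ht]
    simp only [zero_div, arctan_zero, mul_zero, sub_zero]
    have : a - b ≠ 0 := sub_ne_zero.mpr hab
    have : a + b ≠ 0 := by positivity
    rw [sq_sub_sq]
    field_simp
  · have hd : ∀ r ∈ Ici (0 : ℝ), HasDerivAt
        (fun r : ℝ => (2 * a)⁻¹ * arctan (r / a) - r / (2 * (r ^ 2 + a ^ 2)))
        (r ^ 2 * ((r ^ 2 + a ^ 2)⁻¹ * (r ^ 2 + a ^ 2)⁻¹)) r := by
      intro r _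
      have hne : r ^ 2 + a ^ 2 ≠ 0 := by positivity
      have h1 : HasDerivAt (fun r : ℝ => 2 * (r ^ 2 + a ^ 2)) (2 * (2 * r)) r := by
        have := (((hasDerivAt_id r).pow 2).add_const (a ^ 2)).const_mul 2
        refine this.congr_deriv ?_
        simp
      refine (((had ha r).const_mul _).sub ((hasDerivAt_id r).div h1 (by positivity))).congr_deriv ?_
      simp only [id]
      field_simp
      ring
    have hz : Tendsto (fun r : ℝ => r / (2 * (r ^ 2 + a ^ 2))) atTop (𝓝 0) := by
      have h0 : Tendsto (fun r : ℝ => r⁻¹) atTop (𝓝 0) := tendsto_inv_atTop_zero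
      refine squeeze_zero' ?_ ?_ h0
      · filter_upwards [eventually_gt_atTop 0] with r hr
        positivity
      · filter_upwards [eventually_gt_atTop 0] with r hr
        rw [div_le_iff₀ (by positivity)]
        have : r⁻¹ * (2 * (r ^ 2 + a ^ 2)) = 2 * r + 2 * a ^ 2 * r⁻¹ := by
          field_simp
        rw [this]
        have : 0 ≤ 2 * a ^ 2 * r⁻¹ := by positivity
        linarith
    have ht : Tendsto (fun r : ℝ => (2 * a)⁻¹ * arctan (r / a) - r / (2 * (r ^ 2 + a ^ 2)))
        atTop (𝓝 ((2 * a)⁻¹ * (π / 2) - 0)) := ((hat ha).const_mul _).sub hz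
    refine ⟨integrableOn_Ioi_deriv_of_nonneg' hd (fun r _ => by positivity) ht, ?_⟩
    rw [integral_Ioi_of_hasDerivAt_of_nonneg' hd (fun r _ => by positivity) ht]
    simp only [zero_div, arctan_zero, mul_zero, sub_zero]
    field_simp
    ring

variable {z w : ℝ}

theorem integrable_inv_mul_inv (hz : 0 < z) (hw : 0 < w) :
    Integrable fun p : R3 => (‖p‖ ^ 2 + z)⁻¹ * (‖p‖ ^ 2 + w)⁻¹ := by
  refine (integrable_fun_norm_addHaar (E := R3) (volume : Measure R3)
    (f := fun r : ℝ => (r ^ 2 + z)⁻¹ * (r ^ 2 + w)⁻¹)).mpr ?_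
  have := (integral_radial_aux (Real.sqrt_pos.mpr hz) (Real.sqrt_pos.mpr hw)).1
  rw [Real.sq_sqrt hz.le, Real.sq_sqrt hw.le] at this
  simpa using this

theorem integral_inv_mul_inv (hz : 0 < z) (hw : 0 < w) :
    ∫ p : R3, (‖p‖ ^ 2 + z)⁻¹ * (‖p‖ ^ 2 + w)⁻¹ = 2 * π ^ 2 / (√z + √w) := by
  have h := integral_fun_norm_addHaar (E := R3) (volume : Measure R3)
    (fun r : ℝ => (r ^ 2 + z)⁻¹ * (r ^ 2 + w)⁻¹)
  have h2 := (integral_radial_aux (Real.sqrt_pos.mpr hz) (Real.sqrt_pos.mpr hw)).2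
  rw [Real.sq_sqrt hz.le, Real.sq_sqrt hw.le] at h2
  rw [h]
  simp only [finrank_euclideanSpace, Fintype.card_fin, smul_eq_mul, Nat.add_one_sub_one]
  rw [h2, Measure.real, EuclideanSpace.volume_ball_fin_three]
  have : 0 < √z + √w := add_pos (Real.sqrt_pos.mpr hz) (Real.sqrt_pos.mpr hw)
  simp only [ENNReal.ofReal_one, one_pow, one_mul, nsmul_eq_mul]
  rw [ENNReal.toReal_ofReal (by positivity)]
  field_simp
  ring

/-- Cauchy–Schwarz. -/
theorem norm_integral_mul_sq_le {f g : R3 → ℂ} (hf : MemLp f 2) (hg : MemLp g 2) :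
    ‖∫ p, f p * g p‖ ^ 2 ≤ (∫ p, ‖f p‖ ^ 2) * ∫ p, ‖g p‖ ^ 2 := by
  have h1 : ‖∫ p, f p * g p‖ ≤ ∫ p, ‖f p‖ * ‖g p‖ := by
    refine (norm_integral_le_integral_norm _).trans_eq ?_
    simp
  have h2 := integral_mul_norm_le_Lp_mul_Lq (μ := (volume : Measure R3)) (f := f) (g := g)
    Real.HolderConjugate.two_two (by simpa using hf) (by simpa using hg)
  simp only [Real.rpow_two] at h2
  have hA : 0 ≤ ∫ p, ‖f p‖ ^ 2 := integral_nonneg fun _ => by positivity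
  have hB : 0 ≤ ∫ p, ‖g p‖ ^ 2 := integral_nonneg fun _ => by positivity
  rw [← Real.sqrt_eq_rpow, ← Real.sqrt_eq_rpow, ← Real.sqrt_mul hA] at h2
  calc _ ≤ (√((∫ p, ‖f p‖ ^ 2) * ∫ p, ‖g p‖ ^ 2)) ^ 2 := by
        gcongr
        exact h1.trans h2
    _ = _ := Real.sq_sqrt (mul_nonneg hA hB)

theorem memLp_inv (hz : 0 < z) : MemLp (fun p : R3 => (((‖p‖ ^ 2 + z)⁻¹ : ℝ) : ℂ)) 2 := by
  have hc : Continuous fun p : R3 => (((‖p‖ ^ 2 + z)⁻¹ : ℝ) : ℂ) :=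
    Complex.continuous_ofReal.comp (Continuous.inv₀ (by fun_prop) fun p => by positivity)
  rw [memLp_two_iff_integrable_sq_norm hc.aestronglyMeasurable]
  refine (integrable_inv_mul_inv hz hz).congr (Eventually.of_forall fun p => ?_)
  simp only [Complex.norm_real, Real.norm_eq_abs, sq_abs]
  ring

theorem integral_norm_inv_sq (hz : 0 < z) :
    ∫ p : R3, ‖(((‖p‖ ^ 2 + z)⁻¹ : ℝ) : ℂ)‖ ^ 2 = π ^ 2 / √z := by
  have := integral_inv_mul_inv hz hz
  have h0 := Real.sqrt_pos.mpr hz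
  rw [show 2 * π ^ 2 / (√z + √z) = π ^ 2 / √z by field_simp; ring] at this
  rw [← this]
  refine integral_congr_ae (Eventually.of_forall fun p => ?_)
  simp only [Complex.norm_real, Real.norm_eq_abs, sq_abs]
  ring

end FreeIntegrals

/-! ### The resolvent of `-Δ_α` -/

section Krein

/-- The symbol `1 / (p² + z)` of the free resolvent. -/
def freeRes (z : ℝ) (p : R3) : ℂ := (((‖p‖ ^ 2 + z)⁻¹ : ℝ) : ℂ)

/-- The value at the origin of the free resolvent applied to a function with transform `h`. -/
def resAtZero (z : ℝ) (h : R3 → ℂ) : ℂ := gam * ∫ p, h p * freeRes z p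

/-- The coefficient of the Green function in the resolvent of `-Δ_α`. -/
def charge (α z : ℝ) (h : R3 → ℂ) : ℂ := resAtZero z h / (coupling α z : ℂ)

/-- The resolvent of `-Δ_α` at `-z` on the Fourier side (Krein's formula). -/
def krein (α z : ℝ) (h : R3 → ℂ) (p : R3) : ℂ := (h p + charge α z h * gam) * freeRes z p

variable {α z w : ℝ} {h k : R3 → ℂ}

theorem memLp_freeRes (hz : 0 < z) : MemLp (freeRes z) 2 := memLp_inv hz

theorem continuous_freeRes (hz : 0 < z) : Continuous (freeRes z) :=
  Complex.continuous_ofReal.comp (Continuous.inv₀ (by fun_prop) fun p => by positivity)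

theorem norm_freeRes (hz : 0 < z) (p : R3) : ‖freeRes z p‖ = (‖p‖ ^ 2 + z)⁻¹ := by
  rw [freeRes, Complex.norm_real, Real.norm_eq_abs, abs_of_pos (by positivity)]

theorem norm_freeRes_le (hz : 0 < z) (p : R3) : ‖freeRes z p‖ ≤ z⁻¹ := by
  rw [norm_freeRes hz]
  exact inv_anti₀ hz (by nlinarith [sq_nonneg ‖p‖])

theorem sub_mul_freeRes_mul_freeRes (hz : 0 < z) (hw : 0 < w) (p : R3) :
    ((w - z : ℝ) : ℂ) * (freeRes z p * freeRes w p) = freeRes z p - freeRes w p := by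
  simp only [freeRes]
  rw [← Complex.ofReal_mul, ← Complex.ofReal_mul, ← Complex.ofReal_sub]
  congr 1
  have : ‖p‖ ^ 2 + z ≠ 0 := by positivity
  have : ‖p‖ ^ 2 + w ≠ 0 := by positivity
  field_simp
  ring

theorem mul_freeRes_cancel (hz : 0 < z) (p : R3) :
    ((‖p‖ ^ 2 + z : ℝ) : ℂ) * freeRes z p = 1 := by
  rw [freeRes, ← Complex.ofReal_mul, mul_inv_cancel₀ (by positivity), Complex.ofReal_one]

theorem kappa_eq (lam : ℝ) (F : L2) (t : ℝ) : kappa lam F t = resAtZero (lam + t) (hat F) := by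
  rw [kappa, resAtZero]
  congr 1
  refine integral_congr_ae (Eventually.of_forall fun p => ?_)
  simp only [freeRes, div_eq_mul_inv, Complex.ofReal_inv, add_assoc]

theorem coupling_pos (hα : 0 ≤ α) (hz : 0 < z) : 0 < coupling α z := by
  have := Real.sqrt_pos.mpr hz
  unfold coupling
  positivity

theorem coupling_ne_zero (hα : 0 ≤ α) (hz : 0 < z) : (coupling α z : ℂ) ≠ 0 := by
  exact_mod_cast (coupling_pos hα hz).ne'

theorem integrable_mul_freeRes (hh : MemLp h 2) (hz : 0 < z) :
    Integrable fun p => h p * freeRes z p :=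
  hh.integrable_mul (memLp_freeRes hz)

theorem resAtZero_congr (hhk : h =ᵐ[volume] k) : resAtZero z h = resAtZero z k := by
  rw [resAtZero, resAtZero]
  congr 1
  refine integral_congr_ae ?_
  filter_upwards [hhk] with p hp
  rw [hp]

theorem charge_congr (hhk : h =ᵐ[volume] k) : charge α z h = charge α z k := by
  rw [charge, charge, resAtZero_congr hhk]

theorem krein_congr (hhk : h =ᵐ[volume] k) : krein α z h =ᵐ[volume] krein α z k := by
  filter_upwards [hhk] with p hp
  rw [krein, krein, hp, charge_congr hhk]

theorem resAtZero_add (hz : 0 < z) (hh : MemLp h 2) (hk : MemLp k 2) :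
    resAtZero z (fun p => h p + k p) = resAtZero z h + resAtZero z k := by
  simp only [resAtZero, add_mul]
  rw [integral_add (integrable_mul_freeRes hh hz) (integrable_mul_freeRes hk hz)]
  ring

theorem resAtZero_const_mul (c : ℂ) : resAtZero z (fun p => c * h p) = c * resAtZero z h := by
  simp only [resAtZero, mul_assoc]
  rw [integral_const_mul]
  ring

theorem charge_add (hz : 0 < z) (hh : MemLp h 2) (hk : MemLp k 2) :
    charge α z (fun p => h p + k p) = charge α z h + charge α z k := by
  rw [charge, resAtZero_add hz hh hk, charge, charge, add_div]

theorem charge_const_mul (c : ℂ) : charge α z (fun p => c * h p) = c * charge α z h := by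
  rw [charge, resAtZero_const_mul, charge, mul_div_assoc]

theorem memLp_mul_freeRes (hh : MemLp h 2) (hz : 0 < z) :
    MemLp (fun p => h p * freeRes z p) 2 := by
  refine (hh.of_le_mul (c := z⁻¹) (hh.1.mul (continuous_freeRes hz).aestronglyMeasurable)
    (Eventually.of_forall fun p => ?_))
  rw [norm_mul, mul_comm]
  exact mul_le_mul_of_nonneg_right (norm_freeRes_le hz p) (norm_nonneg _)

theorem memLp_krein (hh : MemLp h 2) (hz : 0 < z) : MemLp (krein α z h) 2 := by
  have h1 : MemLp (fun p => h p * freeRes z p + (charge α z h * gam) * freeRes z p) 2 :=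
    (memLp_mul_freeRes hh hz).add ((memLp_freeRes hz).const_mul _)
  refine h1.ae_eq (Eventually.of_forall fun p => ?_)
  simp only [krein]
  ring

theorem coupling_sub (z w : ℝ) : coupling α z - coupling α w = (√z - √w) / (4 * π) := by
  unfold coupling; ring

/-- The values at the origin of differences of Green functions. -/
theorem resAtZero_freeRes (hz : 0 < z) (hw : 0 < w) :
    ((z - w : ℝ) : ℂ) * (gam * resAtZero w (freeRes z)) =
      ((coupling α z - coupling α w : ℝ) : ℂ) := by
  have h1 : ∫ p, freeRes z p * freeRes w p = ((2 * π ^ 2 / (√z + √w) : ℝ) : ℂ) := by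
    rw [← integral_inv_mul_inv hz hw, ← integral_complex_ofReal]
    simp only [freeRes, Complex.ofReal_mul]
  rw [resAtZero, h1, ← Complex.ofReal_mul, ← Complex.ofReal_mul, ← Complex.ofReal_mul,
    coupling_sub]
  congr 1
  have h3 : 0 < √z + √w := add_pos (Real.sqrt_pos.mpr hz) (Real.sqrt_pos.mpr hw)
  -- The factor √z + √w cancels the denominator of the integral, and `gam`² · 2π² = 1/(4π) is the
  -- coefficient of √z in the coupling.
  have h4 : z - w = (√z - √w) * (√z + √w) := by
    rw [mul_comm, ← sq_sub_sq, Real.sq_sqrt hz.le, Real.sq_sqrt hw.le]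
  rw [h4, ← mul_assoc gam, ← pow_two, gam_sq]
  field_simp
  ring

theorem sub_mul_resAtZero_mul_freeRes (hz : 0 < z) (hw : 0 < w) (hh : MemLp h 2) :
    ((z - w : ℝ) : ℂ) * resAtZero w (fun p => h p * freeRes z p) =
      resAtZero w h - resAtZero z h := by
  simp only [resAtZero]
  rw [← mul_sub, ← integral_sub (integrable_mul_freeRes hh hw) (integrable_mul_freeRes hh hz),
    mul_left_comm, ← integral_const_mul]
  congr 2
  ext p
  rw [← mul_sub, ← sub_mul_freeRes_mul_freeRes hw hz]
  ring

theorem resAtZero_krein (hz : 0 < z) (hw : 0 < w) (hh : MemLp h 2) :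
    ((z - w : ℝ) : ℂ) * resAtZero w (krein α z h) =
      resAtZero w h - resAtZero z h + charge α z h * (coupling α z - coupling α w : ℝ) := by
  have e : krein α z h =
      fun p => h p * freeRes z p + (charge α z h * gam) * freeRes z p := by
    ext p; rw [krein]; ring
  rw [e, resAtZero_add hw (memLp_mul_freeRes hh hz) ((memLp_freeRes hz).const_mul _),
    resAtZero_const_mul, mul_add, sub_mul_resAtZero_mul_freeRes hz hw hh,
    ← resAtZero_freeRes hz hw]
  ring

/-- The coupling depends on z precisely so that this holds: its increment compensates the value at
the origin of a difference of Green functions. The resolvent identity and the independence of the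
graph from μ both rest on this. -/
theorem charge_krein (hα : 0 ≤ α) (hz : 0 < z) (hw : 0 < w) (hh : MemLp h 2) :
    ((z - w : ℝ) : ℂ) * charge α w (krein α z h) = charge α w h - charge α z h := by
  have h1 := resAtZero_krein (α := α) hz hw hh
  have hz' := coupling_ne_zero hα hz
  have hw' := coupling_ne_zero hα hw
  rw [charge, mul_div_assoc', h1]
  simp only [charge]
  push_cast
  field_simp
  ring

/-- The resolvent identity. -/
theorem krein_sub_krein (hα : 0 ≤ α) (hz : 0 < z) (hw : 0 < w) (hh : MemLp h 2) (p : R3) :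
    krein α z h p - krein α w h p = ((w - z : ℝ) : ℂ) * krein α z (krein α w h) p := by
  have h1 := charge_krein hα hw hz hh
  have h2 := sub_mul_freeRes_mul_freeRes hz hw p
  have e : ((w - z : ℝ) : ℂ) * krein α z (krein α w h) p =
      (h p + charge α w h * gam) * (((w - z : ℝ) : ℂ) * (freeRes z p * freeRes w p)) +
        (((w - z : ℝ) : ℂ) * charge α z (krein α w h)) * gam * freeRes z p := by
    simp only [krein]
    ring
  rw [e, h1, h2]
  simp only [krein]
  ring

/-- Cauchy–Schwarz with the squared L² norm π²/√z of the free symbol. -/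
theorem norm_resAtZero_sq_le (hz : 0 < z) (hh : MemLp h 2) :
    ‖resAtZero z h‖ ^ 2 ≤ (8 * π * √z)⁻¹ * ∫ p, ‖h p‖ ^ 2 := by
  have h1 := norm_integral_mul_sq_le hh (memLp_freeRes hz)
  have h2 : ∫ p, ‖freeRes z p‖ ^ 2 = π ^ 2 / √z := integral_norm_inv_sq hz
  have hz' := Real.sqrt_pos.mpr hz
  rw [resAtZero, norm_mul, mul_pow, Complex.norm_real, Real.norm_eq_abs, sq_abs, gam_sq]
  calc _ ≤ ((2 * π) ^ 3)⁻¹ * ((∫ p, ‖h p‖ ^ 2) * (π ^ 2 / √z)) := by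
        rw [← h2]; gcongr
    _ = _ := by field_simp; ring

theorem sqrt_le_coupling (hα : 0 ≤ α) (z : ℝ) : √z / (4 * π) ≤ coupling α z := by
  unfold coupling; linarith

/-- Since α ≥ 0, dividing by the squared coupling gains another factor 1/z. The resulting decay
z^{-3/2} of the squared charge is what the dyadic argument for the regular part uses. -/
theorem norm_charge_sq_le (hα : 0 ≤ α) (hz : 0 < z) (hh : MemLp h 2) :
    ‖charge α z h‖ ^ 2 ≤ 2 * π * (√z ^ 3)⁻¹ * ∫ p, ‖h p‖ ^ 2 := by
  have hz' := Real.sqrt_pos.mpr hz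
  have hI : 0 ≤ ∫ p, ‖h p‖ ^ 2 := integral_nonneg fun _ => by positivity
  have hc := sqrt_le_coupling hα z
  rw [charge, norm_div, Complex.norm_real, Real.norm_eq_abs, abs_of_pos (coupling_pos hα hz),
    div_pow]
  calc _ ≤ ((8 * π * √z)⁻¹ * ∫ p, ‖h p‖ ^ 2) / (√z / (4 * π)) ^ 2 := by
        have := norm_resAtZero_sq_le hz hh
        gcongr
    _ = _ := by field_simp; ring

end Krein

/-! ### Krein's formula inverts A + z -/

section Resolvent

variable {α z w : ℝ}

/-- The definition of the graph is Krein's formula at the given μ, with f the free resolvent of v +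
μu. Passing from μ to z is the charge identity together with partial fractions for the free symbols.
-/
theorem hat_eq_krein_of_pointLaplacian (hα : 0 ≤ α) (hz : 0 < z) {u v : L2}
    (huv : PointLaplacian α u v) : hat u =ᵐ[volume] krein α z (hat (v + (z : ℂ) • u)) := by
  obtain ⟨μ, hμ, f, hf, hu, hk⟩ := pointLaplacian_iff.mp huv
  set c : ℂ := (gam * ∫ p, hat f p) / (coupling α μ : ℂ) with hc
  have hu' : hat u =ᵐ[volume] fun p => hat f p + c * gam * freeRes μ p := by
    filter_upwards [hu] with p hp
    rw [hp, freeRes, div_eq_mul_inv]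
    push_cast
    ring
  have hfk : hat f =ᵐ[volume] fun p => hat (v + (μ : ℂ) • u) p * freeRes μ p := by
    filter_upwards [hk] with p hp
    rw [hp, mul_right_comm, mul_freeRes_cancel hμ, one_mul]
  have hcharge : charge α μ (hat (v + (μ : ℂ) • u)) = c := by
    rw [charge, resAtZero, hc, integral_congr_ae hfk]
  have hkr : hat u =ᵐ[volume] krein α μ (hat (v + (μ : ℂ) • u)) := by
    filter_upwards [hu', hfk] with p h1 h2
    rw [h1, h2, krein, hcharge]
    ring
  have hsum : hat (v + (z : ℂ) • u) =ᵐ[volume] fun p =>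
      hat (v + (μ : ℂ) • u) p + ((z - μ : ℝ) : ℂ) * krein α μ (hat (v + (μ : ℂ) • u)) p := by
    have e : v + (z : ℂ) • u = (v + (μ : ℂ) • u) + ((z - μ : ℝ) : ℂ) • u := by
      push_cast
      module
    rw [e]
    filter_upwards [hat_add (v + (μ : ℂ) • u) (((z - μ : ℝ) : ℂ) • u),
      hat_smul ((z - μ : ℝ) : ℂ) u, hkr] with p h1 h2 h3
    rw [h1, h2, h3]
  set k := hat (v + (μ : ℂ) • u) with hkdef
  have hkm : MemLp k 2 := memLp_hat _
  have hch : charge α z (hat (v + (z : ℂ) • u)) = charge α μ k := by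
    rw [charge_congr hsum, charge_add hz hkm ((memLp_krein hkm hμ).const_mul _),
      charge_const_mul]
    have := charge_krein hα hμ hz hkm
    have h2 : ((z - μ : ℝ) : ℂ) = -((μ - z : ℝ) : ℂ) := by push_cast; ring
    rw [h2, neg_mul, this]
    ring
  filter_upwards [hkr, hsum] with p h1 h2
  rw [h1, krein, krein, hch, h2, krein]
  have h3 := sub_mul_freeRes_mul_freeRes hμ hz p
  linear_combination (k p + charge α μ k * gam) * h3.symm

/-- Surjectivity of A + z: use the graph with μ = z and with f the free resolvent of g. -/
theorem exists_pointLaplacian (hz : 0 < z) (g : L2) :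
    ∃ u : L2, hat u =ᵐ[volume] krein α z (hat g) ∧ PointLaplacian α u (g - (z : ℂ) • u) := by
  obtain ⟨u, hu⟩ := exists_hat_eq (memLp_krein (α := α) (memLp_hat g) hz)
  obtain ⟨f, hf⟩ := exists_hat_eq (memLp_mul_freeRes (memLp_hat g) hz)
  refine ⟨u, hu, pointLaplacian_iff.mpr ⟨z, hz, f, ?_, ?_, ?_⟩⟩
  · rw [mem_Hs_iff (by norm_num) hz]
    refine (memLp_hat g).ae_eq ?_
    filter_upwards [hf] with p hp
    rw [hp, div_self two_ne_zero, Real.rpow_one, mul_left_comm, mul_freeRes_cancel hz, mul_one]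
  · filter_upwards [hu, hf] with p h1 h2
    rw [h1, h2, integral_congr_ae hf, krein, charge, resAtZero, freeRes, div_eq_mul_inv gam]
    push_cast
    ring
  · rw [sub_add_cancel]
    filter_upwards [hf] with p hp
    rw [hp, mul_left_comm, mul_freeRes_cancel hz, mul_one]

/-- The Green-function part of the resolvent is a rank-one form with real coefficient 1/coupling.
Symmetry of the resolvent can be read off from this form. -/
theorem inner_hat_krein (hz : 0 < z) {g u : L2} (hu : hat u =ᵐ[volume] krein α z (hat g))
    (h : L2) : inner ℂ h u = (∫ p, (starRingEnd ℂ) (hat h p) * hat g p * freeRes z p) +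
      (starRingEnd ℂ) (resAtZero z (hat h)) * resAtZero z (hat g) / (coupling α z : ℂ) := by
  have hconj : (starRingEnd ℂ) (resAtZero z (hat h)) =
      gam * ∫ p, (starRingEnd ℂ) (hat h p) * freeRes z p := by
    rw [resAtZero, map_mul, Complex.conj_ofReal, ← integral_conj]
    congr 2
    ext p
    rw [map_mul, freeRes, Complex.conj_ofReal]
  have hcm : MemLp (fun p => (starRingEnd ℂ) (hat h p)) 2 := (memLp_hat h).star
  have i1 : Integrable fun p => (starRingEnd ℂ) (hat h p) * hat g p * freeRes z p := by
    have := hcm.integrable_mul (memLp_mul_freeRes (memLp_hat g) hz)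
    refine this.congr (Eventually.of_forall fun p => ?_)
    simp only [Pi.mul_apply, mul_assoc]
  have i2 := (integrable_mul_freeRes hcm hz).const_mul (charge α z (hat g) * gam)
  rw [inner_eq_integral_hat, hconj]
  have e : (∫ p, (starRingEnd ℂ) (hat h p) * hat u p) =
      ∫ p, ((starRingEnd ℂ) (hat h p) * hat g p * freeRes z p +
        (charge α z (hat g) * gam) * ((starRingEnd ℂ) (hat h p) * freeRes z p)) := by
    refine integral_congr_ae ?_
    filter_upwards [hu] with p hp
    rw [hp, krein]
    ring
  rw [e, integral_add i1 i2, integral_const_mul, charge]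
  ring

/-- The resolvents of `-Δ_α` as bounded operators. -/
theorem exists_resolvent (α : ℝ) : ∃ R : ℝ → L2 →L[ℂ] L2, ∀ z, 0 < z →
    (∀ g, hat (R z g) =ᵐ[volume] krein α z (hat g)) ∧ (∀ g h, inner ℂ (R z g) h =
      inner ℂ g (R z h)) := by
  have key : ∀ z : ℝ, ∃ S : L2 →L[ℂ] L2, 0 < z → (∀ g, hat (S g) =ᵐ[volume] krein α z (hat g)) ∧
      (∀ g h, inner ℂ (S g) h = inner ℂ g (S h)) := by
    intro z
    rcases le_or_gt z 0 with hz | hz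
    · exact ⟨0, fun h => absurd h hz.not_gt⟩
    choose r hr using fun g : L2 => exists_pointLaplacian (α := α) hz g
    let S : L2 →ₗ[ℂ] L2 :=
      { toFun := r
        map_add' := fun g h => by
          refine hat_injective ?_
          have hc : charge α z (hat (g + h)) = charge α z (hat g) + charge α z (hat h) := by
            rw [charge_congr (hat_add g h), charge_add hz (memLp_hat g) (memLp_hat h)]
          filter_upwards [(hr (g + h)).1, (hr g).1, (hr h).1, hat_add (r g) (r h), hat_add g h]
            with p h1 h2 h3 h4 h5
          rw [h1, h4, h2, h3, krein, krein, krein, hc, h5]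
          ring
        map_smul' := fun c g => by
          refine hat_injective ?_
          have hc : charge α z (hat (c • g)) = c * charge α z (hat g) := by
            rw [charge_congr (hat_smul c g), charge_const_mul]
          filter_upwards [(hr (c • g)).1, (hr g).1, hat_smul c (r g), hat_smul c g]
            with p h1 h2 h3 h4
          rw [h1, RingHom.id_apply, h3, h2, krein, krein, hc, h4]
          ring }
    have hsym : S.IsSymmetric := by
      intro g h
      change inner ℂ (r g) h = inner ℂ g (r h)
      rw [← inner_conj_symm, inner_hat_krein hz (hr g).1, inner_hat_krein hz (hr h).1, map_add,
        map_div₀, map_mul, Complex.conj_conj, Complex.conj_ofReal, ← integral_conj, mul_comm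
        (resAtZero z (hat h))]
      congr 2
      ext p
      rw [map_mul, map_mul, Complex.conj_conj, freeRes, Complex.conj_ofReal]
      ring
    -- Boundedness is the Hellinger–Toeplitz theorem: an everywhere defined symmetric operator is
    -- continuous.
    exact ⟨⟨S, hsym.continuous⟩, fun _ => ⟨fun g => (hr g).1, hsym⟩⟩
  choose R hR using key
  exact ⟨R, hR⟩

/-- Plain Cauchy–Schwarz only gives boundedness. Splitting 1/(p²+z) as the root of (p²+1)/(p²+z)
times the root of 1/((p²+1)(p²+z)) puts a factor tending to 0 on h, while the other factor still has
squared norm of order z^{-1/2}. -/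
theorem tendsto_mul_resAtZero {h : R3 → ℂ} (hh : MemLp h 2) :
    Tendsto (fun z : ℝ => √z * ‖resAtZero z h‖ ^ 2) atTop (𝓝 0) := by
  have hsq : Integrable fun p => ‖h p‖ ^ 2 := (memLp_two_iff_integrable_sq_norm hh.1).mp hh
  have hle1 : ∀ z : ℝ, 1 ≤ z → ∀ p : R3, (‖p‖ ^ 2 + 1) / (‖p‖ ^ 2 + z) ≤ 1 := by
    intro z hz p
    rw [div_le_one (by positivity)]
    linarith
  have hm : ∀ z : ℝ, 1 ≤ z → Continuous fun p : R3 => (‖p‖ ^ 2 + 1) / (‖p‖ ^ 2 + z) := by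
    intro z hz
    exact Continuous.div (by fun_prop) (by fun_prop) fun p => by positivity
  have t1 : Tendsto (fun z : ℝ => ∫ p, ‖h p‖ ^ 2 * ((‖p‖ ^ 2 + 1) / (‖p‖ ^ 2 + z))) atTop
      (𝓝 (∫ _ : R3, (0 : ℝ))) := by
    refine tendsto_integral_filter_of_dominated_convergence (fun p => ‖h p‖ ^ 2) ?_ ?_ hsq ?_
    · filter_upwards [eventually_ge_atTop 1] with z hz
      exact hsq.1.mul (hm z hz).aestronglyMeasurable
    · filter_upwards [eventually_ge_atTop 1] with z hz
      refine Eventually.of_forall fun p => ?_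
      rw [Real.norm_eq_abs, abs_of_nonneg (by positivity)]
      exact mul_le_of_le_one_right (by positivity) (hle1 z hz p)
    · refine Eventually.of_forall fun p => ?_
      have : Tendsto (fun z : ℝ => (‖p‖ ^ 2 + 1) / (‖p‖ ^ 2 + z)) atTop (𝓝 0) :=
        tendsto_const_nhds.div_atTop (tendsto_atTop_add_const_left _ _ tendsto_id)
      simpa using this.const_mul (‖h p‖ ^ 2)
  rw [integral_zero] at t1
  have t2 := t1.const_mul (gam ^ 2 * (2 * π ^ 2))
  rw [mul_zero] at t2
  refine squeeze_zero' (Eventually.of_forall fun z => by positivity) ?_ t2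
  filter_upwards [eventually_ge_atTop 1] with z hz
  have hz0 : 0 < z := by linarith
  have hsz := Real.sqrt_pos.mpr hz0
  have hsc : Continuous fun p : R3 => ((√((‖p‖ ^ 2 + 1) / (‖p‖ ^ 2 + z)) : ℝ) : ℂ) :=
    Complex.continuous_ofReal.comp (hm z hz).sqrt
  have m1 : MemLp (fun p => h p * ((√((‖p‖ ^ 2 + 1) / (‖p‖ ^ 2 + z)) : ℝ) : ℂ)) 2 := by
    refine hh.of_le_mul (c := 1) (hh.1.mul hsc.aestronglyMeasurable)
      (Eventually.of_forall fun p => ?_)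
    rw [norm_mul, Complex.norm_real, Real.norm_eq_abs, abs_of_nonneg (Real.sqrt_nonneg _), one_mul]
    refine mul_le_of_le_one_right (norm_nonneg _) ?_
    rw [Real.sqrt_le_one]
    exact hle1 z hz p
  have hv : Continuous fun p : R3 => (√((‖p‖ ^ 2 + 1)⁻¹ * (‖p‖ ^ 2 + z)⁻¹)) := by
    refine Continuous.sqrt (Continuous.mul ?_ ?_) <;>
      exact Continuous.inv₀ (by fun_prop) fun p => by positivity
  have n2 : ∀ p : R3, ‖((√((‖p‖ ^ 2 + 1)⁻¹ * (‖p‖ ^ 2 + z)⁻¹) : ℝ) : ℂ)‖ ^ 2 =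
      (‖p‖ ^ 2 + 1)⁻¹ * (‖p‖ ^ 2 + z)⁻¹ := by
    intro p
    rw [Complex.norm_real, Real.norm_eq_abs, sq_abs, Real.sq_sqrt (by positivity)]
  have m2 : MemLp (fun p : R3 => ((√((‖p‖ ^ 2 + 1)⁻¹ * (‖p‖ ^ 2 + z)⁻¹) : ℝ) : ℂ)) 2 := by
    have hvc : Continuous fun p : R3 => ((√((‖p‖ ^ 2 + 1)⁻¹ * (‖p‖ ^ 2 + z)⁻¹) : ℝ) : ℂ) :=
      Complex.continuous_ofReal.comp hv
    rw [memLp_two_iff_integrable_sq_norm hvc.aestronglyMeasurable]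
    simp_rw [n2]
    exact integrable_inv_mul_inv one_pos hz0
  have cs := norm_integral_mul_sq_le m1 m2
  simp_rw [n2] at cs
  rw [integral_inv_mul_inv one_pos hz0] at cs
  have e1 : (∫ p, h p * ((√((‖p‖ ^ 2 + 1) / (‖p‖ ^ 2 + z)) : ℝ) : ℂ) *
      ((√((‖p‖ ^ 2 + 1)⁻¹ * (‖p‖ ^ 2 + z)⁻¹) : ℝ) : ℂ)) = ∫ p, h p * freeRes z p := by
    refine integral_congr_ae (Eventually.of_forall fun p => ?_)
    simp only
    rw [mul_assoc, ← Complex.ofReal_mul, ← Real.sqrt_mul (by positivity), freeRes]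
    congr 2
    have h1 : ‖p‖ ^ 2 + 1 ≠ 0 := by positivity
    have h2 : 0 < ‖p‖ ^ 2 + z := by positivity
    rw [show (‖p‖ ^ 2 + 1) / (‖p‖ ^ 2 + z) * ((‖p‖ ^ 2 + 1)⁻¹ * (‖p‖ ^ 2 + z)⁻¹) =
      ((‖p‖ ^ 2 + z)⁻¹) ^ 2 by field_simp, Real.sqrt_sq (by positivity)]
  have e2 : (∫ p, ‖h p * ((√((‖p‖ ^ 2 + 1) / (‖p‖ ^ 2 + z)) : ℝ) : ℂ)‖ ^ 2) =
      ∫ p, ‖h p‖ ^ 2 * ((‖p‖ ^ 2 + 1) / (‖p‖ ^ 2 + z)) := by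
    refine integral_congr_ae (Eventually.of_forall fun p => ?_)
    simp only
    rw [norm_mul, Complex.norm_real, Real.norm_eq_abs, mul_pow, sq_abs,
      Real.sq_sqrt (by positivity)]
  rw [e1, e2] at cs
  rw [resAtZero, norm_mul, mul_pow, Complex.norm_real, Real.norm_eq_abs, sq_abs]
  set I := ∫ p, ‖h p‖ ^ 2 * ((‖p‖ ^ 2 + 1) / (‖p‖ ^ 2 + z))
  have hI : 0 ≤ I := integral_nonneg fun p => by positivity
  have h3 : √z * (2 * π ^ 2 / (√1 + √z)) ≤ 2 * π ^ 2 := by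
    rw [mul_div_assoc', div_le_iff₀ (by positivity)]
    nlinarith [Real.sqrt_nonneg 1, sq_nonneg π, mul_nonneg (sq_nonneg π) (Real.sqrt_nonneg 1)]
  calc √z * (gam ^ 2 * ‖∫ p, h p * freeRes z p‖ ^ 2)
      ≤ √z * (gam ^ 2 * (I * (2 * π ^ 2 / (√1 + √z)))) := by gcongr
    _ = gam ^ 2 * I * (√z * (2 * π ^ 2 / (√1 + √z))) := by ring
    _ ≤ gam ^ 2 * I * (2 * π ^ 2) := by gcongr
    _ = _ := by ring

/-- In the limit z → ∞ the free part converges by domination, and the rank-one part is at most 4π√z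
|resAtZero|², which vanishes by `tendsto_mul_resAtZero`. -/
theorem isResolventFamily (hα : 0 ≤ α) {R : ℝ → L2 →L[ℂ] L2}
    (hR : ∀ z, 0 < z → ∀ g, hat (R z g) =ᵐ[volume] krein α z (hat g))
    (hsym : ∀ z, 0 < z → ∀ g h, inner ℂ (R z g) h = inner ℂ g (R z h)) :
    IsResolventFamily R where
  isSelfAdjoint z hz := ContinuousLinearMap.isSelfAdjoint_iff_isSymmetric.mpr (hsym z hz)
  sub_eq z w hz hw := by
    ext1 g
    refine hat_injective ?_
    rw [sub_apply, smul_apply, mul_apply_eq_comp]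
    filter_upwards [hat_sub (R z g) (R w g), hR z hz g, hR w hw g,
      hat_smul ((w - z : ℝ) : ℂ) (R z (R w g)), hR z hz (R w g),
      krein_congr (α := α) (z := z) (hR w hw g)] with p h1 h2 h3 h4 h5 h6
    rw [h1, h2, h3, h4, h5, h6, krein_sub_krein hα hz hw (memLp_hat g)]
  tendsto g := by
    have hm := memLp_hat g
    have hsq : Integrable fun p => ‖hat g p‖ ^ 2 := (memLp_two_iff_integrable_sq_norm hm.1).mp hm
    have e : ∀ z : ℝ, 0 < z → (z : ℂ) * inner ℂ g (R z g) =
        ((∫ p, ‖hat g p‖ ^ 2 * (z / (‖p‖ ^ 2 + z)) : ℝ) : ℂ) +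
          ((z * ‖resAtZero z (hat g)‖ ^ 2 / coupling α z : ℝ) : ℂ) := by
      intro z hz
      rw [inner_hat_krein hz (hR z hz g), mul_add, ← integral_complex_ofReal,
        ← integral_const_mul, Complex.conj_mul']
      congr 1
      · refine integral_congr_ae (Eventually.of_forall fun p => ?_)
        simp only
        rw [Complex.conj_mul', freeRes]
        push_cast
        ring
      · push_cast
        ring
    have t1 : Tendsto (fun z : ℝ => ∫ p, ‖hat g p‖ ^ 2 * (z / (‖p‖ ^ 2 + z))) atTop
        (𝓝 (∫ p, ‖hat g p‖ ^ 2)) := by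
      refine tendsto_integral_filter_of_dominated_convergence (fun p => ‖hat g p‖ ^ 2) ?_ ?_ hsq ?_
      · filter_upwards [eventually_gt_atTop 0] with z hz
        refine hsq.1.mul (Continuous.aestronglyMeasurable ?_)
        exact Continuous.div (by fun_prop) (by fun_prop) fun p => by positivity
      · filter_upwards [eventually_gt_atTop 0] with z hz
        refine Eventually.of_forall fun p => ?_
        rw [Real.norm_eq_abs, abs_of_nonneg (by positivity)]
        refine mul_le_of_le_one_right (by positivity) ?_
        rw [div_le_one (by positivity)]
        nlinarith [sq_nonneg ‖p‖]
      · refine Eventually.of_forall fun p => ?_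
        have h0 : Tendsto (fun z : ℝ => 1 - ‖p‖ ^ 2 / (‖p‖ ^ 2 + z)) atTop (𝓝 (1 - 0)) :=
          (tendsto_const_nhds.div_atTop (tendsto_atTop_add_const_left _ _ tendsto_id)).const_sub 1
        have h1 : Tendsto (fun z : ℝ => z / (‖p‖ ^ 2 + z)) atTop (𝓝 1) := by
          rw [sub_zero] at h0
          refine h0.congr' ?_
          filter_upwards [eventually_gt_atTop 0] with z hz
          have : ‖p‖ ^ 2 + z ≠ 0 := by positivity
          field_simp
          ring
        simpa using h1.const_mul (‖hat g p‖ ^ 2)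
    have t2 : Tendsto (fun z : ℝ => z * ‖resAtZero z (hat g)‖ ^ 2 / coupling α z) atTop
        (𝓝 0) := by
      have t3 := (tendsto_mul_resAtZero hm).const_mul (4 * π)
      rw [mul_zero] at t3
      refine squeeze_zero' ?_ ?_ t3
      · filter_upwards [eventually_gt_atTop 0] with z hz
        have := coupling_pos hα hz
        positivity
      · filter_upwards [eventually_gt_atTop 0] with z hz
        have hsz := Real.sqrt_pos.mpr hz
        have h1 := sqrt_le_coupling hα z
        calc _ ≤ z * ‖resAtZero z (hat g)‖ ^ 2 / (√z / (4 * π)) := by gcongr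
          _ = 4 * π * ((z / √z) * ‖resAtZero z (hat g)‖ ^ 2) := by field_simp
          _ = _ := by rw [Real.div_sqrt]
    have h3 : inner ℂ g g = ((∫ p, ‖hat g p‖ ^ 2 : ℝ) : ℂ) + ((0 : ℝ) : ℂ) := by
      rw [inner_self_eq_norm_sq_to_K, ← norm_sq_eq_integral_hat]
      simp
    rw [h3]
    refine Tendsto.congr' ?_ (((Complex.continuous_ofReal.tendsto _).comp t1).add
      ((Complex.continuous_ofReal.tendsto _).comp t2))
    filter_upwards [eventually_gt_atTop 0] with z hz
    exact (e z hz).symm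

end Resolvent

/-! ### Spectral measures of `-Δ_α` -/

section SpectralMeasure

variable {α lam : ℝ}

/-- The transform of `(A + λ) (A + λ + t)⁻¹ g`, where `A = -Δ_α` and `h` is the transform of `g`. -/
def wav (α lam : ℝ) (h : R3 → ℂ) (t : ℝ) (p : R3) : ℂ := h p - t * krein α (lam + t) h p

theorem memLp_wav (hlam : 0 < lam) {h : R3 → ℂ} (hh : MemLp h 2) {t : ℝ} (ht : 0 ≤ t) :
    MemLp (wav α lam h t) 2 :=
  hh.sub ((memLp_krein hh (by positivity)).const_mul _)

theorem isSpectralMeasure_iff (hα : 0 ≤ α) {R : ℝ → L2 →L[ℂ] L2}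
    (hR : ∀ z, 0 < z → ∀ g, hat (R z g) =ᵐ[volume] krein α z (hat g)) {g : L2} {μ : Measure ℝ} :
    IsSpectralMeasure (PointLaplacian α) g μ ↔
      IsFiniteMeasure μ ∧ μ (Iio 0) = 0 ∧ IsResolventFamily.Represents R g μ := by
  refine and_congr_right fun _ => and_congr_right fun _ => forall_congr' fun z =>
    forall_congr' fun hz => ?_
  constructor
  · rintro ⟨u, v, huv, hg, hint⟩
    have h1 := hat_eq_krein_of_pointLaplacian hα hz huv
    rw [hg] at h1
    have h2 : u = R z g := hat_injective (h1.trans (hR z hz g).symm)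
    rwa [h2] at hint
  · intro hint
    obtain ⟨u, hu, hT⟩ := exists_pointLaplacian (α := α) hz g
    have h2 : u = R z g := hat_injective (hu.trans (hR z hz g).symm)
    exact ⟨u, g - (z : ℂ) • u, hT, sub_add_cancel _ _, by rwa [h2]⟩

theorem exists_isSpectralMeasure (hα : 0 ≤ α) (g : L2) :
    ∃ μ, IsSpectralMeasure (PointLaplacian α) g μ := by
  obtain ⟨R, hR⟩ := exists_resolvent α
  have hf := isResolventFamily hα (fun z hz => (hR z hz).1) (fun z hz => (hR z hz).2)
  obtain ⟨μ, hμ⟩ := hf.exists_represents g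
  exact ⟨μ, (isSpectralMeasure_iff hα fun z hz => (hR z hz).1).mpr hμ⟩

theorem integral_conj_wav_mul_wav (hα : 0 ≤ α) (hlam : 0 < lam) {g : L2} {μ : Measure ℝ}
    (hμ : IsSpectralMeasure (PointLaplacian α) g μ) {s t : ℝ} (hs : 0 ≤ s) (ht : 0 ≤ t) :
    ∫ p, (starRingEnd ℂ) (wav α lam (hat g) s p) * wav α lam (hat g) t p =
      ((∫ x, ((x + lam) / (x + lam + s)) * ((x + lam) / (x + lam + t)) ∂μ : ℝ) : ℂ) := by
  obtain ⟨R, hR⟩ := exists_resolvent α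
  have hf := isResolventFamily hα (fun z hz => (hR z hz).1) (fun z hz => (hR z hz).2)
  obtain ⟨h1, h2, h3⟩ := (isSpectralMeasure_iff hα fun z hz => (hR z hz).1).mp hμ
  rw [← hf.inner_sub_smul h2 h3 hlam hs ht, inner_eq_integral_hat]
  have key : ∀ r : ℝ, 0 ≤ r →
      hat (g - (r : ℂ) • R (lam + r) g) =ᵐ[volume] wav α lam (hat g) r := by
    intro r hr
    filter_upwards [hat_sub g ((r : ℂ) • R (lam + r) g), hat_smul (r : ℂ) (R (lam + r) g),
      (hR (lam + r) (by positivity)).1 g] with p h1 h2 h3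
    rw [h1, h2, h3, wav]
  refine integral_congr_ae ?_
  filter_upwards [key s hs, key t ht] with p h1 h2
  rw [h1, h2]

theorem integral_norm_wav_sq (hα : 0 ≤ α) (hlam : 0 < lam) {g : L2} {μ : Measure ℝ}
    (hμ : IsSpectralMeasure (PointLaplacian α) g μ) {t : ℝ} (ht : 0 ≤ t) :
    ∫ p, ‖wav α lam (hat g) t p‖ ^ 2 = ∫ x, ((x + lam) / (x + lam + t)) ^ 2 ∂μ := by
  have h := integral_conj_wav_mul_wav hα hlam hμ ht ht
  apply Complex.ofReal_injective
  simp_rw [pow_two ((_ + lam) / _)]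
  rw [← h, ← integral_complex_ofReal]
  refine integral_congr_ae (Eventually.of_forall fun p => ?_)
  simp only
  rw [Complex.conj_mul', Complex.ofReal_pow]

theorem lintegral_moment_lt_top_iff (hlam : 0 < lam) {μ : Measure ℝ} [IsFiniteMeasure μ]
    (h0 : μ (Iio 0) = 0) :
    ∫⁻ x, ENNReal.ofReal (x ^ (2 * (3 / 4) : ℝ)) ∂μ < ∞ ↔
      Integrable (fun x => (x + lam) ^ (3 / 2 : ℝ)) μ := by
  rw [show (2 * (3 / 4) : ℝ) = 3 / 2 by norm_num]
  have hae := IsResolventFamily.ae_nonneg_of_measure_Iio h0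
  have h1 : ∫⁻ x, ENNReal.ofReal (x ^ (3 / 2 : ℝ)) ∂μ < ∞ ↔
      Integrable (fun x => x ^ (3 / 2 : ℝ)) μ := by
    rw [lt_top_iff_ne_top, lintegral_ofReal_ne_top_iff_integrable
      (Measurable.aestronglyMeasurable (by fun_prop))]
    filter_upwards [hae] with x hx
    exact Real.rpow_nonneg hx _
  rw [h1]
  constructor
  · intro h
    refine ((h.const_mul (2 ^ (3 / 2 : ℝ))).add
      (integrable_const ((2 * lam) ^ (3 / 2 : ℝ)))).mono'
      (Measurable.aestronglyMeasurable (by fun_prop)) ?_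
    filter_upwards [hae] with x hx
    rw [Real.norm_eq_abs, abs_of_nonneg (by positivity), Pi.add_apply]
    rcases le_total x lam with hxl | hxl
    · have h3 : (x + lam) ^ (3 / 2 : ℝ) ≤ (2 * lam) ^ (3 / 2 : ℝ) :=
        Real.rpow_le_rpow (by positivity) (by linarith) (by norm_num)
      have : 0 ≤ 2 ^ (3 / 2 : ℝ) * x ^ (3 / 2 : ℝ) := by positivity
      linarith
    · have h3 : (x + lam) ^ (3 / 2 : ℝ) ≤ (2 * x) ^ (3 / 2 : ℝ) :=
        Real.rpow_le_rpow (by positivity) (by linarith) (by norm_num)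
      rw [Real.mul_rpow (by norm_num) hx] at h3
      have : 0 ≤ (2 * lam) ^ (3 / 2 : ℝ) := by positivity
      linarith
  · intro h
    refine h.mono' (Measurable.aestronglyMeasurable (by fun_prop)) ?_
    filter_upwards [hae] with x hx
    rw [Real.norm_eq_abs, abs_of_nonneg (by positivity)]
    exact Real.rpow_le_rpow hx (by linarith) (by norm_num)

theorem mem_fracPowDomain_iff (hlam : 0 < lam) {g : L2} :
    g ∈ fracPowDomain (PointLaplacian α) (3 / 4) ↔ ∃ μ,
      IsSpectralMeasure (PointLaplacian α) g μ ∧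
        Integrable (fun x => (x + lam) ^ (3 / 2 : ℝ)) μ := by
  refine exists_congr fun μ => and_congr_right fun h => ?_
  have := h.1
  exact lintegral_moment_lt_top_iff hlam h.2.1

end SpectralMeasure

/-! ### Regular part of a vector in the domain -/

section DyadicWeights

/-- A discrete form of ∫ t^{3/2} (y/(y+t))² dt/t at t = 4^n. With Y = √y, each term is at most 4Y³
times an increment of 2^n/(Y+2^n), a sequence in [0,1], so the sum telescopes. -/
theorem sum_dyadic_le {y : ℝ} (hy : 0 < y) (N : ℕ) :
    ∑ n ∈ Finset.range N, 8 ^ n * (y / (y + 4 ^ n)) ^ 2 ≤ 4 * y ^ (3 / 2 : ℝ) := by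
  set Y := √y with hY
  have hYpos : 0 < Y := Real.sqrt_pos.mpr hy
  have hYy : Y ^ 2 = y := Real.sq_sqrt hy.le
  have hy32 : y ^ (3 / 2 : ℝ) = Y ^ 3 := by
    rw [hY, Real.sqrt_eq_rpow, ← Real.rpow_natCast, ← Real.rpow_mul hy.le]
    norm_num
  have hterm : ∀ n : ℕ, 8 ^ n * (y / (y + 4 ^ n)) ^ 2 ≤
      4 * Y ^ 3 * (2 ^ (n + 1) / (Y + 2 ^ (n + 1)) - 2 ^ n / (Y + 2 ^ n)) := by
    intro n
    set m : ℝ := 2 ^ n with hm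
    have hmpos : 0 < m := by positivity
    have h4 : (4 : ℝ) ^ n = m ^ 2 := by
      rw [hm, ← pow_mul, mul_comm, pow_mul]; norm_num
    have h8 : (8 : ℝ) ^ n = m ^ 3 := by
      rw [hm, ← pow_mul, mul_comm, pow_mul]; norm_num
    rw [h4, h8, pow_succ (2 : ℝ) n, ← hm, ← hYy]
    have e : m * 2 / (Y + m * 2) - m / (Y + m) = m * Y / ((Y + m * 2) * (Y + m)) := by
      field_simp
      ring
    rw [e, div_pow, mul_div_assoc', mul_div_assoc', div_le_div_iff₀ (by positivity) (by positivity)]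
    have key : m ^ 2 * ((Y + m * 2) * (Y + m)) ≤ 4 * (Y ^ 2 + m ^ 2) ^ 2 := by
      have h1 : (Y + m * 2) * (Y + m) ≤ 4 * (Y ^ 2 + m ^ 2) := by
        nlinarith [sq_nonneg (Y - m), mul_pos hYpos hmpos]
      calc m ^ 2 * ((Y + m * 2) * (Y + m)) ≤ (Y ^ 2 + m ^ 2) * (4 * (Y ^ 2 + m ^ 2)) := by
            gcongr
            nlinarith
        _ = _ := by ring
    calc m ^ 3 * (Y ^ 2) ^ 2 * ((Y + m * 2) * (Y + m))
        = Y ^ 4 * m * (m ^ 2 * ((Y + m * 2) * (Y + m))) := by ring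
      _ ≤ Y ^ 4 * m * (4 * (Y ^ 2 + m ^ 2) ^ 2) := by gcongr
      _ = _ := by ring
  calc _ ≤ ∑ n ∈ Finset.range N,
        4 * Y ^ 3 * (2 ^ (n + 1) / (Y + 2 ^ (n + 1)) - 2 ^ n / (Y + 2 ^ n)) :=
        Finset.sum_le_sum fun n _ => hterm n
    _ = 4 * Y ^ 3 * (2 ^ N / (Y + 2 ^ N) - 2 ^ 0 / (Y + 2 ^ 0)) := by
        rw [← Finset.mul_sum, Finset.sum_range_sub (fun n : ℕ => (2 : ℝ) ^ n / (Y + 2 ^ n))]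
    _ ≤ 4 * Y ^ 3 * 1 := by
        gcongr
        have h1 : (2 : ℝ) ^ N / (Y + 2 ^ N) ≤ 1 := by
          rw [div_le_one (by positivity)]
          linarith
        have h2 : 0 ≤ (2 : ℝ) ^ 0 / (Y + 2 ^ 0) := by positivity
        linarith
    _ = _ := by rw [hy32, mul_one]

/-- The single scale 4^n ≤ y < 4^{n+1} suffices: there the quotient is at least 1/2 and y^{3/2} ≤ 8
· 8^n, whence 32 = 8 · 4. -/
theorem exists_dyadic_ge {y : ℝ} (hy : 1 ≤ y) :
    ∃ n : ℕ, y ^ (3 / 2 : ℝ) ≤ 32 * (8 ^ n * (y / (y + 4 ^ n)) ^ 2) := by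
  obtain ⟨n, h1, h2⟩ := exists_nat_pow_near hy (by norm_num : (1 : ℝ) < 4)
  refine ⟨n, ?_⟩
  have hy0 : 0 < y := by linarith
  have h3 : y ^ (3 / 2 : ℝ) ≤ 8 * 8 ^ n := by
    calc y ^ (3 / 2 : ℝ) ≤ ((4 : ℝ) ^ (n + 1)) ^ (3 / 2 : ℝ) :=
          Real.rpow_le_rpow hy0.le h2.le (by norm_num)
      _ = ((4 : ℝ) ^ (3 / 2 : ℝ)) ^ (n + 1) := by
          rw [← Real.rpow_natCast, ← Real.rpow_mul (by norm_num), mul_comm,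
            Real.rpow_mul (by norm_num), Real.rpow_natCast]
      _ = 8 * 8 ^ n := by
          rw [show (4 : ℝ) = 2 ^ (2 : ℝ) by norm_num, ← Real.rpow_mul (by norm_num)]
          norm_num [pow_succ]
          ring
  have h4 : 1 / 2 ≤ y / (y + 4 ^ n) := by
    rw [div_le_div_iff₀ (by norm_num) (by positivity)]
    linarith
  have h5 : (1 / 2 : ℝ) ^ 2 ≤ (y / (y + 4 ^ n)) ^ 2 := by gcongr
  have h8 : (0 : ℝ) < 8 ^ n := by positivity
  nlinarith

/-- A discrete Hardy inequality. -/
theorem exists_tendsto_of_sum_le {Θ : ℕ → ℂ} {A : ℕ → ℝ} {K : ℝ} (hA : ∀ n, 0 ≤ A n)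
    (hK : ∀ N, ∑ n ∈ Finset.range N, A n ≤ K)
    (hd : ∀ n, 4 ^ n * ‖Θ (n + 1) - Θ n‖ ^ 2 ≤ 8 * A n) :
    ∃ q, ∀ N, ∑ n ∈ Finset.range N, 4 ^ n * ‖Θ n - q‖ ^ 2 ≤ 64 * K := by
  have hAK : ∀ n, A n ≤ K := fun n =>
    (Finset.single_le_sum (fun i _ => hA i) (Finset.self_mem_range_succ n)).trans (hK (n + 1))
  have hK0 : 0 ≤ K := (hA 0).trans (hAK 0)
  set C := √(8 * K)
  have hC2 : C ^ 2 = 8 * K := Real.sq_sqrt (by positivity)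
  have h42 : ∀ n : ℕ, (4 : ℝ) ^ n = (2 ^ n) ^ 2 := fun n => by
    rw [← pow_mul, mul_comm, pow_mul]; norm_num
  have hdist : ∀ n, dist (Θ n) (Θ (n + 1)) ≤ C * (1 / 2) ^ n := by
    intro n
    rw [dist_comm, dist_eq_norm]
    have h1 := (hd n).trans (mul_le_mul_of_nonneg_left (hAK n) (by norm_num : (0 : ℝ) ≤ 8))
    rw [h42, ← mul_pow, ← hC2] at h1
    have h2 := le_of_sq_le_sq h1 (Real.sqrt_nonneg _)
    rw [one_div, inv_pow, ← div_eq_mul_inv, le_div_iff₀ (by positivity), mul_comm]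
    exact h2
  obtain ⟨q, hq⟩ := cauchySeq_tendsto_of_complete
    (cauchySeq_of_le_geometric (1 / 2) C (by norm_num) hdist)
  refine ⟨q, fun N => ?_⟩
  -- A crude bound from geometric convergence. It is needed only for the boundary term when the sum
  -- is shifted below.
  have hb : ∀ n, 4 ^ n * ‖Θ n - q‖ ^ 2 ≤ 32 * K := by
    intro n
    have h1 := dist_le_of_le_geometric_of_tendsto (1 / 2) C (by norm_num) hdist hq n
    rw [dist_eq_norm] at h1
    have h2 : 2 ^ n * ‖Θ n - q‖ ≤ 2 * C := by
      calc 2 ^ n * ‖Θ n - q‖ ≤ 2 ^ n * (C * (1 / 2) ^ n / (1 - 1 / 2)) := by gcongr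
        _ = 2 * C * (2 ^ n * (1 / 2) ^ n) := by ring
        _ = 2 * C := by rw [← mul_pow]; norm_num
    rw [h42, ← mul_pow]
    calc _ ≤ (2 * C) ^ 2 := by gcongr
      _ = _ := by rw [mul_pow, hC2]; ring
  -- Doubling in the triangle inequality against the growth 4 of the weight leaves the factor 1/2 <
  -- 1, so the shifted sum can be absorbed: S ≤ (S + 32K)/2 + 16K gives S ≤ 64K.
  have hrec : ∀ n, 4 ^ n * ‖Θ n - q‖ ^ 2 ≤
      1 / 2 * (4 ^ (n + 1) * ‖Θ (n + 1) - q‖ ^ 2) + 16 * A n := by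
    intro n
    have h1 : ‖Θ n - q‖ ≤ ‖Θ (n + 1) - q‖ + ‖Θ (n + 1) - Θ n‖ := by
      rw [show Θ n - q = (Θ (n + 1) - q) - (Θ (n + 1) - Θ n) by ring]
      exact norm_sub_le _ _
    have h2 : ‖Θ n - q‖ ^ 2 ≤ 2 * ‖Θ (n + 1) - q‖ ^ 2 + 2 * ‖Θ (n + 1) - Θ n‖ ^ 2 := by
      have := pow_le_pow_left₀ (norm_nonneg _) h1 2
      nlinarith [sq_nonneg (‖Θ (n + 1) - q‖ - ‖Θ (n + 1) - Θ n‖)]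
    have h3 : (0 : ℝ) < 4 ^ n := by positivity
    have h4 := hd n
    rw [pow_succ (4 : ℝ) n]
    nlinarith [mul_le_mul_of_nonneg_left h2 h3.le]
  set b : ℕ → ℝ := fun n => 4 ^ n * ‖Θ n - q‖ ^ 2
  have hs : ∑ n ∈ Finset.range N, b n ≤
      1 / 2 * ∑ n ∈ Finset.range N, b (n + 1) + 16 * ∑ n ∈ Finset.range N, A n := by
    rw [Finset.mul_sum, Finset.mul_sum, ← Finset.sum_add_distrib]
    exact Finset.sum_le_sum fun n _ => hrec n
  have hshift : ∑ n ∈ Finset.range N, b (n + 1) ≤ ∑ n ∈ Finset.range N, b n + 32 * K := by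
    have h1 := Finset.sum_range_succ' b N
    have h2 := Finset.sum_range_succ b N
    have h3 : 0 ≤ b 0 := by positivity
    have h4 := hb N
    have h5 : b N ≤ 32 * K := h4
    linarith
  have := hK N
  linarith

end DyadicWeights

/-! ### Splitting off the Green function -/

section RegularPart

variable {α lam : ℝ}

/-- The quantity t · charge(λ+t) approximates the coefficient q. Its increments are themselves
charges of `wav`, and are therefore small when the spectral moment is finite. -/
theorem charge_wav (hα : 0 ≤ α) (hlam : 0 < lam) {h : R3 → ℂ} (hh : MemLp h 2) {t t' : ℝ}
    (ht : 0 ≤ t) (ht' : 0 ≤ t') :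
    ((t' - t : ℝ) : ℂ) * charge α (lam + t') (wav α lam h t) =
      t' * charge α (lam + t') h - t * charge α (lam + t) h := by
  have hz : 0 < lam + t := by positivity
  have hz' : 0 < lam + t' := by positivity
  have e : wav α lam h t = fun p => h p + (-t : ℂ) * krein α (lam + t) h p := by
    ext p; rw [wav]; ring
  have h1 := charge_krein hα hz hz' hh
  rw [show lam + t - (lam + t') = t - t' by ring] at h1
  rw [e, charge_add hz' hh ((memLp_krein hh hz).const_mul _), charge_const_mul]
  push_cast at h1 ⊢
  linear_combination (t : ℂ) * h1

theorem sq_norm_freeRes_integral_le {n : ℕ} (hlam : 0 < lam) (c : ℂ) :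
    8 ^ n * ∫ p, ‖c * gam * freeRes (lam + 4 ^ n) p‖ ^ 2 ≤ 4 ^ n * ‖c‖ ^ 2 := by
  have h2n : (2 : ℝ) ^ n ≤ √(lam + 4 ^ n) := by
    apply Real.le_sqrt_of_sq_le
    rw [← pow_mul, mul_comm, pow_mul]
    norm_num
    exact hlam.le
  have hI : ∫ p, ‖freeRes (lam + 4 ^ n) p‖ ^ 2 = π ^ 2 / √(lam + 4 ^ n) :=
    integral_norm_inv_sq (by positivity)
  simp_rw [norm_mul, mul_pow, Complex.norm_real, Real.norm_eq_abs, sq_abs]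
  rw [integral_const_mul, hI, gam_sq]
  have h8 : (8 : ℝ) ^ n = 4 ^ n * 2 ^ n := by rw [← mul_pow]; norm_num
  rw [h8]
  calc 4 ^ n * 2 ^ n * (‖c‖ ^ 2 * ((2 * π) ^ 3)⁻¹ * (π ^ 2 / √(lam + 4 ^ n)))
      ≤ 4 ^ n * 2 ^ n * (‖c‖ ^ 2 * ((2 * π) ^ 3)⁻¹ * (π ^ 2 / 2 ^ n)) := by gcongr
    _ = 4 ^ n * ‖c‖ ^ 2 * (8 * π)⁻¹ := by field_simp; ring
    _ ≤ 4 ^ n * ‖c‖ ^ 2 * 1 := by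
        gcongr
        exact inv_le_one_of_one_le₀ (by nlinarith [Real.pi_gt_three])
    _ = _ := mul_one _

/-- A square function criterion for membership in `H^{3/2}`. -/
theorem memLp_of_sum_dyadic_le (hlam : 0 < lam) {f : R3 → ℂ} (hf : MemLp f 2) {K : ℝ}
    (hK : ∀ N, ∑ n ∈ Finset.range N,
      8 ^ n * ∫ p : R3, ‖((‖p‖ ^ 2 + lam : ℝ) : ℂ) * f p * freeRes (lam + 4 ^ n) p‖ ^ 2 ≤ K) :
    MemLp (fun p : R3 => (((‖p‖ ^ 2 + lam) ^ (3 / 2 / 2 : ℝ) : ℝ) : ℂ) * f p) 2 := by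
  have hsq : Integrable fun p => ‖f p‖ ^ 2 := (memLp_two_iff_integrable_sq_norm hf.1).mp hf
  have hnorm : ∀ (n : ℕ) (p : R3),
      ‖((‖p‖ ^ 2 + lam : ℝ) : ℂ) * f p * freeRes (lam + 4 ^ n) p‖ ^ 2 =
        ((‖p‖ ^ 2 + lam) / (‖p‖ ^ 2 + lam + 4 ^ n)) ^ 2 * ‖f p‖ ^ 2 := by
    intro n p
    rw [norm_mul, norm_mul, norm_freeRes (by positivity), Complex.norm_real, Real.norm_eq_abs,
      abs_of_pos (by positivity), div_eq_mul_inv, ← add_assoc]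
    ring
  simp_rw [hnorm] at hK
  have hcont : ∀ n : ℕ, Continuous fun p : R3 =>
      ((‖p‖ ^ 2 + lam) / (‖p‖ ^ 2 + lam + 4 ^ n)) ^ 2 := by
    intro n
    exact (Continuous.div (by fun_prop) (by fun_prop) fun p => by positivity).pow 2
  have hle1 : ∀ (n : ℕ) (p : R3), ((‖p‖ ^ 2 + lam) / (‖p‖ ^ 2 + lam + 4 ^ n)) ^ 2 ≤ 1 := by
    intro n p
    refine pow_le_one₀ (by positivity) ?_
    rw [div_le_one (by positivity)]
    have : (0 : ℝ) < 4 ^ n := by positivity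
    linarith
  have hint : ∀ n : ℕ, Integrable fun p : R3 =>
      8 ^ n * (((‖p‖ ^ 2 + lam) / (‖p‖ ^ 2 + lam + 4 ^ n)) ^ 2 * ‖f p‖ ^ 2) := by
    intro n
    refine Integrable.const_mul ?_ _
    refine hsq.mono' ((hcont n).aestronglyMeasurable.mul hsq.1) (Eventually.of_forall fun p => ?_)
    rw [Real.norm_eq_abs, abs_of_nonneg (by positivity)]
    exact mul_le_of_le_one_left (by positivity) (hle1 n p)
  have hw : Continuous fun p : R3 => (‖p‖ ^ 2 + lam) ^ (3 / 2 / 2 : ℝ) :=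
    Continuous.rpow_const (by fun_prop) fun p => Or.inl (by positivity)
  have hmeas : AEStronglyMeasurable
      (fun p : R3 => (((‖p‖ ^ 2 + lam) ^ (3 / 2 / 2 : ℝ) : ℝ) : ℂ) * f p) volume :=
    (Complex.continuous_ofReal.comp hw).aestronglyMeasurable.mul hf.1
  rw [memLp_two_iff_integrable_sq_norm hmeas]
  have hsqe : ∀ p : R3, ‖(((‖p‖ ^ 2 + lam) ^ (3 / 2 / 2 : ℝ) : ℝ) : ℂ) * f p‖ ^ 2 =
      (‖p‖ ^ 2 + lam) ^ (3 / 2 : ℝ) * ‖f p‖ ^ 2 := by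
    intro p
    rw [norm_mul, mul_pow, Complex.norm_real, Real.norm_eq_abs, sq_abs, ← Real.rpow_natCast,
      ← Real.rpow_mul (by positivity)]
    norm_num
  simp_rw [hsqe]
  have hw2 : Continuous fun p : R3 => (‖p‖ ^ 2 + lam) ^ (3 / 2 : ℝ) :=
    Continuous.rpow_const (by fun_prop) fun p => Or.inl (by positivity)
  have hm2 : AEStronglyMeasurable
      (fun p : R3 => (‖p‖ ^ 2 + lam) ^ (3 / 2 : ℝ) * ‖f p‖ ^ 2) volume :=
    hw2.aestronglyMeasurable.mul hsq.1
  rw [← lintegral_ofReal_ne_top_iff_integrable hm2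
    (Eventually.of_forall fun p => by simp only [Pi.zero_apply]; positivity)]
  refine ne_of_lt ?_
  -- Where p² + λ ≤ 1 the weight is harmless; elsewhere one dyadic term already dominates it.
  have hpt : ∀ p : R3, ENNReal.ofReal ((‖p‖ ^ 2 + lam) ^ (3 / 2 : ℝ) * ‖f p‖ ^ 2) ≤
      ENNReal.ofReal (‖f p‖ ^ 2) + 32 * ∑' n : ℕ, ENNReal.ofReal
        (8 ^ n * (((‖p‖ ^ 2 + lam) / (‖p‖ ^ 2 + lam + 4 ^ n)) ^ 2 * ‖f p‖ ^ 2)) := by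
    intro p
    rcases le_total (‖p‖ ^ 2 + lam) 1 with hy | hy
    · refine le_add_right (ENNReal.ofReal_le_ofReal ?_)
      exact mul_le_of_le_one_left (by positivity)
        (Real.rpow_le_one (by positivity) hy (by norm_num))
    · obtain ⟨n, hn⟩ := exists_dyadic_ge hy
      refine le_add_left ?_
      refine le_trans ?_ (mul_le_mul_right (ENNReal.le_tsum n) 32)
      rw [show (32 : ℝ≥0∞) = ENNReal.ofReal 32 by simp, ← ENNReal.ofReal_mul (by norm_num)]
      refine ENNReal.ofReal_le_ofReal ?_
      have := mul_le_mul_of_nonneg_right hn (sq_nonneg ‖f p‖)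
      linarith
  refine (lintegral_mono hpt).trans_lt ?_
  rw [lintegral_add_left' hsq.1.aemeasurable.ennreal_ofReal]
  refine ENNReal.add_lt_top.mpr ⟨hsq.lintegral_lt_top, ?_⟩
  rw [lintegral_const_mul'' _ (AEMeasurable.tsum fun n =>
    (hint n).1.aemeasurable.ennreal_ofReal),
    lintegral_tsum fun n => (hint n).1.aemeasurable.ennreal_ofReal]
  refine ENNReal.mul_lt_top (by simp) ?_
  refine lt_of_le_of_lt ?_ (ENNReal.ofReal_lt_top (r := K))
  refine ENNReal.tsum_le_of_sum_range_le fun N => ?_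
  have e : ∀ n : ℕ, ∫⁻ p : R3, ENNReal.ofReal
      (8 ^ n * (((‖p‖ ^ 2 + lam) / (‖p‖ ^ 2 + lam + 4 ^ n)) ^ 2 * ‖f p‖ ^ 2)) =
      ENNReal.ofReal (8 ^ n * ∫ p : R3,
        (((‖p‖ ^ 2 + lam) / (‖p‖ ^ 2 + lam + 4 ^ n)) ^ 2 * ‖f p‖ ^ 2)) := by
    intro n
    rw [← integral_const_mul, ofReal_integral_eq_lintegral_ofReal (hint n)
      (Eventually.of_forall fun p => by simp only [Pi.zero_apply]; positivity)]
  simp_rw [e]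
  rw [← ENNReal.ofReal_sum_of_nonneg fun n _ =>
    mul_nonneg (by positivity) (integral_nonneg fun p => by positivity)]
  exact ENNReal.ofReal_le_ofReal (hK N)

theorem sum_integral_norm_wav_le (hα : 0 ≤ α) (hlam : 0 < lam) {g : L2} {μ : Measure ℝ}
    (hμ : IsSpectralMeasure (PointLaplacian α) g μ)
    (hi : Integrable (fun x => (x + lam) ^ (3 / 2 : ℝ)) μ) (N : ℕ) :
    ∑ n ∈ Finset.range N, 8 ^ n * ∫ p, ‖wav α lam (hat g) (4 ^ n) p‖ ^ 2 ≤
      4 * ∫ x, (x + lam) ^ (3 / 2 : ℝ) ∂μ := by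
  have := hμ.1
  have hae := IsResolventFamily.ae_nonneg_of_measure_Iio hμ.2.1
  have hint : ∀ n : ℕ, Integrable (fun x => 8 ^ n * ((x + lam) / (x + lam + 4 ^ n)) ^ 2) μ := by
    intro n
    refine Integrable.const_mul ?_ _
    refine Integrable.of_bound (Measurable.aestronglyMeasurable (by fun_prop)) 1 ?_
    filter_upwards [hae] with x hx
    rw [Real.norm_eq_abs, abs_of_nonneg (by positivity)]
    refine pow_le_one₀ (by positivity) ?_
    rw [div_le_one (by positivity)]
    have : (0 : ℝ) < 4 ^ n := by positivity
    linarith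
  have e : ∀ n : ℕ, 8 ^ n * ∫ p, ‖wav α lam (hat g) (4 ^ n) p‖ ^ 2 =
      ∫ x, 8 ^ n * ((x + lam) / (x + lam + 4 ^ n)) ^ 2 ∂μ := by
    intro n
    rw [integral_const_mul, ← integral_norm_wav_sq hα hlam hμ (by positivity)]
  simp_rw [e]
  rw [← integral_finsetSum _ fun n _ => hint n, ← integral_const_mul]
  refine integral_mono_ae (integrable_finsetSum _ fun n _ => hint n) (hi.const_mul _) ?_
  filter_upwards [hae] with x hx
  exact sum_dyadic_le (by positivity) N

/-- Multiplication by p² + λ turns the transform of q G_λ into the constant q · `gam`. What remains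
of the singular part is thus only the deviation of t · charge(λ+t) from q. -/
theorem wav_add_charge {g F : R3 → ℂ} {q : ℂ} (hlam : 0 < lam) {t : ℝ} (ht : 0 ≤ t) {p : R3}
    (hg : g p = F p + q * gam * freeRes lam p) :
    wav α lam g t p = ((‖p‖ ^ 2 + lam : ℝ) : ℂ) * F p * freeRes (lam + t) p -
      (t * charge α (lam + t) g - q) * gam * freeRes (lam + t) p := by
  have h1 := mul_freeRes_cancel hlam p
  have h2 := mul_freeRes_cancel (by positivity : 0 < lam + t) p
  rw [wav, krein, hg]
  push_cast at h1 h2 ⊢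
  linear_combination (F p + q * gam * freeRes lam p) * (-h2) +
    q * gam * freeRes (lam + t) p * h1

/-- The coefficient q is the one supplied by the discrete Hardy inequality for Θ n = 4^n
charge(λ+4^n). The square function of ĝ − q Ĝ_λ is then bounded by the sum of 8^n ‖`wav`‖² and the
Hardy sum. -/
theorem exists_regular_part (hα : 0 ≤ α) (hlam : 0 < lam) {g : L2}
    (hg : g ∈ fracPowDomain (PointLaplacian α) (3 / 4)) :
    ∃ F ∈ Hs (3 / 2), ∃ q : ℂ, g =ᵐ[volume] fun x => F x + q * green lam x := by
  obtain ⟨μ, hμ, hi⟩ := (mem_fracPowDomain_iff hlam).mp hg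
  set K := 4 * ∫ x, (x + lam) ^ (3 / 2 : ℝ) ∂μ with hKdef
  have hgm : MemLp (hat g) 2 := memLp_hat g
  set A : ℕ → ℝ := fun n => 8 ^ n * ∫ p, ‖wav α lam (hat g) (4 ^ n) p‖ ^ 2 with hAdef
  have hA0 : ∀ n, 0 ≤ A n := fun n =>
    mul_nonneg (by positivity) (integral_nonneg fun _ => by positivity)
  have hAK : ∀ N, ∑ n ∈ Finset.range N, A n ≤ K := sum_integral_norm_wav_le hα hlam hμ hi
  set Θ : ℕ → ℂ := fun n => (4 ^ n : ℝ) * charge α (lam + 4 ^ n) (hat g) with hΘ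
  have hd : ∀ n, 4 ^ n * ‖Θ (n + 1) - Θ n‖ ^ 2 ≤ 8 * A n := by
    intro n
    have h1 := charge_wav hα hlam hgm (t := 4 ^ n) (t' := 4 ^ (n + 1)) (by positivity)
      (by positivity)
    have h2 := norm_charge_sq_le hα (by positivity : 0 < lam + 4 ^ (n + 1))
      (memLp_wav (α := α) hlam hgm (by positivity : (0 : ℝ) ≤ 4 ^ n))
    rw [hΘ]
    simp only
    rw [← h1, norm_mul, mul_pow, Complex.norm_real, Real.norm_eq_abs, sq_abs]
    have hs : (2 : ℝ) ^ (n + 1) ≤ √(lam + 4 ^ (n + 1)) := by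
      apply Real.le_sqrt_of_sq_le
      rw [← pow_mul, mul_comm, pow_mul]
      norm_num
      exact hlam.le
    set I := ∫ p, ‖wav α lam (hat g) (4 ^ n) p‖ ^ 2 with hI
    have hI0 : 0 ≤ I := integral_nonneg fun _ => by positivity
    set m : ℝ := 2 ^ n with hm
    have hmpos : 0 < m := by positivity
    have h4 : (4 : ℝ) ^ n = m ^ 2 := by
      rw [hm, ← pow_mul, mul_comm, pow_mul]; norm_num
    have h8 : (8 : ℝ) ^ n = m ^ 3 := by
      rw [hm, ← pow_mul, mul_comm, pow_mul]; norm_num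
    have h3 : ‖charge α (lam + 4 ^ (n + 1)) (wav α lam (hat g) (4 ^ n))‖ ^ 2 ≤
        2 * π * ((m * 2) ^ 3)⁻¹ * I := by
      refine h2.trans ?_
      rw [pow_succ, ← hm] at hs
      gcongr
    -- The computation below produces the constant 9π/4, and 9/4 · 3.2 = 7.2 stays below the 8
    -- required by `exists_tendsto_of_sum_le`.
    have hpi : π ≤ 3.2 := by linarith [Real.pi_lt_d2]
    calc _ ≤ 4 ^ n * ((4 ^ (n + 1) - 4 ^ n) ^ 2 * (2 * π * ((m * 2) ^ 3)⁻¹ * I)) := by gcongr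
      _ = 9 / 4 * π * (m ^ 3 * I) := by
          rw [pow_succ (4 : ℝ) n, h4]
          field_simp
          ring
      _ ≤ 9 / 4 * 3.2 * (m ^ 3 * I) := by gcongr
      _ ≤ 8 * A n := by
          rw [hAdef]
          simp only
          rw [h8, ← hI]
          have : 0 ≤ m ^ 3 * I := by positivity
          linarith
  obtain ⟨q, hq⟩ := exists_tendsto_of_sum_le hA0 hAK hd
  set f : R3 → ℂ := fun p => hat g p + (-(q * gam)) * freeRes lam p with hf
  have hfm : MemLp f 2 := hgm.add ((memLp_freeRes hlam).const_mul _)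
  have hfg : ∀ p, hat g p = f p + q * gam * freeRes lam p := fun p => by rw [hf]; ring
  obtain ⟨F, hF⟩ := exists_hat_eq hfm
  refine ⟨F, ?_, q, ?_⟩
  · rw [mem_Hs_iff (by norm_num) hlam]
    have key : MemLp (fun p : R3 => (((‖p‖ ^ 2 + lam) ^ (3 / 2 / 2 : ℝ) : ℝ) : ℂ) * f p) 2 := by
      refine memLp_of_sum_dyadic_le hlam hfm (K := 2 * K + 2 * (64 * K)) fun N => ?_
      have hterm : ∀ n : ℕ, 8 ^ n *
          ∫ p : R3, ‖((‖p‖ ^ 2 + lam : ℝ) : ℂ) * f p * freeRes (lam + 4 ^ n) p‖ ^ 2 ≤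
            2 * A n + 2 * (4 ^ n * ‖Θ n - q‖ ^ 2) := by
        intro n
        have hz : 0 < lam + 4 ^ n := by positivity
        have m1 : MemLp (wav α lam (hat g) (4 ^ n)) 2 := memLp_wav hlam hgm (by positivity)
        have m2 : MemLp (fun p => (Θ n - q) * gam * freeRes (lam + 4 ^ n) p) 2 :=
          (memLp_freeRes hz).const_mul _
        have i1 := (memLp_two_iff_integrable_sq_norm m1.1).mp m1
        have i2 := (memLp_two_iff_integrable_sq_norm m2.1).mp m2
        have hpt : ∀ p : R3, ((‖p‖ ^ 2 + lam : ℝ) : ℂ) * f p * freeRes (lam + 4 ^ n) p =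
            wav α lam (hat g) (4 ^ n) p + (Θ n - q) * gam * freeRes (lam + 4 ^ n) p := by
          intro p
          rw [wav_add_charge hlam (by positivity) (hfg p)]
          simp only [hΘ]
          ring
        have m3 := m1.add m2
        have i3 := (memLp_two_iff_integrable_sq_norm m3.1).mp m3
        have h1 : ∫ p : R3, ‖((‖p‖ ^ 2 + lam : ℝ) : ℂ) * f p * freeRes (lam + 4 ^ n) p‖ ^ 2 ≤
            2 * (∫ p, ‖wav α lam (hat g) (4 ^ n) p‖ ^ 2) +
              2 * (∫ p, ‖(Θ n - q) * gam * freeRes (lam + 4 ^ n) p‖ ^ 2) := by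
          rw [← integral_const_mul, ← integral_const_mul,
            ← integral_add (i1.const_mul _) (i2.const_mul _)]
          simp_rw [hpt]
          refine integral_mono i3 ((i1.const_mul _).add (i2.const_mul _)) fun p => ?_
          have := pow_le_pow_left₀ (norm_nonneg _) (norm_add_le (wav α lam (hat g) (4 ^ n) p)
            ((Θ n - q) * gam * freeRes (lam + 4 ^ n) p)) 2
          simp only
          nlinarith [sq_nonneg (‖wav α lam (hat g) (4 ^ n) p‖ -
            ‖(Θ n - q) * gam * freeRes (lam + 4 ^ n) p‖)]
        have h2 := sq_norm_freeRes_integral_le (n := n) hlam (Θ n - q)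
        have h8 : (0 : ℝ) < 8 ^ n := by positivity
        have h3 := mul_le_mul_of_nonneg_left h1 h8.le
        simp only [hAdef]
        linarith
      calc _ ≤ ∑ n ∈ Finset.range N, (2 * A n + 2 * (4 ^ n * ‖Θ n - q‖ ^ 2)) :=
            Finset.sum_le_sum fun n _ => hterm n
        _ = 2 * ∑ n ∈ Finset.range N, A n +
            2 * ∑ n ∈ Finset.range N, 4 ^ n * ‖Θ n - q‖ ^ 2 := by
            rw [Finset.sum_add_distrib, Finset.mul_sum, Finset.mul_sum]
        _ ≤ _ := by
            have := hAK N
            have := hq N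
            linarith
    refine key.ae_eq ?_
    filter_upwards [hF] with p hp
    rw [hp]
  · rw [ae_eq_add_green_iff hlam]
    filter_upwards [hF] with p hp
    rw [hfg p, hp, freeRes, div_eq_mul_inv]
    push_cast
    ring

end RegularPart

/-! ### Values at the origin -/

section Limits

theorem rpow_mul_sq_le {y z u : ℝ} (hy : 0 < y) (hz : 0 < z) (hyu : y ≤ u) (hzu : z ≤ u) :
    z ^ (3 / 2 : ℝ) * (y / u) ^ 2 ≤ y ^ (3 / 2 : ℝ) := by
  have hu : 0 < u := hy.trans_le hyu
  have hsplit : ∀ x : ℝ, 0 < x → x ^ 2 = x ^ (3 / 2 : ℝ) * x ^ (1 / 2 : ℝ) := fun x hx => by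
    rw [← Real.rpow_add hx]; norm_num
  rw [div_pow, hsplit y hy, hsplit u hu, mul_div_assoc', div_le_iff₀ (by positivity)]
  calc z ^ (3 / 2 : ℝ) * (y ^ (3 / 2 : ℝ) * y ^ (1 / 2 : ℝ))
      ≤ u ^ (3 / 2 : ℝ) * (y ^ (3 / 2 : ℝ) * u ^ (1 / 2 : ℝ)) := by
        gcongr
    _ = _ := by ring

theorem tendsto_rpow_mul_sq {y a : ℝ} (ha : 0 ≤ a) :
    Tendsto (fun z : ℝ => z ^ (3 / 2 : ℝ) * (y / (a + z)) ^ 2) atTop (𝓝 0) := by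
  have h1 := (tendsto_rpow_neg_atTop (by norm_num : (0 : ℝ) < 1 / 2)).const_mul (y ^ 2)
  rw [mul_zero] at h1
  refine squeeze_zero' ?_ ?_ h1
  · filter_upwards [eventually_gt_atTop 0] with z hz
    positivity
  · filter_upwards [eventually_gt_atTop 0] with z hz
    calc z ^ (3 / 2 : ℝ) * (y / (a + z)) ^ 2 = y ^ 2 * (z ^ (3 / 2 : ℝ) / (a + z) ^ 2) := by
          rw [div_pow]; ring
      _ ≤ y ^ 2 * (z ^ (3 / 2 : ℝ) / z ^ 2) := by
          gcongr
          linarith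
      _ = y ^ 2 * z ^ (-(1 / 2) : ℝ) := by
          rw [← Real.rpow_natCast z 2, ← Real.rpow_sub hz]
          norm_num

/-- For z ≥ λ the integrand is dominated by the assumed integrable function and tends to 0
pointwise. Stated abstractly because it serves both momentum space with weight |F̂|² and the
spectral measure with weight 1. -/
theorem tendsto_integral_rpow_mul_sq {X : Type*} [MeasurableSpace X] {ν : Measure X} {a w : X → ℝ}
    {lam : ℝ} (hlam : 0 < lam) (ha : Measurable a) (ha0 : ∀ᵐ x ∂ν, 0 ≤ a x)
    (hw : AEStronglyMeasurable w ν) (hw0 : ∀ x, 0 ≤ w x)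
    (hi : Integrable (fun x => (a x + lam) ^ (3 / 2 : ℝ) * w x) ν) :
    Tendsto (fun z : ℝ => z ^ (3 / 2 : ℝ) * ∫ x, ((a x + lam) / (a x + z)) ^ 2 * w x ∂ν) atTop
      (𝓝 0) := by
  have h : Tendsto (fun z : ℝ => ∫ x, z ^ (3 / 2 : ℝ) * ((a x + lam) / (a x + z)) ^ 2 * w x ∂ν)
      atTop (𝓝 (∫ _, (0 : ℝ) ∂ν)) := by
    refine tendsto_integral_filter_of_dominated_convergence _ ?_ ?_ hi ?_
    · refine Eventually.of_forall fun z => ?_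
      exact (Measurable.aestronglyMeasurable (by fun_prop)).mul hw
    · filter_upwards [eventually_ge_atTop lam] with z hz
      filter_upwards [ha0] with x hx
      have hz0 : 0 < z := hlam.trans_le hz
      have := hw0 x
      rw [Real.norm_eq_abs, abs_of_nonneg (by positivity)]
      refine mul_le_mul_of_nonneg_right ?_ this
      exact rpow_mul_sq_le (by positivity) hz0 (by linarith) (by linarith)
    · filter_upwards [ha0] with x hx
      simpa using (tendsto_rpow_mul_sq (y := a x + lam) hx).mul_const (w x)
  rw [integral_zero] at h
  refine h.congr fun z => ?_
  rw [← integral_const_mul]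
  simp only [mul_assoc]

variable {α lam : ℝ}

theorem integrable_rpow_mul_norm_hat_sq (hlam : 0 < lam) {F : L2} (hF : F ∈ Hs (3 / 2)) :
    Integrable fun p : R3 => (‖p‖ ^ 2 + lam) ^ (3 / 2 : ℝ) * ‖hat F p‖ ^ 2 := by
  have h1 := (mem_Hs_iff (by norm_num) hlam F).mp hF
  refine ((memLp_two_iff_integrable_sq_norm h1.1).mp h1).congr (Eventually.of_forall fun p => ?_)
  simp only
  rw [norm_mul, mul_pow, Complex.norm_real, Real.norm_eq_abs, sq_abs, ← Real.rpow_natCast,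
    ← Real.rpow_mul (by positivity)]
  norm_num

/-- The free resolvent of G_λ at the origin is an increment of the coupling divided by t. Hence the
deviation of the charge compares t κ_F(t) with q · coupling(λ). -/
theorem mul_charge_sub {h f : R3 → ℂ} {q : ℂ} (hα : 0 ≤ α) (hlam : 0 < lam) {t : ℝ} (ht : 0 ≤ t)
    (hf : MemLp f 2) (hh : h =ᵐ[volume] fun p => f p + q * gam * freeRes lam p) :
    t * charge α (lam + t) h - q =
      (t * resAtZero (lam + t) f - q * coupling α lam) / coupling α (lam + t) := by
  have hz : 0 < lam + t := by positivity
  have h0 := coupling_ne_zero hα hz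
  have h1 := resAtZero_freeRes (α := α) hlam hz
  rw [charge_congr hh, charge, resAtZero_add hz hf ((memLp_freeRes hlam).const_mul _),
    resAtZero_const_mul]
  field_simp
  push_cast at h1
  linear_combination (-q) * h1

theorem integral_norm_add_sq_le {f g : R3 → ℂ} (hf : MemLp f 2) (hg : MemLp g 2) :
    ∫ p, ‖f p + g p‖ ^ 2 ≤ 2 * (∫ p, ‖f p‖ ^ 2) + 2 * (∫ p, ‖g p‖ ^ 2) := by
  have i1 := (memLp_two_iff_integrable_sq_norm hf.1).mp hf
  have i2 := (memLp_two_iff_integrable_sq_norm hg.1).mp hg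
  have i3 : Integrable fun p => ‖f p + g p‖ ^ 2 :=
    (memLp_two_iff_integrable_sq_norm (hf.add hg).1).mp (hf.add hg)
  rw [← integral_const_mul, ← integral_const_mul,
    ← integral_add (i1.const_mul _) (i2.const_mul _)]
  refine integral_mono i3 ((i1.const_mul _).add (i2.const_mul _)) fun p => ?_
  have := pow_le_pow_left₀ (norm_nonneg _) (norm_add_le (f p) (g p)) 2
  simp only
  nlinarith [sq_nonneg (‖f p‖ - ‖g p‖)]

theorem memLp_mul_freeRes_smul (hlam : 0 < lam) {f : R3 → ℂ} (hf : MemLp f 2) {t : ℝ}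
    (ht : 0 ≤ t) :
    MemLp (fun p : R3 => ((‖p‖ ^ 2 + lam : ℝ) : ℂ) * f p * freeRes (lam + t) p) 2 := by
  have hc : Continuous fun p : R3 => ((‖p‖ ^ 2 + lam : ℝ) : ℂ) :=
    Complex.continuous_ofReal.comp (by fun_prop)
  have hz : 0 < lam + t := by positivity
  refine hf.of_le_mul (c := 1) ((hc.aestronglyMeasurable.mul hf.1).mul
    (continuous_freeRes hz).aestronglyMeasurable) (Eventually.of_forall fun p => ?_)
  rw [norm_mul, norm_mul, norm_freeRes hz, Complex.norm_real, Real.norm_eq_abs,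
    abs_of_pos (by positivity), mul_right_comm]
  gcongr
  rw [← div_eq_mul_inv, div_le_one (by positivity)]
  linarith

theorem coupling_le_mul_sqrt (hα : 0 ≤ α) {z : ℝ} (hz : 1 ≤ z) :
    coupling α z ≤ (α + 1) * √z := by
  have h1 : 1 ≤ √z := Real.one_le_sqrt.mpr hz
  have h2 : √z / (4 * π) ≤ √z := div_le_self (by positivity) (by nlinarith [Real.pi_gt_three])
  unfold coupling
  nlinarith

/-- Let r be the deviation of t · charge(z) from q, where z = λ + t. By `wav_add_charge`, r times a
Green function is the difference of a regular vector and `wav`; taking norms, |r|²/(8π√z) ≤ 2V + 2W.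
The quantity of interest is r · coupling(z), and coupling(z) is O(√z), so its square is
O(z^{3/2}(V+W)), which tends to 0. -/
theorem tendsto_mul_kappa_of_mem (hα : 0 ≤ α) (hlam : 0 < lam) {g F : L2} {q : ℂ}
    (hg : g ∈ fracPowDomain (PointLaplacian α) (3 / 4)) (hF : F ∈ Hs (3 / 2))
    (hgF : hat g =ᵐ[volume] fun p => hat F p + q * gam * freeRes lam p) :
    Tendsto (fun t : ℝ => t * kappa lam F t) atTop (𝓝 (q * coupling α lam)) := by
  obtain ⟨μ, hμ, hi⟩ := (mem_fracPowDomain_iff hlam).mp hg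
  have hFm := memLp_hat F
  have hgm := memLp_hat g
  have hae := IsResolventFamily.ae_nonneg_of_measure_Iio hμ.2.1
  set V : ℝ → ℝ := fun z => ∫ p : R3, ((‖p‖ ^ 2 + lam) / (‖p‖ ^ 2 + z)) ^ 2 * ‖hat F p‖ ^ 2
  set W : ℝ → ℝ := fun z => ∫ x, ((x + lam) / (x + z)) ^ 2 * 1 ∂μ
  have hV : Tendsto (fun z : ℝ => z ^ (3 / 2 : ℝ) * V z) atTop (𝓝 0) :=
    tendsto_integral_rpow_mul_sq hlam (by fun_prop)
      (Eventually.of_forall fun p => by positivity) (hFm.1.norm.pow 2) (fun p => by positivity)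
      (integrable_rpow_mul_norm_hat_sq hlam hF)
  have hW : Tendsto (fun z : ℝ => z ^ (3 / 2 : ℝ) * W z) atTop (𝓝 0) :=
    tendsto_integral_rpow_mul_sq (a := fun x => x) (w := fun _ => 1) hlam measurable_id hae
      aestronglyMeasurable_const (fun _ => zero_le_one) (by simpa using hi)
  have hlim : Tendsto (fun z : ℝ => 16 * π * (α + 1) ^ 2 *
      (z ^ (3 / 2 : ℝ) * V z + z ^ (3 / 2 : ℝ) * W z)) atTop (𝓝 0) := by
    simpa using (hV.add hW).const_mul (16 * π * (α + 1) ^ 2)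
  have hshift : Tendsto (fun t : ℝ => lam + t) atTop atTop :=
    tendsto_atTop_add_const_left _ _ tendsto_id
  have hbound : ∀ t : ℝ, 1 ≤ t → ‖t * kappa lam F t - q * coupling α lam‖ ^ 2 ≤
      16 * π * (α + 1) ^ 2 * ((lam + t) ^ (3 / 2 : ℝ) * V (lam + t) +
        (lam + t) ^ (3 / 2 : ℝ) * W (lam + t)) := by
    intro t ht
    have ht0 : 0 ≤ t := by linarith
    set z := lam + t with hz
    have hz0 : 0 < z := by positivity
    have hz1 : 1 ≤ z := by linarith
    set r : ℂ := t * charge α z (hat g) - q with hr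
    have hrk : t * kappa lam F t - q * coupling α lam = r * coupling α z := by
      rw [hr, mul_charge_sub hα hlam ht0 hFm hgF, kappa_eq,
        div_mul_cancel₀ _ (coupling_ne_zero hα hz0)]
    have m1 := memLp_mul_freeRes_smul hlam hFm ht0
    have m2 : MemLp (fun p => -wav α lam (hat g) t p) 2 := (memLp_wav hlam hgm ht0).neg
    have e1 : ∫ p, ‖r * gam * freeRes z p‖ ^ 2 = ‖r‖ ^ 2 * gam ^ 2 * (π ^ 2 / √z) := by
      have hI : ∫ p, ‖freeRes z p‖ ^ 2 = π ^ 2 / √z := integral_norm_inv_sq hz0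
      simp_rw [norm_mul, mul_pow, Complex.norm_real, Real.norm_eq_abs, sq_abs]
      rw [integral_const_mul, hI]
    have e2 : ∫ p, ‖r * gam * freeRes z p‖ ^ 2 ≤ 2 * V z + 2 * W z := by
      have h1 := integral_norm_add_sq_le m1 m2
      have h2 : ∫ p : R3, ‖((‖p‖ ^ 2 + lam : ℝ) : ℂ) * hat F p * freeRes (lam + t) p‖ ^ 2 = V z := by
        refine integral_congr_ae (Eventually.of_forall fun p => ?_)
        simp only
        rw [norm_mul, norm_mul, norm_freeRes hz0, Complex.norm_real, Real.norm_eq_abs,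
          abs_of_pos (by positivity), div_eq_mul_inv]
        ring
      have h3 : ∫ p, ‖-wav α lam (hat g) t p‖ ^ 2 = W z := by
        simp_rw [norm_neg]
        rw [integral_norm_wav_sq hα hlam hμ ht0]
        refine integral_congr_ae (Eventually.of_forall fun x => ?_)
        simp only [mul_one, hz, add_assoc]
      rw [h2, h3] at h1
      refine le_of_eq_of_le ?_ h1
      refine integral_congr_ae ?_
      filter_upwards [hgF] with p hp
      rw [wav_add_charge hlam ht0 hp]
      congr 2
      ring
    rw [e1, gam_sq] at e2
    have hs := Real.sqrt_pos.mpr hz0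
    have h32 : z ^ (3 / 2 : ℝ) = √z ^ 3 := by
      rw [Real.sqrt_eq_rpow, ← Real.rpow_natCast, ← Real.rpow_mul hz0.le]
      norm_num
    have e3 : ‖r‖ ^ 2 ≤ 16 * π * √z * (V z + W z) := by
      have h4 : ‖r‖ ^ 2 = (8 * π * √z) * (‖r‖ ^ 2 * ((2 * π) ^ 3)⁻¹ * (π ^ 2 / √z)) := by
        field_simp
        ring
      rw [h4]
      calc _ ≤ (8 * π * √z) * (2 * V z + 2 * W z) := by gcongr
        _ = _ := by ring
    rw [hrk, norm_mul, mul_pow, Complex.norm_real, Real.norm_eq_abs, sq_abs, h32]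
    have hVW : 0 ≤ V z + W z :=
      add_nonneg (integral_nonneg fun _ => by positivity) (integral_nonneg fun _ => by positivity)
    have hc := coupling_le_mul_sqrt hα hz1
    have hc0 := coupling_pos hα hz0
    calc ‖r‖ ^ 2 * coupling α z ^ 2 ≤ (16 * π * √z * (V z + W z)) * ((α + 1) * √z) ^ 2 := by
          gcongr
      _ = _ := by ring
  rw [tendsto_iff_norm_sub_tendsto_zero]
  have hsq := squeeze_zero' (f := fun t : ℝ => ‖t * kappa lam F t - q * coupling α lam‖ ^ 2)
    (Eventually.of_forall fun t => by positivity)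
    ((eventually_ge_atTop 1).mono hbound) (hlim.comp hshift)
  have := (Real.continuous_sqrt.tendsto 0).comp hsq
  rw [Real.sqrt_zero] at this
  exact this.congr fun t => Real.sqrt_sq (norm_nonneg _)

end Limits

/-! ### Comparison of smooth and sharp momentum cutoffs -/

section ValueAtZero

variable {lam : ℝ}

/-- The difference between the smooth cutoff `R² / (p² + λ + R²)` and the sharp one. -/
def cutoffDiff (lam R : ℝ) (p : R3) : ℝ :=
  R ^ 2 * (‖p‖ ^ 2 + (lam + R ^ 2))⁻¹ - (Metric.ball (0 : R3) R).indicator (fun _ => 1) p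

theorem measurable_cutoffDiff (lam R : ℝ) : Measurable (cutoffDiff lam R) := by
  unfold cutoffDiff
  exact Measurable.sub (by fun_prop) (measurable_const.indicator Metric.isOpen_ball.measurableSet)

theorem abs_cutoffDiff_le_one (hlam : 0 < lam) (R : ℝ) (p : R3) : |cutoffDiff lam R p| ≤ 1 := by
  have h1 : 0 ≤ R ^ 2 * (‖p‖ ^ 2 + (lam + R ^ 2))⁻¹ := by positivity
  have h2 : R ^ 2 * (‖p‖ ^ 2 + (lam + R ^ 2))⁻¹ ≤ 1 := by
    rw [← div_eq_mul_inv, div_le_one (by positivity)]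
    nlinarith [sq_nonneg ‖p‖]
  rw [cutoffDiff, abs_le]
  by_cases hp : p ∈ Metric.ball (0 : R3) R
  · rw [indicator_of_mem hp]; constructor <;> linarith
  · rw [indicator_of_notMem hp]; constructor <;> linarith

/-- With u = p² + λ + R², the difference has size (p²+λ)/u inside the ball, where u ≤ 3R², and R²/u
outside, where u ≤ 3(p²+λ). One symmetric bound covers both cases. -/
theorem abs_cutoffDiff_le (hlam : 0 < lam) {R : ℝ} (hR : 0 < R) (hlR : lam ≤ R ^ 2) (p : R3) :
    |cutoffDiff lam R p| ≤
      3 * (‖p‖ ^ 2 + lam) * R ^ 2 * (‖p‖ ^ 2 + (lam + R ^ 2))⁻¹ ^ 2 := by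
  have hu : 0 < ‖p‖ ^ 2 + (lam + R ^ 2) := by positivity
  rw [cutoffDiff]
  by_cases hp : p ∈ Metric.ball (0 : R3) R
  · rw [indicator_of_mem hp]
    have hp' : ‖p‖ < R := by simpa using hp
    have hpR : ‖p‖ ^ 2 ≤ R ^ 2 := by gcongr
    have e : R ^ 2 * (‖p‖ ^ 2 + (lam + R ^ 2))⁻¹ - 1 =
        -((‖p‖ ^ 2 + lam) * (‖p‖ ^ 2 + (lam + R ^ 2))⁻¹) := by
      field_simp
      ring
    rw [e, abs_neg, abs_of_nonneg (by positivity), ← div_eq_mul_inv, inv_pow, ← div_eq_mul_inv,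
      div_le_div_iff₀ hu (by positivity)]
    have : ‖p‖ ^ 2 + (lam + R ^ 2) ≤ 3 * R ^ 2 := by linarith
    calc (‖p‖ ^ 2 + lam) * (‖p‖ ^ 2 + (lam + R ^ 2)) ^ 2
        = (‖p‖ ^ 2 + lam) * (‖p‖ ^ 2 + (lam + R ^ 2)) * (‖p‖ ^ 2 + (lam + R ^ 2)) := by ring
      _ ≤ (‖p‖ ^ 2 + lam) * (3 * R ^ 2) * (‖p‖ ^ 2 + (lam + R ^ 2)) := by gcongr
      _ = _ := by ring
  · rw [indicator_of_notMem hp]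
    have hp' : R ≤ ‖p‖ := by simpa using hp
    have hpR : R ^ 2 ≤ ‖p‖ ^ 2 := by gcongr
    rw [sub_zero, abs_of_nonneg (by positivity), ← div_eq_mul_inv, inv_pow, ← div_eq_mul_inv,
      div_le_div_iff₀ hu (by positivity)]
    have : ‖p‖ ^ 2 + (lam + R ^ 2) ≤ 3 * (‖p‖ ^ 2 + lam) := by linarith
    calc R ^ 2 * (‖p‖ ^ 2 + (lam + R ^ 2)) ^ 2
        = (‖p‖ ^ 2 + (lam + R ^ 2)) * R ^ 2 * (‖p‖ ^ 2 + (lam + R ^ 2)) := by ring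
      _ ≤ 3 * (‖p‖ ^ 2 + lam) * R ^ 2 * (‖p‖ ^ 2 + (lam + R ^ 2)) := by gcongr

theorem tendsto_cutoffDiff (hlam : 0 < lam) (p : R3) :
    Tendsto (fun R => cutoffDiff lam R p) atTop (𝓝 0) := by
  have h1 : Tendsto (fun R : ℝ => -((‖p‖ ^ 2 + lam) / (‖p‖ ^ 2 + lam + R ^ 2))) atTop
      (𝓝 (-0)) :=
    (tendsto_const_nhds.div_atTop (tendsto_atTop_add_const_left _ _
      (tendsto_pow_atTop two_ne_zero))).neg
  rw [neg_zero] at h1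
  refine h1.congr' ?_
  filter_upwards [eventually_gt_atTop ‖p‖] with R hR
  rw [cutoffDiff, indicator_of_mem (by simpa using hR)]
  have : ‖p‖ ^ 2 + lam + R ^ 2 ≠ 0 := by positivity
  have : ‖p‖ ^ 2 + (lam + R ^ 2) ≠ 0 := by positivity
  field_simp
  ring

/-- The root in (p²+λ)^{-1/2} is removed by the arithmetic–geometric mean inequality at scale R.
This leaves products of two free symbols, whose integrals are explicit and of order 1/R. -/
theorem rpow_neg_mul_abs_cutoffDiff_le (hlam : 0 < lam) {R : ℝ} (hR : 0 < R) (hlR : lam ≤ R ^ 2)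
    (p : R3) : (‖p‖ ^ 2 + lam) ^ (-(3 / 2) : ℝ) * |cutoffDiff lam R p| ≤
      3 / 2 * (R * ((‖p‖ ^ 2 + lam)⁻¹ * (‖p‖ ^ 2 + (lam + R ^ 2))⁻¹) +
        R * ((‖p‖ ^ 2 + (lam + R ^ 2))⁻¹ * (‖p‖ ^ 2 + (lam + R ^ 2))⁻¹)) := by
  set y := ‖p‖ ^ 2 + lam with hy
  have hy0 : 0 < y := by positivity
  have hu : 0 < ‖p‖ ^ 2 + (lam + R ^ 2) := by positivity
  set i := (‖p‖ ^ 2 + (lam + R ^ 2))⁻¹ with hi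
  have hi0 : 0 < i := by positivity
  have hRi : R ^ 2 * i ≤ 1 := by
    rw [hi, ← div_eq_mul_inv, div_le_one hu]
    nlinarith [sq_nonneg ‖p‖]
  have hs := Real.sqrt_pos.mpr hy0
  have e1 : y ^ (-(3 / 2) : ℝ) * y = (√y)⁻¹ := by
    rw [Real.sqrt_eq_rpow, ← Real.rpow_neg hy0.le, ← Real.rpow_add_one hy0.ne']
    norm_num
  have e2 : (√y)⁻¹ ≤ 1 / 2 * (R * y⁻¹ + R⁻¹) := by
    have h1 := two_mul_le_add_sq (R * (√y)⁻¹) 1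
    have h2 : ((√y)⁻¹) ^ 2 = y⁻¹ := by rw [inv_pow, Real.sq_sqrt hy0.le]
    have h3 : R⁻¹ * (2 * (R * (√y)⁻¹) * 1) ≤ R⁻¹ * ((R * (√y)⁻¹) ^ 2 + 1 ^ 2) := by gcongr
    rw [mul_pow, h2] at h3
    field_simp at h3 ⊢
    linarith
  calc y ^ (-(3 / 2) : ℝ) * |cutoffDiff lam R p|
      ≤ y ^ (-(3 / 2) : ℝ) * (3 * y * R ^ 2 * i ^ 2) := by
        gcongr
        exact abs_cutoffDiff_le hlam hR hlR p
    _ = 3 * (y ^ (-(3 / 2) : ℝ) * y) * (R ^ 2 * i ^ 2) := by ring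
    _ ≤ 3 * (1 / 2 * (R * y⁻¹ + R⁻¹)) * (R ^ 2 * i ^ 2) := by rw [e1]; gcongr
    _ = 3 / 2 * (R * (y⁻¹ * i) * (R ^ 2 * i) + R * (i * i) * (R⁻¹ * R)) := by
        field_simp
    _ ≤ 3 / 2 * (R * (y⁻¹ * i) * 1 + R * (i * i) * 1) := by
        rw [inv_mul_cancel₀ hR.ne']
        gcongr
    _ = _ := by ring

theorem integrable_rpow_neg_mul_abs_cutoffDiff (hlam : 0 < lam) {R : ℝ} (hR : 0 < R)
    (hlR : lam ≤ R ^ 2) :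
    Integrable fun p : R3 => (‖p‖ ^ 2 + lam) ^ (-(3 / 2) : ℝ) * |cutoffDiff lam R p| := by
  have hz : 0 < lam + R ^ 2 := by positivity
  refine (((integrable_inv_mul_inv hlam hz).const_mul R).add
    ((integrable_inv_mul_inv hz hz).const_mul R)).const_mul (3 / 2) |>.mono' ?_
    (Eventually.of_forall fun p => ?_)
  · exact (Measurable.mul (by fun_prop)
      (measurable_cutoffDiff lam R).norm).aestronglyMeasurable
  · rw [Real.norm_eq_abs, abs_of_nonneg (by positivity)]
    exact rpow_neg_mul_abs_cutoffDiff_le hlam hR hlR p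

theorem integral_rpow_neg_mul_abs_cutoffDiff_le (hlam : 0 < lam) {R : ℝ} (hR : 0 < R)
    (hlR : lam ≤ R ^ 2) :
    ∫ p : R3, (‖p‖ ^ 2 + lam) ^ (-(3 / 2) : ℝ) * |cutoffDiff lam R p| ≤ 5 * π ^ 2 := by
  have hz : 0 < lam + R ^ 2 := by positivity
  have i1 := (integrable_inv_mul_inv hlam hz).const_mul R
  have i2 := (integrable_inv_mul_inv hz hz).const_mul R
  have hs : R ≤ √(lam + R ^ 2) := Real.le_sqrt_of_sq_le (by linarith)
  have hs0 := Real.sqrt_nonneg lam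
  calc _ ≤ ∫ p : R3, 3 / 2 * (R * ((‖p‖ ^ 2 + lam)⁻¹ * (‖p‖ ^ 2 + (lam + R ^ 2))⁻¹) +
        R * ((‖p‖ ^ 2 + (lam + R ^ 2))⁻¹ * (‖p‖ ^ 2 + (lam + R ^ 2))⁻¹)) :=
        integral_mono (integrable_rpow_neg_mul_abs_cutoffDiff hlam hR hlR)
          ((i1.add i2).const_mul _) (rpow_neg_mul_abs_cutoffDiff_le hlam hR hlR)
    _ = 3 / 2 * (R * (2 * π ^ 2 / (√lam + √(lam + R ^ 2))) +
        R * (2 * π ^ 2 / (√(lam + R ^ 2) + √(lam + R ^ 2)))) := by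
        rw [integral_const_mul, integral_add i1 i2, integral_const_mul, integral_const_mul,
          integral_inv_mul_inv hlam hz, integral_inv_mul_inv hz hz]
    _ ≤ 3 / 2 * (R * (2 * π ^ 2 / (0 + R)) + R * (2 * π ^ 2 / (R + R))) := by gcongr
    _ = 9 / 2 * π ^ 2 := by field_simp; ring
    _ ≤ _ := by nlinarith [sq_nonneg π]

/-- For `F ∈ H^{3/2}` the smooth and the sharp cutoff define the same value at the origin. -/
theorem tendsto_integral_mul_cutoffDiff (hlam : 0 < lam) {F : L2} (hF : F ∈ Hs (3 / 2)) :
    Tendsto (fun R => ∫ p, hat F p * (cutoffDiff lam R p : ℂ)) atTop (𝓝 0) := by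
  have hi := integrable_rpow_mul_norm_hat_sq hlam hF
  have hFm := memLp_hat F
  have hV : Tendsto (fun R : ℝ => ∫ p : R3,
      (‖p‖ ^ 2 + lam) ^ (3 / 2 : ℝ) * ‖hat F p‖ ^ 2 * |cutoffDiff lam R p|) atTop
      (𝓝 (∫ _ : R3, (0 : ℝ))) := by
    refine tendsto_integral_filter_of_dominated_convergence _ ?_ ?_ hi ?_
    · exact Eventually.of_forall fun R => hi.1.mul
        (measurable_cutoffDiff lam R).norm.aestronglyMeasurable
    · refine Eventually.of_forall fun R => Eventually.of_forall fun p => ?_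
      rw [Real.norm_eq_abs, abs_of_nonneg (by positivity)]
      exact mul_le_of_le_one_right (by positivity) (abs_cutoffDiff_le_one hlam R p)
    · refine Eventually.of_forall fun p => ?_
      simpa using (tendsto_cutoffDiff hlam p).abs.const_mul
        ((‖p‖ ^ 2 + lam) ^ (3 / 2 : ℝ) * ‖hat F p‖ ^ 2)
  rw [integral_zero] at hV
  rw [Metric.tendsto_nhds]
  intro ε hε
  -- Weighted Cauchy–Schwarz with |`cutoffDiff`| as density. The function (p²+λ)^{-3/2} is not
  -- integrable on ℝ³; against the density its integral is only bounded, by 5π², while the H^{3/2}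
  -- integral tends to 0. This δ makes each contribution ε/2.
  set δ : ℝ := ε / (5 * π ^ 2) with hδ
  have hδ0 : 0 < δ := by positivity
  have hev := hV.eventually (gt_mem_nhds (by positivity : 0 < δ * ε))
  have hRl : ∀ᶠ R : ℝ in atTop, lam ≤ R ^ 2 :=
    (tendsto_pow_atTop two_ne_zero).eventually_ge_atTop lam
  filter_upwards [hev, hRl, eventually_gt_atTop 0] with R h1 hlR hR
  have j1 : Integrable fun p : R3 =>
      (‖p‖ ^ 2 + lam) ^ (3 / 2 : ℝ) * ‖hat F p‖ ^ 2 * |cutoffDiff lam R p| := by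
    refine hi.mono' (hi.1.mul (measurable_cutoffDiff lam R).norm.aestronglyMeasurable)
      (Eventually.of_forall fun p => ?_)
    rw [Real.norm_eq_abs, abs_of_nonneg (by positivity)]
    exact mul_le_of_le_one_right (by positivity) (abs_cutoffDiff_le_one hlam R p)
  have j2 := integrable_rpow_neg_mul_abs_cutoffDiff hlam hR hlR
  have h2 := integral_rpow_neg_mul_abs_cutoffDiff_le hlam hR hlR
  have hpt : ∀ p : R3, ‖hat F p * (cutoffDiff lam R p : ℂ)‖ ≤
      1 / 2 * (δ⁻¹ * ((‖p‖ ^ 2 + lam) ^ (3 / 2 : ℝ) * ‖hat F p‖ ^ 2 * |cutoffDiff lam R p|) +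
        δ * ((‖p‖ ^ 2 + lam) ^ (-(3 / 2) : ℝ) * |cutoffDiff lam R p|)) := by
    intro p
    rw [norm_mul, Complex.norm_real, Real.norm_eq_abs]
    have hy : 0 < ‖p‖ ^ 2 + lam := by positivity
    set Y := (‖p‖ ^ 2 + lam) ^ (3 / 2 : ℝ) with hY
    have hY0 : 0 < Y := by positivity
    rw [Real.rpow_neg hy.le, ← hY]
    have h3 : 2 * ‖hat F p‖ ≤ δ⁻¹ * (Y * ‖hat F p‖ ^ 2) + δ * Y⁻¹ := by
      have := sq_nonneg (Y * ‖hat F p‖ - δ)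
      rw [← sub_nonneg]
      have e : δ⁻¹ * (Y * ‖hat F p‖ ^ 2) + δ * Y⁻¹ - 2 * ‖hat F p‖ =
          (δ * Y)⁻¹ * (Y * ‖hat F p‖ - δ) ^ 2 := by
        field_simp
        ring
      rw [e]
      positivity
    have := mul_le_mul_of_nonneg_right h3 (abs_nonneg (cutoffDiff lam R p))
    linarith
  rw [dist_zero_right]
  calc ‖∫ p, hat F p * (cutoffDiff lam R p : ℂ)‖
      ≤ ∫ p : R3, 1 / 2 * (δ⁻¹ * ((‖p‖ ^ 2 + lam) ^ (3 / 2 : ℝ) * ‖hat F p‖ ^ 2 *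
        |cutoffDiff lam R p|) + δ * ((‖p‖ ^ 2 + lam) ^ (-(3 / 2) : ℝ) * |cutoffDiff lam R p|)) :=
        norm_integral_le_of_norm_le (((j1.const_mul _).add (j2.const_mul _)).const_mul _)
          (Eventually.of_forall hpt)
    _ = 1 / 2 * (δ⁻¹ * (∫ p : R3, (‖p‖ ^ 2 + lam) ^ (3 / 2 : ℝ) * ‖hat F p‖ ^ 2 *
          |cutoffDiff lam R p|) +
        δ * (∫ p : R3, (‖p‖ ^ 2 + lam) ^ (-(3 / 2) : ℝ) * |cutoffDiff lam R p|)) := by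
        rw [integral_const_mul, integral_add (j1.const_mul _) (j2.const_mul _),
          integral_const_mul, integral_const_mul]
    _ < 1 / 2 * (δ⁻¹ * (δ * ε) + δ * (5 * π ^ 2)) := by
        have a1 := mul_lt_mul_of_pos_left h1 (inv_pos.mpr hδ0)
        have a2 := mul_le_mul_of_nonneg_left h2 hδ0.le
        linarith
    _ = ε := by
        rw [hδ]
        field_simp
        norm_num

/-- With t = R², t κ_F(t) is the smoothly cut-off integral, and its distance to the integral over
|p| < R vanishes. -/
theorem hasValueAtZero_of_tendsto (hlam : 0 < lam) {F : L2} (hF : F ∈ Hs (3 / 2)) {c : ℂ}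
    (h : Tendsto (fun t : ℝ => t * kappa lam F t) atTop (𝓝 c)) : HasValueAtZero F c := by
  have hFm := memLp_hat F
  have h1 : Tendsto (fun R : ℝ => ((R ^ 2 : ℝ) : ℂ) * kappa lam F (R ^ 2)) atTop (𝓝 c) :=
    h.comp (tendsto_pow_atTop two_ne_zero)
  have h2 := h1.sub ((tendsto_integral_mul_cutoffDiff hlam hF).const_mul (gam : ℂ))
  rw [mul_zero, sub_zero] at h2
  refine h2.congr fun R => ?_
  have hz : 0 < lam + R ^ 2 := by positivity
  have i1 : Integrable fun p => ((R ^ 2 : ℝ) : ℂ) * (hat F p * freeRes (lam + R ^ 2) p) :=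
    (integrable_mul_freeRes hFm hz).const_mul _
  have hball : IntegrableOn (hat F) (Metric.ball (0 : R3) R) := by
    have : IsFiniteMeasure (volume.restrict (Metric.ball (0 : R3) R)) :=
      ⟨by
        rw [Measure.restrict_apply_univ]
        exact measure_ball_lt_top⟩
    exact (hFm.restrict _).integrable (by norm_num)
  have i2 := hball.integrable_indicator Metric.isOpen_ball.measurableSet
  have e : (∫ p, hat F p * (cutoffDiff lam R p : ℂ)) =
      ((R ^ 2 : ℝ) : ℂ) * (∫ p, hat F p * freeRes (lam + R ^ 2) p) -
        ∫ p in Metric.ball (0 : R3) R, hat F p := by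
    rw [← integral_const_mul, ← integral_indicator Metric.isOpen_ball.measurableSet,
      ← integral_sub i1 i2]
    refine integral_congr_ae (Eventually.of_forall fun p => ?_)
    simp only [cutoffDiff, freeRes]
    by_cases hp : p ∈ Metric.ball (0 : R3) R
    · rw [indicator_of_mem hp, indicator_of_mem hp]
      push_cast
      ring
    · rw [indicator_of_notMem hp, indicator_of_notMem hp]
      push_cast
      ring
  rw [e, kappa_eq, resAtZero, gam]
  ring

end ValueAtZero

/-! ### Truncated fractional powers -/

section ScalarIntegrals

theorem integrableOn_rpow_Ioc {r : ℝ} (hr : r < 1) (N : ℝ) :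
    IntegrableOn (fun t : ℝ => t ^ (-r)) (Ioc 0 N) := by
  rcases le_or_gt 0 N with hN | hN
  · exact (intervalIntegrable_iff_integrableOn_Ioc_of_le hN).mp
      (intervalIntegral.intervalIntegrable_rpow' (by linarith))
  · rw [Ioc_eq_empty hN.not_gt]
    exact integrableOn_empty

theorem integral_rpow_Ioc {r : ℝ} (hr : r < 1) {N : ℝ} (hN : 0 ≤ N) :
    ∫ t in Ioc 0 N, t ^ (-r) = N ^ (1 - r) / (1 - r) := by
  rw [← intervalIntegral.integral_of_le hN, integral_rpow (Or.inl (by linarith)),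
    Real.zero_rpow (by linarith)]
  rw [show -r + 1 = 1 - r by ring, sub_zero]

theorem rpow_div_add_le {r y t : ℝ} (hy : 0 < y) (ht : 0 < t) :
    t ^ (-r) / (y + t) ≤ t ^ (-r) / y ∧ t ^ (-r) / (y + t) ≤ t ^ (-r - 1) := by
  constructor
  · gcongr
    linarith
  · rw [Real.rpow_sub_one ht.ne']
    gcongr
    linarith

/-- Split at t = y, bounding the denominator below by y before and by t after. Constants suffice;
the exact beta integral is not needed. -/
theorem integrableOn_rpow_div_add {r y : ℝ} (hr0 : 0 < r) (hr1 : r < 1) (hy : 0 < y) :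
    IntegrableOn (fun t : ℝ => t ^ (-r) / (y + t)) (Ioi 0) ∧
      ∫ t in Ioi (0 : ℝ), t ^ (-r) / (y + t) ≤ ((1 - r)⁻¹ + r⁻¹) * y ^ (-r) := by
  have hm : Measurable fun t : ℝ => t ^ (-r) / (y + t) := by fun_prop
  have i1 : IntegrableOn (fun t : ℝ => t ^ (-r) / y) (Ioc 0 y) :=
    (integrableOn_rpow_Ioc hr1 y).div_const y
  have i2 : IntegrableOn (fun t : ℝ => t ^ (-r - 1)) (Ioi y) :=
    integrableOn_Ioi_rpow_of_lt (by linarith) hy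
  have j1 : IntegrableOn (fun t : ℝ => t ^ (-r) / (y + t)) (Ioc 0 y) := by
    refine i1.mono' hm.aestronglyMeasurable ?_
    filter_upwards [ae_restrict_mem measurableSet_Ioc] with t ht
    have ht0 : 0 < t := ht.1
    rw [Real.norm_eq_abs, abs_of_nonneg (by positivity)]
    exact (rpow_div_add_le hy ht0).1
  have j2 : IntegrableOn (fun t : ℝ => t ^ (-r) / (y + t)) (Ioi y) := by
    refine i2.mono' hm.aestronglyMeasurable ?_
    filter_upwards [ae_restrict_mem measurableSet_Ioi] with t ht
    have ht0 : 0 < t := hy.trans ht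
    rw [Real.norm_eq_abs, abs_of_nonneg (by positivity)]
    exact (rpow_div_add_le hy ht0).2
  have hU : Ioc 0 y ∪ Ioi y = Ioi (0 : ℝ) := Ioc_union_Ioi_eq_Ioi hy.le
  refine ⟨hU ▸ j1.union j2, ?_⟩
  rw [← hU, setIntegral_union (Ioc_disjoint_Ioi le_rfl) measurableSet_Ioi j1 j2]
  have k1 : ∫ t in Ioc 0 y, t ^ (-r) / (y + t) ≤ (1 - r)⁻¹ * y ^ (-r) := by
    calc _ ≤ ∫ t in Ioc 0 y, t ^ (-r) / y :=
          setIntegral_mono_on j1 i1 measurableSet_Ioc fun t ht => (rpow_div_add_le hy ht.1).1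
      _ = (1 - r)⁻¹ * y ^ (-r) := by
          rw [integral_div, integral_rpow_Ioc hr1 hy.le, sub_eq_neg_add 1 r,
            Real.rpow_add_one hy.ne']
          field_simp
  have k2 : ∫ t in Ioi y, t ^ (-r) / (y + t) ≤ r⁻¹ * y ^ (-r) := by
    calc _ ≤ ∫ t in Ioi y, t ^ (-r - 1) :=
          setIntegral_mono_on j2 i2 measurableSet_Ioi fun t ht =>
            (rpow_div_add_le hy (hy.trans ht)).2
      _ = r⁻¹ * y ^ (-r) := by
          rw [integral_Ioi_rpow_of_lt (by linarith) hy, sub_add_cancel]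
          field_simp
  linarith

/-- The symbol of the truncated power: `∫₀ᴺ t^{-1/4} y / (y + t) dt`. -/
def truncSymbol (N y : ℝ) : ℝ := ∫ t in Ioc 0 N, t ^ (-(1 / 4) : ℝ) * (y / (y + t))

theorem integrableOn_rpow_mul_div {y : ℝ} (hy : 0 < y) :
    IntegrableOn (fun t : ℝ => t ^ (-(1 / 4) : ℝ) * (y / (y + t))) (Ioi 0) := by
  refine Integrable.congr ((integrableOn_rpow_div_add (r := 1 / 4) (by norm_num) (by norm_num)
    hy).1.const_mul y) (Eventually.of_forall fun t => ?_)
  ring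

theorem truncSymbol_nonneg {N y : ℝ} (hy : 0 < y) : 0 ≤ truncSymbol N y :=
  setIntegral_nonneg measurableSet_Ioc fun t ht => by
    have := ht.1
    positivity

theorem truncSymbol_mono {N M y : ℝ} (hy : 0 < y) (hNM : N ≤ M) :
    truncSymbol N y ≤ truncSymbol M y := by
  refine setIntegral_mono_set ((integrableOn_rpow_mul_div hy).mono_set Ioc_subset_Ioi_self) ?_
    (Ioc_subset_Ioc_right hNM).eventuallyLE
  filter_upwards [ae_restrict_mem measurableSet_Ioc] with t ht
  have := ht.1
  simp only [Pi.zero_apply]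
  positivity

theorem truncSymbol_le {N y : ℝ} (hy : 0 < y) : truncSymbol N y ≤ 16 / 3 * y ^ (3 / 4 : ℝ) := by
  calc truncSymbol N y ≤ ∫ t in Ioi (0 : ℝ), t ^ (-(1 / 4) : ℝ) * (y / (y + t)) := by
        refine setIntegral_mono_set (integrableOn_rpow_mul_div hy) ?_
          Ioc_subset_Ioi_self.eventuallyLE
        filter_upwards [ae_restrict_mem measurableSet_Ioi] with t ht
        have : 0 < t := ht
        simp only [Pi.zero_apply]
        positivity
    _ = y * ∫ t in Ioi (0 : ℝ), t ^ (-(1 / 4) : ℝ) / (y + t) := by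
        rw [← integral_const_mul]
        congr 1
        ext t
        ring
    _ ≤ y * (((1 - 1 / 4)⁻¹ + (1 / 4)⁻¹) * y ^ (-(1 / 4) : ℝ)) := by
        gcongr
        exact (integrableOn_rpow_div_add (by norm_num) (by norm_num) hy).2
    _ = 16 / 3 * y ^ (3 / 4 : ℝ) := by
        rw [show (3 / 4 : ℝ) = -(1 / 4) + 1 by norm_num, Real.rpow_add_one hy.ne']
        ring

/-- For fixed N the truncated power is a bounded function of the operator, so it can be applied to
every vector before anything is known about its moments. -/
theorem truncSymbol_le_const {N y : ℝ} (hN : 0 ≤ N) (hy : 0 < y) :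
    truncSymbol N y ≤ 4 / 3 * N ^ (3 / 4 : ℝ) := by
  have i1 := integrableOn_rpow_Ioc (by norm_num : (1 / 4 : ℝ) < 1) N
  calc truncSymbol N y ≤ ∫ t in Ioc 0 N, t ^ (-(1 / 4) : ℝ) := by
        refine setIntegral_mono_on ((integrableOn_rpow_mul_div hy).mono_set Ioc_subset_Ioi_self)
          i1 measurableSet_Ioc fun t ht => ?_
        have := ht.1
        refine mul_le_of_le_one_right (by positivity) ?_
        rw [div_le_one (by positivity)]
        linarith
    _ = 4 / 3 * N ^ (3 / 4 : ℝ) := by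
        rw [integral_rpow_Ioc (by norm_num) hN]
        norm_num
        ring

/-- On (0, y] the quotient y/(y+t) is at least 1/2, and half of the integral of t^{-1/4} is 2/3 ·
y^{3/4}. -/
theorem le_truncSymbol {N y : ℝ} (hy : 0 < y) (hyN : y ≤ N) :
    2 / 3 * y ^ (3 / 4 : ℝ) ≤ truncSymbol N y := by
  refine le_trans ?_ (truncSymbol_mono hy hyN)
  have i1 := integrableOn_rpow_Ioc (by norm_num : (1 / 4 : ℝ) < 1) y
  calc 2 / 3 * y ^ (3 / 4 : ℝ) = ∫ t in Ioc 0 y, t ^ (-(1 / 4) : ℝ) * (1 / 2) := by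
        rw [integral_mul_const, integral_rpow_Ioc (by norm_num) hy.le]
        norm_num
        ring
    _ ≤ truncSymbol y y := by
        refine setIntegral_mono_on (i1.mul_const _)
          ((integrableOn_rpow_mul_div hy).mono_set Ioc_subset_Ioi_self) measurableSet_Ioc
          fun t ht => ?_
        have h1 := ht.1
        have h2 := ht.2
        refine mul_le_mul_of_nonneg_left ?_ (by positivity)
        rw [div_le_div_iff₀ (by norm_num) (by positivity)]
        linarith

theorem measurable_truncSymbol (N : ℝ) : Measurable (truncSymbol N) := by
  have h : StronglyMeasurable (Function.uncurry fun y t : ℝ =>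
      t ^ (-(1 / 4) : ℝ) * (y / (y + t))) := by
    refine Measurable.stronglyMeasurable ?_
    simp only [Function.uncurry_def]
    fun_prop
  exact (h.integral_prod_right (ν := volume.restrict (Ioc 0 N))).measurable

theorem integral_mul_truncSymbol {μ : Measure ℝ} [IsFiniteMeasure μ] {lam N C : ℝ}
    (hlam : 0 < lam) (hμ : ∀ᵐ x ∂μ, 0 ≤ x) {ψ : ℝ → ℝ} (hψ : Measurable ψ)
    (hC : ∀ᵐ x ∂μ, ‖ψ x‖ ≤ C) :
    ∫ t in Ioc 0 N, t ^ (-(1 / 4) : ℝ) * ∫ x, ψ x * ((x + lam) / (x + lam + t)) ∂μ =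
      ∫ x, ψ x * truncSymbol N (x + lam) ∂μ := by
  simp only [truncSymbol, ← integral_const_mul]
  rw [integral_integral_swap]
  · refine integral_congr_ae (Eventually.of_forall fun x => ?_)
    refine integral_congr_ae (Eventually.of_forall fun t => ?_)
    simp only
    ring
  · have i1 := integrableOn_rpow_Ioc (by norm_num : (1 / 4 : ℝ) < 1) N
    refine (i1.mul_prod (integrable_const (μ := μ) C)).mono' ?_ ?_
    · refine Measurable.aestronglyMeasurable ?_
      simp only [Function.uncurry_def]
      fun_prop
    · have h1 : ∀ᵐ z ∂((volume.restrict (Ioc 0 N)).prod μ), z.1 ∈ Ioc 0 N :=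
        Measure.quasiMeasurePreserving_fst.ae (ae_restrict_mem measurableSet_Ioc)
      have h2 : ∀ᵐ z ∂((volume.restrict (Ioc 0 N)).prod μ), 0 ≤ z.2 ∧ ‖ψ z.2‖ ≤ C :=
        Measure.quasiMeasurePreserving_snd.ae (hμ.and hC)
      filter_upwards [h1, h2] with z ⟨hz1, _⟩ ⟨hz2, hz3⟩
      simp only [Function.uncurry_def]
      have h4 : 0 ≤ (z.2 + lam) / (z.2 + lam + z.1) := by positivity
      rw [norm_mul, norm_mul, Real.norm_eq_abs, abs_of_nonneg (by positivity)]
      gcongr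
      rw [← mul_one C]
      refine mul_le_mul hz3 ?_ (norm_nonneg _) ((norm_nonneg _).trans hz3)
      rw [Real.norm_eq_abs, abs_of_nonneg h4, div_le_one (by positivity)]
      linarith

end ScalarIntegrals

/-! ### Truncated powers of the operator as Fourier-side integrals -/

section TruncatedPower

variable {α lam : ℝ}

/-- The truncated integral `∫₀ᴺ t^{-1/4} (A + λ) (A + λ + t)⁻¹ g dt` on the Fourier side. -/
def truncPow (α lam : ℝ) (h : R3 → ℂ) (N : ℝ) (p : R3) : ℂ :=
  ∫ t in Ioc 0 N, ((t ^ (-(1 / 4) : ℝ) : ℝ) : ℂ) * wav α lam h t p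

theorem measurable_freeRes_uncurry (lam : ℝ) :
    Measurable fun x : R3 × ℝ => freeRes (lam + x.2) x.1 := by
  unfold freeRes
  fun_prop

theorem aestronglyMeasurable_resAtZero {h : R3 → ℂ} (hh : AEStronglyMeasurable h volume)
    (lam : ℝ) (τ : Measure ℝ) [SFinite τ] :
    AEStronglyMeasurable (fun t => resAtZero (lam + t) h) τ := by
  have h1 : AEStronglyMeasurable (fun x : ℝ × R3 => h x.2 * freeRes (lam + x.1) x.2)
      (τ.prod volume) :=
    hh.comp_snd.mul ((measurable_freeRes_uncurry lam).comp measurable_swap).aestronglyMeasurable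
  exact h1.integral_prod_right'.const_mul _

theorem measurable_coupling (α : ℝ) : Measurable (coupling α) := by
  unfold coupling
  fun_prop

theorem aestronglyMeasurable_wav {h : R3 → ℂ} (hh : AEStronglyMeasurable h volume)
    (α lam : ℝ) (τ : Measure ℝ) [SFinite τ] :
    AEStronglyMeasurable (fun x : R3 × ℝ => wav α lam h x.2 x.1) (volume.prod τ) := by
  have h1 : AEStronglyMeasurable (fun x : R3 × ℝ => h x.1) (volume.prod τ) := hh.comp_fst
  have hc : Measurable fun t : ℝ => (coupling α (lam + t) : ℂ) :=
    Complex.measurable_ofReal.comp ((measurable_coupling α).comp (by fun_prop))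
  have h2 : AEStronglyMeasurable (fun t => charge α (lam + t) h) τ :=
    ((aestronglyMeasurable_resAtZero hh lam τ).aemeasurable.div
      hc.aemeasurable).aestronglyMeasurable
  have h3 : AEStronglyMeasurable (fun x : R3 × ℝ => charge α (lam + x.2) h) (volume.prod τ) :=
    h2.comp_snd
  have h4 : AEStronglyMeasurable (fun x : R3 × ℝ => (x.2 : ℂ)) (volume.prod τ) :=
    (Complex.measurable_ofReal.comp measurable_snd).aestronglyMeasurable
  exact h1.sub (h4.mul ((h1.add (h3.mul_const _)).mul
    (measurable_freeRes_uncurry lam).aestronglyMeasurable))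

/-- A bound uniform in t ≤ N, with square integrable right-hand side. It justifies exchanging the t-
and p-integrals. -/
theorem exists_norm_wav_le (hα : 0 ≤ α) (hlam : 0 < lam) {h : R3 → ℂ} (hh : MemLp h 2) (N : ℝ) :
    ∃ C, ∀ t ∈ Ioc 0 N, ∀ p, ‖wav α lam h t p‖ ≤ 2 * ‖h p‖ + C * (‖p‖ ^ 2 + lam)⁻¹ := by
  set I := ∫ p, ‖h p‖ ^ 2
  have hI : 0 ≤ I := integral_nonneg fun _ => by positivity
  refine ⟨N * √(2 * π * (√lam ^ 3)⁻¹ * I) * gam, fun t ht p => ?_⟩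
  have ht0 : 0 < t := ht.1
  have htN := ht.2
  have hN : 0 ≤ N := ht0.le.trans htN
  have hz : 0 < lam + t := by positivity
  have hs := Real.sqrt_pos.mpr hlam
  have hg := gam_pos
  have hc : ‖charge α (lam + t) h‖ ≤ √(2 * π * (√lam ^ 3)⁻¹ * I) := by
    refine Real.le_sqrt_of_sq_le ((norm_charge_sq_le hα hz hh).trans ?_)
    gcongr
    linarith
  have h1 : ‖(t : ℂ) * krein α (lam + t) h p‖ ≤
      ‖h p‖ + N * √(2 * π * (√lam ^ 3)⁻¹ * I) * gam * (‖p‖ ^ 2 + lam)⁻¹ := by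
    rw [krein, norm_mul, norm_mul, norm_freeRes hz, Complex.norm_real, Real.norm_eq_abs,
      abs_of_pos ht0]
    have h2 : ‖h p + charge α (lam + t) h * gam‖ ≤
        ‖h p‖ + √(2 * π * (√lam ^ 3)⁻¹ * I) * gam := by
      refine (norm_add_le _ _).trans ?_
      rw [norm_mul, Complex.norm_real, Real.norm_eq_abs, abs_of_pos hg]
      gcongr
    have h3 : t * (‖p‖ ^ 2 + (lam + t))⁻¹ ≤ 1 := by
      rw [← div_eq_mul_inv, div_le_one (by positivity)]
      nlinarith [sq_nonneg ‖p‖]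
    calc t * (‖h p + charge α (lam + t) h * gam‖ * (‖p‖ ^ 2 + (lam + t))⁻¹)
        ≤ t * ((‖h p‖ + √(2 * π * (√lam ^ 3)⁻¹ * I) * gam) * (‖p‖ ^ 2 + (lam + t))⁻¹) := by
          gcongr
      _ = ‖h p‖ * (t * (‖p‖ ^ 2 + (lam + t))⁻¹) +
          t * √(2 * π * (√lam ^ 3)⁻¹ * I) * gam * (‖p‖ ^ 2 + (lam + t))⁻¹ := by ring
      _ ≤ ‖h p‖ * 1 + N * √(2 * π * (√lam ^ 3)⁻¹ * I) * gam * (‖p‖ ^ 2 + lam)⁻¹ := by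
          gcongr
          linarith
      _ = _ := by ring
  calc ‖wav α lam h t p‖ ≤ ‖h p‖ + ‖(t : ℂ) * krein α (lam + t) h p‖ := norm_sub_le _ _
    _ ≤ _ := by linarith

theorem exists_memLp_norm_wav_le (hα : 0 ≤ α) (hlam : 0 < lam) {h : R3 → ℂ} (hh : MemLp h 2)
    (N : ℝ) : ∃ A : R3 → ℝ, MemLp A 2 ∧ (∀ p, 0 ≤ A p) ∧
      ∀ t ∈ Ioc 0 N, ∀ p, ‖wav α lam h t p‖ ≤ A p := by
  obtain ⟨C, hC⟩ := exists_norm_wav_le hα hlam hh N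
  refine ⟨fun p => 2 * ‖h p‖ + |C| * ‖freeRes lam p‖,
    (hh.norm.const_mul _).add ((memLp_freeRes hlam).norm.const_mul _),
    fun p => by positivity, fun t ht p => (hC t ht p).trans ?_⟩
  simp only [norm_freeRes hlam]
  gcongr
  exact le_abs_self C

theorem integrable_conj_mul_wav (hα : 0 ≤ α) (hlam : 0 < lam) {h u : R3 → ℂ} (hh : MemLp h 2)
    (hu : MemLp u 2) (N : ℝ) :
    Integrable (Function.uncurry fun (p : R3) (t : ℝ) => (starRingEnd ℂ) (u p) *
      (((t ^ (-(1 / 4) : ℝ) : ℝ) : ℂ) * wav α lam h t p)) (volume.prod (volume.restrict (Ioc 0 N)))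
    := by
  obtain ⟨A, hA, hA0, hwA⟩ := exists_memLp_norm_wav_le (α := α) hα hlam hh N
  have i1 : Integrable fun p => ‖u p‖ * A p := hu.norm.integrable_mul hA
  have i2 := integrableOn_rpow_Ioc (by norm_num : (1 / 4 : ℝ) < 1) N
  refine (i1.mul_prod i2).mono' ?_ ?_
  · have hw : Measurable fun x : R3 × ℝ => ((x.2 ^ (-(1 / 4) : ℝ) : ℝ) : ℂ) := by fun_prop
    exact hu.star.1.comp_fst.mul (hw.aestronglyMeasurable.mul
      (aestronglyMeasurable_wav hh.1 α lam _))
  · have h1 : ∀ᵐ z ∂((volume : Measure R3).prod (volume.restrict (Ioc 0 N))), z.2 ∈ Ioc 0 N :=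
      Measure.quasiMeasurePreserving_snd.ae (ae_restrict_mem measurableSet_Ioc)
    filter_upwards [h1] with z hz
    have hz0 : 0 < z.2 := hz.1
    simp only [Function.uncurry_def]
    rw [norm_mul, norm_mul, Complex.norm_real, Real.norm_eq_abs, abs_of_nonneg (by positivity),
      RCLike.norm_conj]
    calc _ ≤ ‖u z.1‖ * (z.2 ^ (-(1 / 4) : ℝ) * A z.1) := by
          gcongr
          exact hwA _ hz _
      _ = _ := by ring

theorem integral_conj_mul_truncPow (hα : 0 ≤ α) (hlam : 0 < lam) {h u : R3 → ℂ} (hh : MemLp h 2)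
    (hu : MemLp u 2) (N : ℝ) :
    ∫ p, (starRingEnd ℂ) (u p) * truncPow α lam h N p =
      ∫ t in Ioc 0 N, ((t ^ (-(1 / 4) : ℝ) : ℝ) : ℂ) *
        ∫ p, (starRingEnd ℂ) (u p) * wav α lam h t p := by
  simp only [truncPow, ← integral_const_mul]
  rw [integral_integral_swap (integrable_conj_mul_wav hα hlam hh hu N)]
  refine integral_congr_ae (Eventually.of_forall fun t => ?_)
  refine integral_congr_ae (Eventually.of_forall fun p => ?_)
  simp only
  ring

theorem memLp_truncPow (hα : 0 ≤ α) (hlam : 0 < lam) {h : R3 → ℂ} (hh : MemLp h 2) (N : ℝ) :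
    MemLp (truncPow α lam h N) 2 := by
  obtain ⟨A, hA, hA0, hwA⟩ := exists_memLp_norm_wav_le (α := α) hα hlam hh N
  have i2 := integrableOn_rpow_Ioc (by norm_num : (1 / 4 : ℝ) < 1) N
  have hw : Measurable fun x : R3 × ℝ => ((x.2 ^ (-(1 / 4) : ℝ) : ℝ) : ℂ) := by fun_prop
  refine hA.of_le_mul (c := ∫ t in Ioc 0 N, t ^ (-(1 / 4) : ℝ))
    (hw.aestronglyMeasurable.mul
      (aestronglyMeasurable_wav hh.1 α lam (volume.restrict (Ioc 0 N)))).integral_prod_right'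
    (Eventually.of_forall fun p => ?_)
  rw [Real.norm_eq_abs, abs_of_nonneg (hA0 p), ← integral_mul_const]
  refine norm_integral_le_of_norm_le (i2.mul_const _) ?_
  filter_upwards [ae_restrict_mem measurableSet_Ioc] with t ht
  have ht0 : 0 < t := ht.1
  rw [norm_mul, Complex.norm_real, Real.norm_eq_abs, abs_of_nonneg (by positivity)]
  gcongr
  exact hwA t ht p

theorem integral_conj_wav_mul_truncPow (hα : 0 ≤ α) (hlam : 0 < lam) {g : L2} {μ : Measure ℝ}
    (hμ : IsSpectralMeasure (PointLaplacian α) g μ) {s : ℝ} (hs : 0 ≤ s) (N : ℝ) :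
    ∫ p, (starRingEnd ℂ) (wav α lam (hat g) s p) * truncPow α lam (hat g) N p =
      ((∫ x, ((x + lam) / (x + lam + s)) * truncSymbol N (x + lam) ∂μ : ℝ) : ℂ) := by
  have := hμ.1
  have hgm := memLp_hat g
  have hae := IsResolventFamily.ae_nonneg_of_measure_Iio hμ.2.1
  rw [integral_conj_mul_truncPow hα hlam hgm (memLp_wav hlam hgm hs),
    ← integral_mul_truncSymbol (C := 1) hlam hae (by fun_prop), ← integral_complex_ofReal]
  · refine setIntegral_congr_fun measurableSet_Ioc fun t ht => ?_
    rw [integral_conj_wav_mul_wav hα hlam hμ hs ht.1.le, Complex.ofReal_mul]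
  · filter_upwards [hae] with x hx
    rw [Real.norm_eq_abs, abs_of_nonneg (by positivity), div_le_one (by positivity)]
    linarith

/-- The truncated powers are functions of the operator. -/
theorem integral_conj_truncPow_mul_truncPow (hα : 0 ≤ α) (hlam : 0 < lam) {g : L2} {μ : Measure ℝ}
    (hμ : IsSpectralMeasure (PointLaplacian α) g μ) {M : ℝ} (hM : 0 ≤ M) (N : ℝ) :
    ∫ p, (starRingEnd ℂ) (truncPow α lam (hat g) M p) * truncPow α lam (hat g) N p =
      ((∫ x, truncSymbol M (x + lam) * truncSymbol N (x + lam) ∂μ : ℝ) : ℂ) := by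
  have := hμ.1
  have hgm := memLp_hat g
  have hae := IsResolventFamily.ae_nonneg_of_measure_Iio hμ.2.1
  rw [integral_conj_mul_truncPow hα hlam hgm (memLp_truncPow hα hlam hgm M),
    ← integral_mul_truncSymbol (ψ := fun x => truncSymbol M (x + lam))
      (C := 4 / 3 * M ^ (3 / 4 : ℝ)) hlam hae
      ((measurable_truncSymbol M).comp (measurable_id.add_const lam)), ← integral_complex_ofReal]
  · refine setIntegral_congr_fun measurableSet_Ioc fun t ht => ?_
    have h1 := congrArg (starRingEnd ℂ) (integral_conj_wav_mul_truncPow hα hlam hμ ht.1.le M)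
    rw [← integral_conj, Complex.conj_ofReal] at h1
    simp only [map_mul, Complex.conj_conj] at h1
    simp only [mul_comm ((starRingEnd ℂ) (truncPow _ _ _ _ _))]
    rw [h1, Complex.ofReal_mul]
    simp only [mul_comm (truncSymbol _ _)]
  · filter_upwards [hae] with x hx
    rw [Real.norm_eq_abs, abs_of_nonneg (truncSymbol_nonneg (by positivity))]
    exact truncSymbol_le_const hM (by positivity)

theorem integral_norm_truncPow_sq (hα : 0 ≤ α) (hlam : 0 < lam) {g : L2} {μ : Measure ℝ}
    (hμ : IsSpectralMeasure (PointLaplacian α) g μ) {N : ℝ} (hN : 0 ≤ N) :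
    ∫ p, ‖truncPow α lam (hat g) N p‖ ^ 2 = ∫ x, truncSymbol N (x + lam) ^ 2 ∂μ := by
  apply Complex.ofReal_injective
  simp_rw [pow_two (truncSymbol _ _)]
  rw [← integral_conj_truncPow_mul_truncPow hα hlam hμ hN, ← integral_complex_ofReal]
  refine integral_congr_ae (Eventually.of_forall fun p => ?_)
  simp only
  rw [Complex.conj_mul', Complex.ofReal_pow]

end TruncatedPower

/-! ### The limit of the truncated powers -/

section Defect

variable {α lam : ℝ}

theorem integrable_rpow_neg (hlam : 0 < lam) {r : ℝ} (hr : 3 / 2 < r) :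
    Integrable fun p : R3 => (‖p‖ ^ 2 + lam) ^ (-r) := by
  have h1 : Integrable fun p : R3 => (1 + ‖p‖ ^ 2) ^ (-(2 * r) / 2) :=
    integrable_rpow_neg_one_add_norm_sq (by
      rw [finrank_euclideanSpace_fin]
      push_cast
      linarith)
  have hm : 0 < min 1 lam := by positivity
  refine (h1.const_mul ((min 1 lam) ^ (-r))).mono'
    (Measurable.aestronglyMeasurable (by fun_prop)) (Eventually.of_forall fun p => ?_)
  rw [Real.norm_eq_abs, abs_of_nonneg (by positivity), show -(2 * r) / 2 = -r by ring,
    ← Real.mul_rpow (by positivity) (by positivity)]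
  refine Real.rpow_le_rpow_of_nonpos (by positivity) ?_ (by linarith)
  have h2 := min_le_left 1 lam
  have h3 := min_le_right 1 lam
  nlinarith [sq_nonneg ‖p‖]

theorem memLp_rpow_neg (hlam : 0 < lam) {r : ℝ} (hr : 3 / 4 < r) :
    MemLp (fun p : R3 => (‖p‖ ^ 2 + lam) ^ (-r)) 2 := by
  rw [memLp_two_iff_integrable_sq (Measurable.aestronglyMeasurable (by fun_prop))]
  refine (integrable_rpow_neg hlam (r := 2 * r) (by linarith)).congr
    (Eventually.of_forall fun p => ?_)
  simp only
  rw [← Real.rpow_natCast ((‖p‖ ^ 2 + lam) ^ (-r)) 2, ← Real.rpow_mul (by positivity)]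
  congr 1
  push_cast
  ring

/-- The density `(p² + λ)^{3/4} |F̂(p)|`. -/
def weightedNorm (lam : ℝ) (F : L2) (p : R3) : ℝ := (‖p‖ ^ 2 + lam) ^ (3 / 4 : ℝ) * ‖hat F p‖

theorem memLp_weightedNorm (hlam : 0 < lam) {F : L2} (hF : F ∈ Hs (3 / 2)) :
    MemLp (weightedNorm lam F) 2 := by
  refine ((mem_Hs_iff (by norm_num) hlam F).mp hF).norm.ae_eq (Eventually.of_forall fun p => ?_)
  rw [norm_mul, Complex.norm_real, Real.norm_eq_abs, abs_of_nonneg (by positivity), weightedNorm]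
  norm_num

/-- The exponent 7/8 is a choice: being larger than 3/4 it makes y^{-7/8} square integrable on ℝ³
for y = p² + λ, so it pairs with y^{3/4}|F̂|, and being less than 1 it leaves the power y^{-1/8} to
absorb. -/
theorem rpow_neg_mul_inv_le {y t : ℝ} (hy : 0 < y) (ht : 0 < t) :
    (y + t)⁻¹ ≤ y ^ (3 / 4 : ℝ) * (y ^ (-(7 / 8) : ℝ) * t ^ (-(7 / 8) : ℝ)) := by
  have h1 : y ^ (3 / 4 : ℝ) * y ^ (-(7 / 8) : ℝ) = y ^ (-(1 / 8) : ℝ) := by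
    rw [← Real.rpow_add hy]; norm_num
  have h2 : (y + t)⁻¹ = (y + t) ^ (-(1 / 8) : ℝ) * (y + t) ^ (-(7 / 8) : ℝ) := by
    rw [← Real.rpow_add (by positivity), ← Real.rpow_neg_one]; norm_num
  rw [← mul_assoc, h1, h2]
  refine mul_le_mul (Real.rpow_le_rpow_of_nonpos hy (by linarith) (by norm_num))
    (Real.rpow_le_rpow_of_nonpos ht (by linarith) (by norm_num)) (by positivity) (by positivity)

theorem exists_norm_kappa_le (hlam : 0 < lam) {F : L2} (hF : F ∈ Hs (3 / 2)) :
    ∃ C, 0 ≤ C ∧ ∀ t, 0 < t → ‖kappa lam F t‖ ≤ C * t ^ (-(7 / 8) : ℝ) := by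
  have hi : Integrable fun p => weightedNorm lam F p * (‖p‖ ^ 2 + lam) ^ (-(7 / 8) : ℝ) :=
    (memLp_weightedNorm hlam hF).integrable_mul (memLp_rpow_neg hlam (by norm_num))
  have hg := gam_pos
  refine ⟨gam * ∫ p, weightedNorm lam F p * (‖p‖ ^ 2 + lam) ^ (-(7 / 8) : ℝ), ?_, fun t ht => ?_⟩
  · refine mul_nonneg hg.le (integral_nonneg fun p => ?_)
    simp only [weightedNorm, Pi.zero_apply]
    positivity
  · rw [kappa_eq, resAtZero, norm_mul, Complex.norm_real, Real.norm_eq_abs, abs_of_pos hg, mul_assoc,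
      ← integral_mul_const]
    gcongr
    refine norm_integral_le_of_norm_le (hi.mul_const _) (Eventually.of_forall fun p => ?_)
    rw [norm_mul, norm_freeRes (by positivity), ← add_assoc, weightedNorm]
    have := rpow_neg_mul_inv_le (by positivity : 0 < ‖p‖ ^ 2 + lam) ht
    calc _ ≤ ‖hat F p‖ * ((‖p‖ ^ 2 + lam) ^ (3 / 4 : ℝ) * ((‖p‖ ^ 2 + lam) ^ (-(7 / 8) : ℝ) *
          t ^ (-(7 / 8) : ℝ))) := by gcongr
      _ = _ := by ring

/-- The deviation of the charges of `F + q G_λ` from `q`. -/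
def defect (α lam : ℝ) (F : L2) (q : ℂ) (t : ℝ) : ℂ :=
  (q * coupling α lam - t * kappa lam F t) / coupling α (lam + t)

theorem aestronglyMeasurable_kappa (lam : ℝ) (F : L2) (τ : Measure ℝ) [SFinite τ] :
    AEStronglyMeasurable (kappa lam F) τ :=
  (aestronglyMeasurable_resAtZero (memLp_hat F).1 lam τ).congr
    (Eventually.of_forall fun t => (kappa_eq lam F t).symm)

theorem aestronglyMeasurable_defect (α lam : ℝ) (F : L2) (q : ℂ) (τ : Measure ℝ) [SFinite τ] :
    AEStronglyMeasurable (defect α lam F q) τ := by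
  have hc : Measurable fun t : ℝ => (coupling α (lam + t) : ℂ) :=
    Complex.measurable_ofReal.comp ((measurable_coupling α).comp (by fun_prop))
  have ht : Measurable fun t : ℝ => (t : ℂ) := Complex.measurable_ofReal
  exact ((aemeasurable_const.sub (ht.aemeasurable.mul
    (aestronglyMeasurable_kappa lam F τ).aemeasurable)).div hc.aemeasurable).aestronglyMeasurable

theorem inv_coupling_le (hα : 0 ≤ α) (hlam : 0 < lam) {t : ℝ} (ht : 0 < t) :
    (coupling α (lam + t))⁻¹ ≤ 4 * π * t ^ (-(1 / 2) : ℝ) := by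
  have h1 := sqrt_le_coupling hα (lam + t)
  have h2 : √t ≤ √(lam + t) := Real.sqrt_le_sqrt (by linarith)
  have h3 := Real.sqrt_pos.mpr ht
  rw [Real.rpow_neg ht.le, ← Real.sqrt_eq_rpow]
  calc (coupling α (lam + t))⁻¹ ≤ (√t / (4 * π))⁻¹ := by
        refine inv_anti₀ (by positivity) (le_trans ?_ h1)
        gcongr
    _ = _ := by field_simp

theorem coupling_div_le (hα : 0 ≤ α) (hlam : 0 < lam) {t : ℝ} (ht : 0 < t) :
    coupling α lam * (coupling α (lam + t))⁻¹ ≤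
      (1 + 4 * π * coupling α lam) * t ^ (-(3 / 8) : ℝ) := by
  have h0 := coupling_pos hα hlam
  have h0' := coupling_pos hα (by positivity : 0 < lam + t)
  rcases le_total t 1 with h | h
  · have h1 : 1 ≤ t ^ (-(3 / 8) : ℝ) :=
      Real.one_le_rpow_of_pos_of_le_one_of_nonpos ht h (by norm_num)
    have h2 : coupling α lam ≤ coupling α (lam + t) := by
      unfold coupling
      gcongr
      linarith
    have h3 : coupling α lam * (coupling α (lam + t))⁻¹ ≤ 1 := by
      rw [← div_eq_mul_inv, div_le_one h0']
      exact h2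
    have h4 : 0 ≤ 4 * π * coupling α lam := by positivity
    nlinarith
  · have h1 := inv_coupling_le hα hlam ht
    have h2 : t ^ (-(1 / 2) : ℝ) ≤ t ^ (-(3 / 8) : ℝ) :=
      Real.rpow_le_rpow_of_exponent_le h (by norm_num)
    calc _ ≤ coupling α lam * (4 * π * t ^ (-(3 / 8) : ℝ)) := by
          gcongr
          exact h1.trans (by gcongr)
      _ ≤ _ := by
          have : 0 ≤ t ^ (-(3 / 8) : ℝ) := by positivity
          linarith

/-- From |κ_F(t)| ≤ C t^{-7/8} and 1/coupling ≤ 4π t^{-1/2} one gets t · t^{-7/8} · t^{-1/2} =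
t^{-3/8}. With the weight t^{-1/4} this becomes t^{-5/8}/(y+t), which is integrable on the whole
half-line. -/
theorem exists_norm_defect_le (hα : 0 ≤ α) (hlam : 0 < lam) {F : L2} (hF : F ∈ Hs (3 / 2))
    (q : ℂ) : ∃ C, 0 ≤ C ∧ ∀ t, 0 < t → ‖defect α lam F q t‖ ≤ C * t ^ (-(3 / 8) : ℝ) := by
  obtain ⟨C, hC0, hC⟩ := exists_norm_kappa_le hlam hF
  have h0 := coupling_pos hα hlam
  refine ⟨‖q‖ * (1 + 4 * π * coupling α lam) + 4 * π * C, by positivity, fun t ht => ?_⟩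
  have h0' := coupling_pos hα (by positivity : 0 < lam + t)
  have h1 := coupling_div_le hα hlam ht
  have h2 := inv_coupling_le hα hlam ht
  have h3 : t * t ^ (-(7 / 8) : ℝ) * t ^ (-(1 / 2) : ℝ) = t ^ (-(3 / 8) : ℝ) := by
    rw [mul_comm t, ← Real.rpow_add_one ht.ne', ← Real.rpow_add ht]
    norm_num
  rw [defect, norm_div, Complex.norm_real, Real.norm_eq_abs, abs_of_pos h0', div_eq_mul_inv]
  have h4 : ‖q * coupling α lam - t * kappa lam F t‖ ≤
      ‖q‖ * coupling α lam + t * (C * t ^ (-(7 / 8) : ℝ)) := by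
    refine (norm_sub_le _ _).trans ?_
    rw [norm_mul, norm_mul, Complex.norm_real, Complex.norm_real, Real.norm_eq_abs,
      Real.norm_eq_abs, abs_of_pos h0, abs_of_pos ht]
    gcongr
    exact hC t ht
  calc _ ≤ (‖q‖ * coupling α lam + t * (C * t ^ (-(7 / 8) : ℝ))) *
        (coupling α (lam + t))⁻¹ := by gcongr
    _ = ‖q‖ * (coupling α lam * (coupling α (lam + t))⁻¹) +
        t * (C * t ^ (-(7 / 8) : ℝ)) * (coupling α (lam + t))⁻¹ := by ring
    _ ≤ ‖q‖ * ((1 + 4 * π * coupling α lam) * t ^ (-(3 / 8) : ℝ)) +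
        t * (C * t ^ (-(7 / 8) : ℝ)) * (4 * π * t ^ (-(1 / 2) : ℝ)) := by gcongr
    _ = ‖q‖ * ((1 + 4 * π * coupling α lam) * t ^ (-(3 / 8) : ℝ)) +
        4 * π * C * (t * t ^ (-(7 / 8) : ℝ) * t ^ (-(1 / 2) : ℝ)) := by ring
    _ = _ := by rw [h3]; ring

theorem wav_eq_defect {h : R3 → ℂ} {F : L2} {q : ℂ} (hα : 0 ≤ α) (hlam : 0 < lam)
    (hh : h =ᵐ[volume] fun p => hat F p + q * gam * freeRes lam p) {t : ℝ} (ht : 0 ≤ t) {p : R3}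
    (hp : h p = hat F p + q * gam * freeRes lam p) :
    wav α lam h t p = ((‖p‖ ^ 2 + lam : ℝ) : ℂ) * hat F p * freeRes (lam + t) p +
      gam * (defect α lam F q t * freeRes (lam + t) p) := by
  rw [wav_add_charge hlam ht hp, mul_charge_sub hα hlam ht (memLp_hat F) hh, defect, kappa_eq]
  ring

theorem norm_rpow_mul_freeRes (hlam : 0 < lam) {t : ℝ} (ht : 0 < t) (p : R3) :
    ‖((t ^ (-(1 / 4) : ℝ) : ℝ) : ℂ) * freeRes (lam + t) p‖ =
      t ^ (-(1 / 4) : ℝ) / (‖p‖ ^ 2 + lam + t) := by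
  rw [norm_mul, norm_freeRes (by positivity), Complex.norm_real, Real.norm_eq_abs,
    abs_of_nonneg (by positivity), ← div_eq_mul_inv, ← add_assoc]

theorem norm_rpow_mul_defect_le {F : L2} {q : ℂ} {C : ℝ} (hlam : 0 < lam)
    (hC : ∀ t, 0 < t → ‖defect α lam F q t‖ ≤ C * t ^ (-(3 / 8) : ℝ)) {t : ℝ} (ht : 0 < t)
    (p : R3) : ‖((t ^ (-(1 / 4) : ℝ) : ℝ) : ℂ) * (defect α lam F q t * freeRes (lam + t) p)‖ ≤
      C * (t ^ (-(5 / 8) : ℝ) / (‖p‖ ^ 2 + lam + t)) := by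
  rw [mul_left_comm, norm_mul, norm_rpow_mul_freeRes hlam ht]
  have h3 : t ^ (-(3 / 8) : ℝ) * t ^ (-(1 / 4) : ℝ) = t ^ (-(5 / 8) : ℝ) := by
    rw [← Real.rpow_add ht]; norm_num
  calc _ ≤ C * t ^ (-(3 / 8) : ℝ) * (t ^ (-(1 / 4) : ℝ) / (‖p‖ ^ 2 + lam + t)) := by
        gcongr
        exact hC t ht
    _ = C * (t ^ (-(3 / 8) : ℝ) * t ^ (-(1 / 4) : ℝ) / (‖p‖ ^ 2 + lam + t)) := by ring
    _ = _ := by rw [h3]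

theorem integrableOn_rpow_mul_defect (hα : 0 ≤ α) (hlam : 0 < lam) {F : L2} (hF : F ∈ Hs (3 / 2))
    (q : ℂ) (p : R3) :
    IntegrableOn (fun t : ℝ => ((t ^ (-(1 / 4) : ℝ) : ℝ) : ℂ) *
      (defect α lam F q t * freeRes (lam + t) p)) (Ioi 0) := by
  obtain ⟨C, hC0, hC⟩ := exists_norm_defect_le hα hlam hF q
  have h1 : Measurable fun t : ℝ => ((t ^ (-(1 / 4) : ℝ) : ℝ) : ℂ) := by fun_prop
  have h2 : Measurable fun t : ℝ => freeRes (lam + t) p := by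
    unfold freeRes
    fun_prop
  refine ((integrableOn_rpow_div_add (r := 5 / 8) (by norm_num) (by norm_num)
    (by positivity : 0 < ‖p‖ ^ 2 + lam)).1.const_mul C).mono'
    (h1.aestronglyMeasurable.mul ((aestronglyMeasurable_defect α lam F q _).mul
      h2.aestronglyMeasurable)) ?_
  filter_upwards [ae_restrict_mem measurableSet_Ioi] with t ht
  exact norm_rpow_mul_defect_le hlam hC ht p

/-- The Fourier transform of `I_F + q J_λ`, up to a constant. -/
def defectInt (α lam : ℝ) (F : L2) (q : ℂ) (p : R3) : ℂ :=
  gam * ∫ t in Ioi (0 : ℝ), ((t ^ (-(1 / 4) : ℝ) : ℝ) : ℂ) *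
    (defect α lam F q t * freeRes (lam + t) p)

theorem sin_mul_pi_div_pos : 0 < sin (3 / 2 * π / 2) :=
  Real.sin_pos_of_pos_of_lt_pi (by positivity) (by linarith [Real.pi_pos])

theorem four_pi_mul_coupling (z : ℝ) : 4 * π * coupling α z = 4 * π * α + √z := by
  unfold coupling
  field_simp

/-- At q = 0 the defect is −t κ_F(t)/coupling(λ+t), and 4π · coupling(λ+t) is the denominator in
I_F; the extra t turns t^{-1/4} into t^{3/4}. -/
theorem hatI_eq (hα : 0 ≤ α) (hlam : 0 < lam) (F : L2) (p : R3) :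
    hatI (3 / 2) α lam F p = ((sin (3 / 2 * π / 2) / π : ℝ) : ℂ) * defectInt α lam F 0 p := by
  rw [hatI, defectInt, ← mul_assoc, ← integral_const_mul, ← integral_const_mul]
  refine setIntegral_congr_fun measurableSet_Ioi fun t ht => ?_
  have ht0 : 0 < t := ht
  have hc := coupling_ne_zero hα (by positivity : 0 < lam + t)
  have hpi : (π : ℂ) ≠ 0 := by exact_mod_cast Real.pi_ne_zero
  have e1 : t ^ (3 / 2 / 2 : ℝ) = t * t ^ (-(1 / 4) : ℝ) := by
    rw [mul_comm, ← Real.rpow_add_one ht0.ne']; norm_num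
  simp only [defect, freeRes]
  rw [← four_pi_mul_coupling, e1, add_assoc, gam]
  have hu : ((‖p‖ ^ 2 + (lam + t) : ℝ) : ℂ) ≠ 0 := by
    exact_mod_cast (by positivity : ‖p‖ ^ 2 + (lam + t) ≠ 0)
  have hg : (((2 * π) ^ (3 / 2 : ℝ) : ℝ) : ℂ) ≠ 0 := by
    exact_mod_cast (by positivity : (2 * π) ^ (3 / 2 : ℝ) ≠ 0)
  simp only [Complex.ofReal_mul, Complex.ofReal_div, Complex.ofReal_inv, Complex.ofReal_ofNat]
  field_simp
  ring

/-- At F = 0 and q = 1 the defect is the ratio of couplings, that is φ(t), and s/2 − 1 = −1/4. -/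
theorem hatJ_eq (hα : 0 ≤ α) (hlam : 0 < lam) (p : R3) :
    (hatJ (3 / 2) α lam p : ℂ) = ((sin (3 / 2 * π / 2) / π : ℝ) : ℂ) * defectInt α lam 0 1 p := by
  rw [hatJ, defectInt, Complex.ofReal_mul, ← integral_complex_ofReal, ← mul_assoc,
    ← integral_const_mul, ← integral_const_mul]
  refine setIntegral_congr_fun measurableSet_Ioi fun t ht => ?_
  have ht0 : 0 < t := ht
  have hc := coupling_ne_zero hα (by positivity : 0 < lam + t)
  have hpi : (π : ℂ) ≠ 0 := by exact_mod_cast Real.pi_ne_zero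
  have hk : kappa lam 0 t = 0 := by
    have h0 : hat 0 =ᵐ[volume] fun p => (0 : ℂ) * hat 0 p := by
      have := hat_smul 0 (0 : L2)
      rwa [smul_zero] at this
    rw [kappa_eq, resAtZero_congr h0, resAtZero_const_mul, zero_mul]
  simp only [defect, freeRes, phi]
  rw [← four_pi_mul_coupling, ← four_pi_mul_coupling, hk, add_assoc, gam,
    show (3 / 2 / 2 - 1 : ℝ) = -(1 / 4) by norm_num]
  have hu : ((‖p‖ ^ 2 + (lam + t) : ℝ) : ℂ) ≠ 0 := by
    exact_mod_cast (by positivity : ‖p‖ ^ 2 + (lam + t) ≠ 0)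
  have hg : (((2 * π) ^ (3 / 2 : ℝ) : ℝ) : ℂ) ≠ 0 := by
    exact_mod_cast (by positivity : (2 * π) ^ (3 / 2 : ℝ) ≠ 0)
  simp only [Complex.ofReal_mul, Complex.ofReal_div, Complex.ofReal_inv, Complex.ofReal_ofNat]
  field_simp
  ring

end Defect

/-! ### Linearity of the defect integral and its relation to I_F and J_λ -/

section DefectLinear

variable {α lam : ℝ}

theorem kappa_add (hlam : 0 < lam) (F G : L2) {t : ℝ} (ht : 0 ≤ t) :
    kappa lam (F + G) t = kappa lam F t + kappa lam G t := by
  rw [kappa_eq, kappa_eq, kappa_eq, resAtZero_congr (hat_add F G),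
    resAtZero_add (by positivity) (memLp_hat F) (memLp_hat G)]

theorem kappa_smul (c : ℂ) (F : L2) (t : ℝ) : kappa lam (c • F) t = c * kappa lam F t := by
  rw [kappa_eq, kappa_eq, resAtZero_congr (hat_smul c F), resAtZero_const_mul]

theorem Hs_add {F G : L2} (hF : F ∈ Hs (3 / 2)) (hG : G ∈ Hs (3 / 2)) : F + G ∈ Hs (3 / 2) := by
  rw [mem_Hs_iff (by norm_num) one_pos] at hF hG ⊢
  refine (hF.add hG).ae_eq ?_
  filter_upwards [hat_add F G] with p hp
  rw [hp, Pi.add_apply]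
  ring

theorem Hs_smul (c : ℂ) {F : L2} (hF : F ∈ Hs (3 / 2)) : c • F ∈ Hs (3 / 2) := by
  rw [mem_Hs_iff (by norm_num) one_pos] at hF ⊢
  refine (hF.const_mul c).ae_eq ?_
  filter_upwards [hat_smul c F] with p hp
  rw [hp]
  ring

theorem Hs_zero : (0 : L2) ∈ Hs (3 / 2) := by
  have h0 : hat 0 =ᵐ[volume] fun p => (0 : ℂ) * hat 0 p := by
    have := hat_smul 0 (0 : L2)
    rwa [smul_zero] at this
  rw [mem_Hs_iff (by norm_num) one_pos]
  refine (MemLp.zero (ε := ℂ) (α := R3)).ae_eq ?_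
  filter_upwards [h0] with p hp
  rw [hp]
  simp

theorem defectInt_add (hα : 0 ≤ α) (hlam : 0 < lam) {F G : L2} (hF : F ∈ Hs (3 / 2))
    (hG : G ∈ Hs (3 / 2)) (q r : ℂ) (p : R3) :
    defectInt α lam (F + G) (q + r) p = defectInt α lam F q p + defectInt α lam G r p := by
  rw [defectInt, defectInt, defectInt, ← mul_add,
    ← integral_add (integrableOn_rpow_mul_defect hα hlam hF q p)
      (integrableOn_rpow_mul_defect hα hlam hG r p)]
  congr 1
  refine setIntegral_congr_fun measurableSet_Ioi fun t ht => ?_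
  simp only [defect]
  rw [kappa_add hlam F G (le_of_lt ht)]
  ring

theorem defectInt_smul (c : ℂ) (F : L2) (q : ℂ) (p : R3) :
    defectInt α lam (c • F) (c * q) p = c * defectInt α lam F q p := by
  rw [defectInt, defectInt, mul_left_comm c, ← integral_const_mul c]
  congr 1
  refine setIntegral_congr_fun measurableSet_Ioi fun t ht => ?_
  simp only [defect]
  rw [kappa_smul]
  ring

theorem hatI_add_hatJ (hα : 0 ≤ α) (hlam : 0 < lam) {F : L2} (hF : F ∈ Hs (3 / 2)) (q : ℂ)
    (p : R3) : hatI (3 / 2) α lam F p + q * (hatJ (3 / 2) α lam p : ℂ) =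
      ((sin (3 / 2 * π / 2) / π : ℝ) : ℂ) * defectInt α lam F q p := by
  have h1 := defectInt_add hα hlam hF Hs_zero 0 q p
  have h2 := defectInt_smul (α := α) (lam := lam) q 0 1 p
  rw [add_zero, zero_add] at h1
  rw [smul_zero, mul_one] at h2
  rw [hatI_eq hα hlam, hatJ_eq hα hlam, h1, h2]
  ring

theorem memLp_hatI_add_hatJ_iff (hα : 0 ≤ α) (hlam : 0 < lam) {F : L2} (hF : F ∈ Hs (3 / 2))
    (q : ℂ) : MemLp (fun p => hatI (3 / 2) α lam F p + q * (hatJ (3 / 2) α lam p : ℂ)) 2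
      (volume : Measure R3) ↔ MemLp (defectInt α lam F q) 2 := by
  simp_rw [hatI_add_hatJ hα hlam hF]
  have hβ : ((sin (3 / 2 * π / 2) / π : ℝ) : ℂ) ≠ 0 := by
    exact_mod_cast (div_pos sin_mul_pi_div_pos Real.pi_pos).ne'
  constructor
  · intro h
    refine (h.const_mul ((sin (3 / 2 * π / 2) / π : ℝ) : ℂ)⁻¹).ae_eq
      (Eventually.of_forall fun p => ?_)
    rw [inv_mul_cancel_left₀ hβ]
  · exact fun h => h.const_mul _

end DefectLinear

/-! ### Pointwise limit of the truncated powers and domination -/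

section LimitPower

variable {α lam : ℝ}

/-- The symbol `∫₀^∞ t^{-1/4} y / (y + t) dt`, a multiple of `y^{3/4}`. -/
def powSymbol (y : ℝ) : ℝ := ∫ t in Ioi (0 : ℝ), t ^ (-(1 / 4) : ℝ) * (y / (y + t))

theorem tendsto_setIntegral_Ioc_Ioi {E : Type*} [NormedAddCommGroup E] [NormedSpace ℝ E]
    {f : ℝ → E} (hf : IntegrableOn f (Ioi 0)) :
    Tendsto (fun N : ℝ => ∫ t in Ioc 0 N, f t) atTop (𝓝 (∫ t in Ioi (0 : ℝ), f t)) := by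
  refine (intervalIntegral_tendsto_integral_Ioi 0 hf tendsto_id).congr' ?_
  filter_upwards [eventually_ge_atTop 0] with N hN
  exact intervalIntegral.integral_of_le hN

theorem tendsto_truncSymbol {y : ℝ} (hy : 0 < y) :
    Tendsto (fun N => truncSymbol N y) atTop (𝓝 (powSymbol y)) :=
  tendsto_setIntegral_Ioc_Ioi (integrableOn_rpow_mul_div hy)

theorem powSymbol_le {y : ℝ} (hy : 0 < y) : powSymbol y ≤ 16 / 3 * y ^ (3 / 4 : ℝ) :=
  le_of_tendsto' (tendsto_truncSymbol hy) fun _ => truncSymbol_le hy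

theorem le_powSymbol {y : ℝ} (hy : 0 < y) : 2 / 3 * y ^ (3 / 4 : ℝ) ≤ powSymbol y := by
  refine ge_of_tendsto (tendsto_truncSymbol hy) ?_
  filter_upwards [eventually_ge_atTop y] with N hN
  exact le_truncSymbol hy hN

theorem measurable_powSymbol : Measurable powSymbol := by
  have h : StronglyMeasurable (Function.uncurry fun y t : ℝ =>
      t ^ (-(1 / 4) : ℝ) * (y / (y + t))) := by
    refine Measurable.stronglyMeasurable ?_
    simp only [Function.uncurry_def]
    fun_prop
  exact (h.integral_prod_right (ν := volume.restrict (Ioi 0))).measurable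

theorem memLp_powSymbol_mul (hlam : 0 < lam) {F : L2} (hF : F ∈ Hs (3 / 2)) :
    MemLp (fun p : R3 => (powSymbol (‖p‖ ^ 2 + lam) : ℂ) * hat F p) 2 := by
  have hm : Measurable fun p : R3 => (powSymbol (‖p‖ ^ 2 + lam) : ℂ) :=
    Complex.measurable_ofReal.comp (measurable_powSymbol.comp (by fun_prop))
  refine (memLp_weightedNorm hlam hF).of_le_mul (c := 16 / 3)
    (hm.aestronglyMeasurable.mul (memLp_hat F).1) (Eventually.of_forall fun p => ?_)
  have hy : 0 < ‖p‖ ^ 2 + lam := by positivity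
  have h0 : 0 ≤ powSymbol (‖p‖ ^ 2 + lam) := le_trans (by positivity) (le_powSymbol hy)
  rw [norm_mul, Complex.norm_real, Real.norm_eq_abs, abs_of_nonneg h0, weightedNorm,
    Real.norm_eq_abs, abs_of_nonneg (by positivity), ← mul_assoc]
  gcongr
  exact powSymbol_le hy

variable {h : R3 → ℂ} {F : L2} {q : ℂ}

theorem rpow_mul_wav_eq (hα : 0 ≤ α) (hlam : 0 < lam)
    (hh : h =ᵐ[volume] fun p => hat F p + q * gam * freeRes lam p) {t : ℝ} (ht : 0 < t) {p : R3}
    (hp : h p = hat F p + q * gam * freeRes lam p) :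
    ((t ^ (-(1 / 4) : ℝ) : ℝ) : ℂ) * wav α lam h t p =
      ((t ^ (-(1 / 4) : ℝ) * ((‖p‖ ^ 2 + lam) / (‖p‖ ^ 2 + lam + t)) : ℝ) : ℂ) * hat F p +
      gam * (((t ^ (-(1 / 4) : ℝ) : ℝ) : ℂ) * (defect α lam F q t * freeRes (lam + t) p)) := by
  rw [wav_eq_defect hα hlam hh ht.le hp]
  simp only [freeRes, div_eq_mul_inv, add_assoc]
  push_cast
  ring

theorem integrableOn_rpow_mul_wav (hα : 0 ≤ α) (hlam : 0 < lam) (hF : F ∈ Hs (3 / 2))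
    (hh : h =ᵐ[volume] fun p => hat F p + q * gam * freeRes lam p) {p : R3}
    (hp : h p = hat F p + q * gam * freeRes lam p) :
    IntegrableOn (fun t : ℝ => ((t ^ (-(1 / 4) : ℝ) : ℝ) : ℂ) * wav α lam h t p) (Ioi 0) ∧
      ∫ t in Ioi (0 : ℝ), ((t ^ (-(1 / 4) : ℝ) : ℝ) : ℂ) * wav α lam h t p =
        powSymbol (‖p‖ ^ 2 + lam) * hat F p + defectInt α lam F q p := by
  have hy : 0 < ‖p‖ ^ 2 + lam := by positivity
  have i1 : IntegrableOn (fun t : ℝ =>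
      ((t ^ (-(1 / 4) : ℝ) * ((‖p‖ ^ 2 + lam) / (‖p‖ ^ 2 + lam + t)) : ℝ) : ℂ) * hat F p) (Ioi 0) :=
    (integrableOn_rpow_mul_div hy).ofReal.mul_const _
  have i2 := (integrableOn_rpow_mul_defect hα hlam hF q p).const_mul (gam : ℂ)
  constructor
  · refine IntegrableOn.congr_fun (i1.add i2) (fun t ht => ?_) measurableSet_Ioi
    rw [Pi.add_apply, rpow_mul_wav_eq hα hlam hh ht hp]
  · rw [setIntegral_congr_fun measurableSet_Ioi fun t ht => rpow_mul_wav_eq hα hlam hh ht hp,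
      integral_add i1 i2, integral_mul_const, integral_const_mul, integral_complex_ofReal]
    rfl

theorem tendsto_truncPow (hα : 0 ≤ α) (hlam : 0 < lam) (hF : F ∈ Hs (3 / 2))
    (hh : h =ᵐ[volume] fun p => hat F p + q * gam * freeRes lam p) {p : R3}
    (hp : h p = hat F p + q * gam * freeRes lam p) :
    Tendsto (fun N => truncPow α lam h N p) atTop
      (𝓝 (powSymbol (‖p‖ ^ 2 + lam) * hat F p + defectInt α lam F q p)) := by
  obtain ⟨h1, h2⟩ := integrableOn_rpow_mul_wav hα hlam hF hh hp
  rw [← h2]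
  exact tendsto_setIntegral_Ioc_Ioi h1

/-- Uniform in N, but not an L² bound: (p²+λ)^{-5/8} is not square integrable on ℝ³, which would
need an exponent above 3/4. This matches the fact that the L² condition on the limit is a genuine
restriction. -/
theorem exists_norm_truncPow_le (hα : 0 ≤ α) (hlam : 0 < lam) (hF : F ∈ Hs (3 / 2))
    (hh : h =ᵐ[volume] fun p => hat F p + q * gam * freeRes lam p) :
    ∃ C, 0 ≤ C ∧ ∀ N p, h p = hat F p + q * gam * freeRes lam p → ‖truncPow α lam h N p‖ ≤
      16 / 3 * weightedNorm lam F p + C * (‖p‖ ^ 2 + lam) ^ (-(5 / 8) : ℝ) := by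
  obtain ⟨C, hC0, hC⟩ := exists_norm_defect_le hα hlam hF q
  have hg := gam_pos
  refine ⟨gam * C * ((1 - 5 / 8)⁻¹ + (5 / 8)⁻¹), by positivity, fun N p hp => ?_⟩
  have hy : 0 < ‖p‖ ^ 2 + lam := by positivity
  have i1 := (integrableOn_rpow_mul_div hy).mul_const ‖hat F p‖
  obtain ⟨i2, h2⟩ := integrableOn_rpow_div_add (r := 5 / 8) (by norm_num) (by norm_num) hy
  have i3 : IntegrableOn (fun t : ℝ => t ^ (-(1 / 4) : ℝ) *
      ((‖p‖ ^ 2 + lam) / (‖p‖ ^ 2 + lam + t)) * ‖hat F p‖ +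
        gam * C * (t ^ (-(5 / 8) : ℝ) / (‖p‖ ^ 2 + lam + t))) (Ioi 0) :=
    i1.add (i2.const_mul _)
  calc ‖truncPow α lam h N p‖ ≤ ∫ t in Ioc 0 N, (t ^ (-(1 / 4) : ℝ) *
        ((‖p‖ ^ 2 + lam) / (‖p‖ ^ 2 + lam + t)) * ‖hat F p‖ +
        gam * C * (t ^ (-(5 / 8) : ℝ) / (‖p‖ ^ 2 + lam + t))) := by
        refine norm_integral_le_of_norm_le (i3.mono_set Ioc_subset_Ioi_self) ?_
        filter_upwards [ae_restrict_mem measurableSet_Ioc] with t ht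
        have ht0 : 0 < t := ht.1
        rw [rpow_mul_wav_eq hα hlam hh ht0 hp]
        refine (norm_add_le _ _).trans (add_le_add ?_ ?_)
        · rw [norm_mul, Complex.norm_real, Real.norm_eq_abs, abs_of_nonneg (by positivity)]
        · rw [norm_mul, Complex.norm_real, Real.norm_eq_abs, abs_of_pos hg, mul_assoc]
          gcongr
          exact norm_rpow_mul_defect_le hlam hC ht0 p
    _ ≤ ∫ t in Ioi (0 : ℝ), (t ^ (-(1 / 4) : ℝ) *
        ((‖p‖ ^ 2 + lam) / (‖p‖ ^ 2 + lam + t)) * ‖hat F p‖ +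
        gam * C * (t ^ (-(5 / 8) : ℝ) / (‖p‖ ^ 2 + lam + t))) := by
        refine setIntegral_mono_set i3 ?_ Ioc_subset_Ioi_self.eventuallyLE
        filter_upwards [ae_restrict_mem measurableSet_Ioi] with t ht
        have ht0 : 0 < t := ht
        simp only [Pi.zero_apply]
        positivity
    _ = powSymbol (‖p‖ ^ 2 + lam) * ‖hat F p‖ +
        gam * C * ∫ t in Ioi (0 : ℝ), t ^ (-(5 / 8) : ℝ) / (‖p‖ ^ 2 + lam + t) := by
        rw [integral_add i1 (i2.const_mul _), integral_mul_const, integral_const_mul]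
        rfl
    _ ≤ (16 / 3 * (‖p‖ ^ 2 + lam) ^ (3 / 4 : ℝ)) * ‖hat F p‖ +
        gam * C * (((1 - 5 / 8)⁻¹ + (5 / 8)⁻¹) * (‖p‖ ^ 2 + lam) ^ (-(5 / 8) : ℝ)) := by
        gcongr
        exact powSymbol_le hy
    _ = _ := by rw [weightedNorm]; ring

/-- For fixed N the decay (p²+λ)⁻¹ of the Green function survives. This compensates for the weak
uniform bound when a fixed truncation is paired with a varying one. -/
theorem exists_norm_truncPow_le_of_fixed (hα : 0 ≤ α) (hlam : 0 < lam) (hm : MemLp h 2) (N : ℝ) :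
    ∃ K, 0 ≤ K ∧ ∀ p, h p = hat F p + q * gam * freeRes lam p → ‖truncPow α lam h N p‖ ≤
      K * (‖hat F p‖ + (‖p‖ ^ 2 + lam)⁻¹) := by
  obtain ⟨C, hC⟩ := exists_norm_wav_le (α := α) hα hlam hm N
  have hg := gam_pos
  have i1 := integrableOn_rpow_Ioc (by norm_num : (1 / 4 : ℝ) < 1) N
  set J := ∫ t in Ioc 0 N, t ^ (-(1 / 4) : ℝ) with hJ
  have hJ0 : 0 ≤ J := setIntegral_nonneg measurableSet_Ioc fun t ht => by
    have := ht.1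
    positivity
  set B : ℝ := 2 + 2 * ‖q‖ * gam + |C| with hB
  refine ⟨J * B, by positivity, fun p hp => ?_⟩
  have hy : 0 < (‖p‖ ^ 2 + lam)⁻¹ := by positivity
  have hh : ‖h p‖ ≤ ‖hat F p‖ + ‖q‖ * gam * (‖p‖ ^ 2 + lam)⁻¹ := by
    rw [hp]
    refine (norm_add_le _ _).trans ?_
    rw [norm_mul, norm_mul, norm_freeRes hlam, Complex.norm_real, Real.norm_eq_abs, abs_of_pos hg]
  have hw : ∀ t ∈ Ioc 0 N, ‖wav α lam h t p‖ ≤ B * (‖hat F p‖ + (‖p‖ ^ 2 + lam)⁻¹) := by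
    intro t ht
    have h1 := hC t ht p
    have h2 := mul_le_mul_of_nonneg_right (le_abs_self C) hy.le
    have h3 : 0 ≤ (2 * ‖q‖ * gam + |C|) * ‖hat F p‖ := by positivity
    have h4 : B * (‖hat F p‖ + (‖p‖ ^ 2 + lam)⁻¹) = 2 * ‖hat F p‖ +
        (2 * ‖q‖ * gam + |C|) * ‖hat F p‖ + 2 * (‖p‖ ^ 2 + lam)⁻¹ +
        2 * (‖q‖ * gam * (‖p‖ ^ 2 + lam)⁻¹) + |C| * (‖p‖ ^ 2 + lam)⁻¹ := by
      rw [hB]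
      ring
    linarith
  rw [mul_assoc, hJ, ← integral_mul_const]
  refine norm_integral_le_of_norm_le (i1.mul_const _) ?_
  filter_upwards [ae_restrict_mem measurableSet_Ioc] with t ht
  have ht0 : 0 < t := ht.1
  rw [norm_mul, Complex.norm_real, Real.norm_eq_abs, abs_of_nonneg (by positivity)]
  gcongr
  exact hw t ht

end LimitPower

/-! ### Characterization of the domain -/

section Characterization

variable {α lam : ℝ}

/-- A version of Fatou's lemma. -/
theorem integrable_of_tendsto_of_integral_le {X : Type*} [MeasurableSpace X] {ν : Measure X}
    {f : ℕ → X → ℝ} {g : X → ℝ} {K : ℝ} (hf : ∀ n, Integrable (f n) ν)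
    (h0 : ∀ n, 0 ≤ᵐ[ν] f n) (hK : ∀ n, ∫ x, f n x ∂ν ≤ K)
    (hlim : ∀ᵐ x ∂ν, Tendsto (fun n => f n x) atTop (𝓝 (g x))) : Integrable g ν := by
  have hm : AEStronglyMeasurable g ν := aestronglyMeasurable_of_tendsto_ae _ (fun n => (hf n).1) hlim
  have hg0 : 0 ≤ᵐ[ν] g := by
    filter_upwards [hlim, ae_all_iff.mpr h0] with x hx h0x
    exact ge_of_tendsto' hx h0x
  rw [← lintegral_ofReal_ne_top_iff_integrable hm hg0]
  refine ne_of_lt (lt_of_le_of_lt ?_ (ENNReal.ofReal_lt_top (r := K)))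
  calc ∫⁻ x, ENNReal.ofReal (g x) ∂ν
      = ∫⁻ x, liminf (fun n => ENNReal.ofReal (f n x)) atTop ∂ν := by
        refine lintegral_congr_ae ?_
        filter_upwards [hlim] with x hx
        exact ((ENNReal.continuous_ofReal.tendsto _).comp hx).liminf_eq.symm
    _ ≤ liminf (fun n => ∫⁻ x, ENNReal.ofReal (f n x) ∂ν) atTop :=
        lintegral_liminf_le' fun n => (hf n).1.aemeasurable.ennreal_ofReal
    _ ≤ liminf (fun _ : ℕ => ENNReal.ofReal K) atTop := by
        refine liminf_le_liminf (Eventually.of_forall fun n => ?_)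
        rw [← ofReal_integral_eq_lintegral_ofReal (hf n) (h0 n)]
        exact ENNReal.ofReal_le_ofReal (hK n)
    _ = _ := liminf_const _

variable {g F : L2} {q : ℂ}

theorem integrable_truncSymbol_sq {μ : Measure ℝ} [IsFiniteMeasure μ] (hlam : 0 < lam)
    (hμ : ∀ᵐ x ∂μ, 0 ≤ x) {N M : ℝ} (hN : 0 ≤ N) (hM : 0 ≤ M) :
    Integrable (fun x => truncSymbol N (x + lam) * truncSymbol M (x + lam)) μ := by
  have hmeas : ∀ N, Measurable fun x => truncSymbol N (x + lam) := fun N =>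
    (measurable_truncSymbol N).comp (measurable_id.add_const lam)
  refine Integrable.of_bound ((hmeas N).mul (hmeas M)).aestronglyMeasurable
    (4 / 3 * N ^ (3 / 4 : ℝ) * (4 / 3 * M ^ (3 / 4 : ℝ))) ?_
  filter_upwards [hμ] with x hx
  have hy : 0 < x + lam := by positivity
  have h1 := truncSymbol_nonneg (N := N) hy
  have h2 := truncSymbol_nonneg (N := M) hy
  rw [Real.norm_eq_abs, abs_of_nonneg (mul_nonneg h1 h2)]
  exact mul_le_mul (truncSymbol_le_const hN hy) (truncSymbol_le_const hM hy) h2 (by positivity)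

/-- Fatou's lemma: the truncations have squared norms ∫ `truncSymbol`² dμ, bounded by a multiple of
the finite moment of order 3/2. -/
theorem memLp_limit_of_mem (hα : 0 ≤ α) (hlam : 0 < lam)
    (hg : g ∈ fracPowDomain (PointLaplacian α) (3 / 4)) (hF : F ∈ Hs (3 / 2))
    (hgF : hat g =ᵐ[volume] fun p => hat F p + q * gam * freeRes lam p) :
    MemLp (fun p : R3 => powSymbol (‖p‖ ^ 2 + lam) * hat F p + defectInt α lam F q p) 2 := by
  obtain ⟨μ, hμ, hi⟩ := (mem_fracPowDomain_iff hlam).mp hg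
  have := hμ.1
  have hgm := memLp_hat g
  have hae := IsResolventFamily.ae_nonneg_of_measure_Iio hμ.2.1
  have htr : ∀ n : ℕ, MemLp (truncPow α lam (hat g) n) 2 := fun n =>
    memLp_truncPow hα hlam hgm n
  have hlim : ∀ᵐ p : R3, Tendsto (fun n : ℕ => truncPow α lam (hat g) n p) atTop
      (𝓝 (powSymbol (‖p‖ ^ 2 + lam) * hat F p + defectInt α lam F q p)) := by
    filter_upwards [hgF] with p hp
    exact (tendsto_truncPow hα hlam hF hgF hp).comp tendsto_natCast_atTop_atTop
  have hm := aestronglyMeasurable_of_tendsto_ae _ (fun n => (htr n).1) hlim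
  rw [memLp_two_iff_integrable_sq_norm hm]
  refine integrable_of_tendsto_of_integral_le
    (f := fun (n : ℕ) p => ‖truncPow α lam (hat g) n p‖ ^ 2)
    (K := ∫ x, (16 / 3) ^ 2 * (x + lam) ^ (3 / 2 : ℝ) ∂μ)
    (fun n => (memLp_two_iff_integrable_sq_norm (htr n).1).mp (htr n))
    (fun n => Eventually.of_forall fun p => sq_nonneg _) (fun n => ?_) ?_
  · rw [integral_norm_truncPow_sq hα hlam hμ n.cast_nonneg]
    refine integral_mono_ae ?_ (hi.const_mul _) ?_
    · simp_rw [pow_two (truncSymbol _ _)]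
      exact integrable_truncSymbol_sq hlam hae n.cast_nonneg n.cast_nonneg
    · filter_upwards [hae] with x hx
      have hy : 0 < x + lam := by positivity
      have h1 : (x + lam) ^ (3 / 2 : ℝ) = ((x + lam) ^ (3 / 4 : ℝ)) ^ 2 := by
        rw [← Real.rpow_natCast, ← Real.rpow_mul hy.le]
        norm_num
      rw [h1, ← mul_pow]
      exact pow_le_pow_left₀ (truncSymbol_nonneg hy) (truncSymbol_le hy) 2
  · filter_upwards [hlim] with p hp
    exact (hp.norm).pow 2

theorem memLp_defectInt_of_mem (hα : 0 ≤ α) (hlam : 0 < lam)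
    (hg : g ∈ fracPowDomain (PointLaplacian α) (3 / 4)) (hF : F ∈ Hs (3 / 2))
    (hgF : hat g =ᵐ[volume] fun p => hat F p + q * gam * freeRes lam p) :
    MemLp (defectInt α lam F q) 2 := by
  refine ((memLp_limit_of_mem hα hlam hg hF hgF).sub (memLp_powSymbol_mul hlam hF)).ae_eq
    (Eventually.of_forall fun p => ?_)
  simp

/-- The critical term y^{-5/8} is multiplied by |F̂| + y⁻¹. It gives y^{3/4}|F̂| · y^{-11/8}, a
product of L² functions, and y^{-13/8}, integrable because 13/8 > 3/2. -/
theorem integrable_truncPow_dominator (hlam : 0 < lam) (hF : F ∈ Hs (3 / 2)) {u : R3 → ℂ}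
    (hu : MemLp u 2) (K C : ℝ) : Integrable fun p : R3 =>
      ‖u p‖ * (16 / 3 * weightedNorm lam F p) + C * (K * (‖hat F p‖ + (‖p‖ ^ 2 + lam)⁻¹) *
        (‖p‖ ^ 2 + lam) ^ (-(5 / 8) : ℝ)) := by
  have hw := memLp_weightedNorm hlam hF
  have i1 : Integrable fun p => ‖u p‖ * (16 / 3 * weightedNorm lam F p) :=
    hu.norm.integrable_mul (hw.const_mul _)
  have i2 : Integrable fun p : R3 => weightedNorm lam F p * (‖p‖ ^ 2 + lam) ^ (-(11 / 8) : ℝ) :=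
    hw.integrable_mul (memLp_rpow_neg hlam (by norm_num))
  have i3 := integrable_rpow_neg hlam (r := 13 / 8) (by norm_num)
  refine i1.add (Integrable.const_mul (Integrable.congr ((i2.add i3).const_mul K)
    (Eventually.of_forall fun p => ?_)) C)
  have hy : 0 < ‖p‖ ^ 2 + lam := by positivity
  simp only [weightedNorm, Pi.add_apply]
  have e1 : (‖p‖ ^ 2 + lam) ^ (3 / 4 : ℝ) * (‖p‖ ^ 2 + lam) ^ (-(11 / 8) : ℝ) =
      (‖p‖ ^ 2 + lam) ^ (-(5 / 8) : ℝ) := by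
    rw [← Real.rpow_add hy]; norm_num
  have e2 : (‖p‖ ^ 2 + lam) ^ (-(13 / 8) : ℝ) =
      (‖p‖ ^ 2 + lam)⁻¹ * (‖p‖ ^ 2 + lam) ^ (-(5 / 8) : ℝ) := by
    rw [← Real.rpow_neg_one, ← Real.rpow_add hy]; norm_num
  rw [e2, ← e1]
  ring

theorem tendsto_integral_conj_truncPow (hα : 0 ≤ α) (hlam : 0 < lam) (hF : F ∈ Hs (3 / 2))
    (hgF : hat g =ᵐ[volume] fun p => hat F p + q * gam * freeRes lam p) (N : ℝ) :
    Tendsto (fun M : ℕ => ∫ p, (starRingEnd ℂ) (truncPow α lam (hat g) N p) *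
      truncPow α lam (hat g) M p) atTop (𝓝 (∫ p : R3, (starRingEnd ℂ) (truncPow α lam (hat g) N p) *
        (powSymbol (‖p‖ ^ 2 + lam) * hat F p + defectInt α lam F q p))) := by
  have hgm := memLp_hat g
  obtain ⟨C, hC0, hC⟩ := exists_norm_truncPow_le hα hlam hF hgF
  obtain ⟨K, hK0, hK⟩ := exists_norm_truncPow_le_of_fixed (α := α) (F := F) (q := q) hα hlam hgm N
  have hN := memLp_truncPow hα hlam hgm N
  refine tendsto_integral_of_dominated_convergence _ (fun M => ?_)
    (integrable_truncPow_dominator hlam hF hN K C) (fun M => ?_) ?_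
  · exact hN.star.1.mul (memLp_truncPow hα hlam hgm M).1
  · filter_upwards [hgF] with p hp
    rw [norm_mul, RCLike.norm_conj]
    calc _ ≤ ‖truncPow α lam (hat g) N p‖ * (16 / 3 * weightedNorm lam F p +
          C * (‖p‖ ^ 2 + lam) ^ (-(5 / 8) : ℝ)) := by
          gcongr
          exact hC M p hp
      _ = ‖truncPow α lam (hat g) N p‖ * (16 / 3 * weightedNorm lam F p) +
          C * (‖truncPow α lam (hat g) N p‖ * (‖p‖ ^ 2 + lam) ^ (-(5 / 8) : ℝ)) := by ring
      _ ≤ _ := by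
          gcongr
          exact hK p hp
  · filter_upwards [hgF] with p hp
    exact ((tendsto_truncPow hα hlam hF hgF hp).comp tendsto_natCast_atTop_atTop).const_mul _

/-- Let T_N be the truncated power of g and k the pointwise limit. Monotonicity of the symbol in N
gives ‖T_N‖² ≤ ⟨T_N, T_M⟩ for M ≥ N. Letting M → ∞ and applying Cauchy–Schwarz, ‖T_N‖² ≤ ‖T_N‖ ‖k‖.
No convergence of T_M in L² is needed. -/
theorem integral_truncSymbol_sq_le (hα : 0 ≤ α) (hlam : 0 < lam) (hF : F ∈ Hs (3 / 2))
    (hgF : hat g =ᵐ[volume] fun p => hat F p + q * gam * freeRes lam p)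
    (hk : MemLp (defectInt α lam F q) 2) {μ : Measure ℝ}
    (hμ : IsSpectralMeasure (PointLaplacian α) g μ) {N : ℝ} (hN : 0 ≤ N) :
    ∫ x, truncSymbol N (x + lam) ^ 2 ∂μ ≤
      ∫ p : R3, ‖powSymbol (‖p‖ ^ 2 + lam) * hat F p + defectInt α lam F q p‖ ^ 2 := by
  have := hμ.1
  have hgm := memLp_hat g
  have hae := IsResolventFamily.ae_nonneg_of_measure_Iio hμ.2.1
  have hkm := (memLp_powSymbol_mul hlam hF).add hk
  set k : R3 → ℂ := fun p => powSymbol (‖p‖ ^ 2 + lam) * hat F p + defectInt α lam F q p with hkdef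
  set X := ∫ x, truncSymbol N (x + lam) ^ 2 ∂μ with hX
  have hX0 : 0 ≤ X := integral_nonneg fun _ => sq_nonneg _
  set Y := ∫ p : R3, (starRingEnd ℂ) (truncPow α lam (hat g) N p) * k p with hY
  have h1 : X ≤ ‖Y‖ := by
    have ht := (tendsto_integral_conj_truncPow hα hlam hF hgF N).norm
    refine ge_of_tendsto ht ?_
    filter_upwards [(tendsto_natCast_atTop_atTop (R := ℝ)).eventually_ge_atTop N] with M hM
    rw [integral_conj_truncPow_mul_truncPow hα hlam hμ hN, Complex.norm_real]
    refine le_trans ?_ (le_abs_self _)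
    simp_rw [hX, pow_two (truncSymbol _ _)]
    refine integral_mono_ae (integrable_truncSymbol_sq hlam hae hN hN)
      (integrable_truncSymbol_sq hlam hae hN (hN.trans hM)) ?_
    filter_upwards [hae] with x hx
    have hy : 0 < x + lam := by positivity
    exact mul_le_mul_of_nonneg_left (truncSymbol_mono hy hM) (truncSymbol_nonneg hy)
  have h2 : ‖Y‖ ^ 2 ≤ X * ∫ p, ‖k p‖ ^ 2 := by
    have h3 := norm_integral_mul_sq_le (memLp_truncPow hα hlam hgm N).star hkm
    have h4 : ∫ p, ‖(star (truncPow α lam (hat g) N)) p‖ ^ 2 = X := by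
      simp_rw [Pi.star_apply, norm_star]
      exact integral_norm_truncPow_sq hα hlam hμ hN
    rw [h4] at h3
    exact h3
  have h5 : X * X ≤ X * ∫ p, ‖k p‖ ^ 2 := by
    refine le_trans ?_ h2
    rw [← pow_two]
    gcongr
  rcases hX0.eq_or_lt with h | h
  · rw [← h]
    exact integral_nonneg fun _ => sq_nonneg _
  · exact le_of_mul_le_mul_left h5 h

theorem mem_of_memLp_defectInt (hα : 0 ≤ α) (hlam : 0 < lam) (hF : F ∈ Hs (3 / 2))
    (hgF : hat g =ᵐ[volume] fun p => hat F p + q * gam * freeRes lam p)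
    (hk : MemLp (defectInt α lam F q) 2) : g ∈ fracPowDomain (PointLaplacian α) (3 / 4) := by
  obtain ⟨μ, hμ⟩ := exists_isSpectralMeasure hα g
  refine (mem_fracPowDomain_iff hlam).mpr ⟨μ, hμ, ?_⟩
  have := hμ.1
  have hae := IsResolventFamily.ae_nonneg_of_measure_Iio hμ.2.1
  have hi : Integrable (fun x => powSymbol (x + lam) ^ 2) μ := by
    refine integrable_of_tendsto_of_integral_le
      (f := fun (n : ℕ) x => truncSymbol n (x + lam) ^ 2) (fun n => ?_)
      (fun n => Eventually.of_forall fun x => sq_nonneg _)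
      (fun n => integral_truncSymbol_sq_le hα hlam hF hgF hk hμ n.cast_nonneg) ?_
    · simp_rw [pow_two (truncSymbol _ _)]
      exact integrable_truncSymbol_sq hlam hae n.cast_nonneg n.cast_nonneg
    · filter_upwards [hae] with x hx
      exact ((tendsto_truncSymbol (by positivity)).comp tendsto_natCast_atTop_atTop).pow 2
  -- The constant is the inverse square of the factor 2/3 in `le_powSymbol`.
  refine (hi.const_mul (9 / 4)).mono' (Measurable.aestronglyMeasurable (by fun_prop)) ?_
  filter_upwards [hae] with x hx
  have hy : 0 < x + lam := by positivity
  have h1 : (x + lam) ^ (3 / 2 : ℝ) = ((x + lam) ^ (3 / 4 : ℝ)) ^ 2 := by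
    rw [← Real.rpow_natCast, ← Real.rpow_mul hy.le]
    norm_num
  have h2 := pow_le_pow_left₀ (by positivity) (le_powSymbol hy) 2
  rw [Real.norm_eq_abs, abs_of_nonneg (by positivity), h1]
  linarith

end Characterization

theorem ae_eq_add_green_iff_freeRes {lam : ℝ} (hlam : 0 < lam) (g F : L2) (q : ℂ) :
    g =ᵐ[volume] (fun x => F x + q * green lam x) ↔
      hat g =ᵐ[volume] fun p => hat F p + q * gam * freeRes lam p := by
  rw [ae_eq_add_green_iff hlam]
  refine Iff.of_eq ?_
  congr 1
  ext p
  rw [freeRes, div_eq_mul_inv]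
  push_cast
  ring

/-! ### The space of regular parts and its link with the domain -/

section RegularSpace

variable {α lam : ℝ}

theorem integrableOn_hat_ball (F : L2) (R : ℝ) : IntegrableOn (hat F) (Metric.ball (0 : R3) R) := by
  have : IsFiniteMeasure (volume.restrict (Metric.ball (0 : R3) R)) :=
    ⟨by
      rw [Measure.restrict_apply_univ]
      exact measure_ball_lt_top⟩
  exact ((memLp_hat F).restrict _).integrable (by norm_num)

theorem HasValueAtZero.add {F G : L2} {c d : ℂ} (hF : HasValueAtZero F c)
    (hG : HasValueAtZero G d) : HasValueAtZero (F + G) (c + d) := by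
  refine (Tendsto.add hF hG).congr fun R => ?_
  rw [← mul_add, ← integral_add (integrableOn_hat_ball F R) (integrableOn_hat_ball G R)]
  congr 1
  exact integral_congr_ae (EventuallyEq.symm (ae_restrict_of_ae (hat_add F G)))

theorem HasValueAtZero.smul {F : L2} {c : ℂ} (a : ℂ) (hF : HasValueAtZero F c) :
    HasValueAtZero (a • F) (a * c) := by
  refine (Tendsto.const_mul a hF).congr fun R => ?_
  rw [mul_left_comm, ← integral_const_mul a]
  congr 1
  exact integral_congr_ae (EventuallyEq.symm (ae_restrict_of_ae (hat_smul a F)))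

theorem mem_D0_iff (hα : 0 ≤ α) (hlam : 0 < lam) {F : L2} : F ∈ D0 (3 / 2) α lam ↔
    F ∈ Hs (3 / 2) ∧ ∃ c, HasValueAtZero F c ∧
      MemLp (defectInt α lam F (c / coupling α lam)) 2 := by
  refine and_congr_right fun hF => exists_congr fun c => and_congr_right fun _ => ?_
  exact memLp_hatI_add_hatJ_iff hα hlam hF _

theorem exists_submodule_eq_D0 (hα : 0 ≤ α) (hlam : 0 < lam) :
    ∃ V : Submodule ℂ L2, (V : Set L2) = D0 (3 / 2) α lam := by
  have hsmul : ∀ (a : ℂ) (F : L2), F ∈ D0 (3 / 2) α lam → a • F ∈ D0 (3 / 2) α lam := by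
    intro a F hF
    rw [mem_D0_iff hα hlam] at hF ⊢
    obtain ⟨hH, c, hc, hm⟩ := hF
    refine ⟨Hs_smul a hH, a * c, hc.smul a, (hm.const_mul a).ae_eq
      (Eventually.of_forall fun p => ?_)⟩
    rw [mul_div_assoc, defectInt_smul]
  have hne : (0 : L2) ∈ D0 (3 / 2) α lam := by
    rw [mem_D0_iff hα hlam]
    have h0 : hat 0 =ᵐ[volume] fun _ => (0 : ℂ) := by
      have := hat_smul 0 (0 : L2)
      simpa using this
    have h1 := fun p => defectInt_smul (α := α) (lam := lam) 0 0 0 p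
    simp only [smul_zero, mul_zero, zero_mul] at h1
    refine ⟨Hs_zero, 0, ?_, ?_⟩
    · refine Tendsto.congr (fun R => ?_) tendsto_const_nhds
      rw [integral_congr_ae (ae_restrict_of_ae h0)]
      simp
    · rw [zero_div]
      exact (MemLp.zero (ε := ℂ) (α := R3)).ae_eq (Eventually.of_forall fun p => (h1 p).symm)
  refine ⟨{ carrier := D0 (3 / 2) α lam
            add_mem' := fun {F G} hF hG => ?_
            zero_mem' := hne
            smul_mem' := fun a F hF => hsmul a F hF }, rfl⟩
  rw [mem_D0_iff hα hlam] at hF hG ⊢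
  obtain ⟨hF, c, hc, hm⟩ := hF
  obtain ⟨hG, d, hd, hn⟩ := hG
  refine ⟨Hs_add hF hG, c + d, hc.add hd, (hm.add hn).ae_eq (Eventually.of_forall fun p => ?_)⟩
  rw [add_div, defectInt_add hα hlam hF hG, Pi.add_apply]

/-- The limit of t κ_F(t) is the value F⁽⁰⁾ and equals q · coupling(λ). So q is determined by F, and
the defect integral in the L² condition is the one for this q. -/
theorem mem_D0_of_mem_fracPowDomain (hα : 0 ≤ α) (hlam : 0 < lam) {g F : L2} {q : ℂ}
    (hF : F ∈ Hs (3 / 2)) (hg : g ∈ fracPowDomain (PointLaplacian α) (3 / 4))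
    (hgF : g =ᵐ[volume] fun x => F x + q * green lam x) :
    F ∈ D0 (3 / 2) α lam ∧ ∃ c, HasValueAtZero F c ∧ q = c / (coupling α lam : ℂ) := by
  rw [ae_eq_add_green_iff_freeRes hlam] at hgF
  have hc := coupling_ne_zero hα hlam
  have hv := hasValueAtZero_of_tendsto hlam hF (tendsto_mul_kappa_of_mem hα hlam hg hF hgF)
  refine ⟨(mem_D0_iff hα hlam).mpr ⟨hF, _, hv, ?_⟩, _, hv, (mul_div_cancel_right₀ q hc).symm⟩
  rw [mul_div_cancel_right₀ q hc]
  exact memLp_defectInt_of_mem hα hlam hg hF hgF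

theorem mem_fracPowDomain_of_mem_D0 (hα : 0 ≤ α) (hlam : 0 < lam) {g F : L2} {c : ℂ}
    (hF : F ∈ D0 (3 / 2) α lam) (hc : HasValueAtZero F c)
    (hgF : g =ᵐ[volume] fun x => F x + c / (coupling α lam : ℂ) * green lam x) :
    g ∈ fracPowDomain (PointLaplacian α) (3 / 4) := by
  rw [ae_eq_add_green_iff_freeRes hlam] at hgF
  obtain ⟨hF, d, hd, hm⟩ := (mem_D0_iff hα hlam).mp hF
  -- The value at the origin is a limit, hence unique, so the constant in the L² condition is the
  -- given c.
  rw [tendsto_nhds_unique hd hc] at hm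
  exact mem_of_memLp_defectInt hα hlam hF hgF hm

end RegularSpace

/-! ### An H^{3/2} function without a value at the origin -/

section Strict

/-- A radial profile which is barely not integrable over `ℝ³`. -/
def logProfile (r : ℝ) : ℝ := (r * (r ^ 2 + 2) * log (r ^ 2 + 2))⁻¹

theorem log_sq_add_two_pos (r : ℝ) : 0 < log (r ^ 2 + 2) :=
  Real.log_pos (by nlinarith [sq_nonneg r])

theorem hasDerivAt_log_sq_add_two (r : ℝ) :
    HasDerivAt (fun r : ℝ => log (r ^ 2 + 2)) (2 * r / (r ^ 2 + 2)) r := by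
  have h := ((hasDerivAt_pow 2 r).add_const 2).log (by positivity)
  simpa using h

theorem integrableOn_mul_inv_log_sq :
    IntegrableOn (fun r : ℝ => 2 * r / (r ^ 2 + 2) / log (r ^ 2 + 2) ^ 2) (Ioi 0) := by
  have hlim : Tendsto (fun r : ℝ => -(log (r ^ 2 + 2))⁻¹) atTop (𝓝 (-0)) :=
    (tendsto_inv_atTop_zero.comp (Real.tendsto_log_atTop.comp
      (tendsto_atTop_add_const_right _ _ (tendsto_pow_atTop two_ne_zero)))).neg
  have hd : ∀ r : ℝ, HasDerivAt (fun r : ℝ => -(log (r ^ 2 + 2))⁻¹)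
      (2 * r / (r ^ 2 + 2) / log (r ^ 2 + 2) ^ 2) r := by
    intro r
    have h := ((hasDerivAt_log_sq_add_two r).inv (log_sq_add_two_pos r).ne').neg
    refine h.congr_deriv ?_
    rw [neg_div, neg_neg]
  refine integrableOn_Ioi_deriv_of_nonneg' (fun r _ => hd r) (fun r hr => ?_) hlim
  have : 0 < r := hr
  have := log_sq_add_two_pos r
  positivity

/-- The integrand simplifies to 1/(√(r²+2) log²(r²+2)). Near infinity it is dominated by the
derivative of −1/log(r²+2), so the square of the logarithm makes the H^{3/2} norm finite. -/
theorem integrableOn_sq_mul_logProfile_sq :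
    IntegrableOn (fun r : ℝ => r ^ 2 * ((r ^ 2 + 2) ^ (3 / 2 : ℝ) * logProfile r ^ 2)) (Ioi 0) := by
  have e : ∀ r ∈ Ioi (0 : ℝ), (√(r ^ 2 + 2))⁻¹ / log (r ^ 2 + 2) ^ 2 =
      r ^ 2 * ((r ^ 2 + 2) ^ (3 / 2 : ℝ) * logProfile r ^ 2) := by
    intro r hr
    have hr0 : r ≠ 0 := ne_of_gt hr
    have hl := (log_sq_add_two_pos r).ne'
    have hy : 0 < r ^ 2 + 2 := by positivity
    have hs := Real.sqrt_pos.mpr hy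
    have h1 : (r ^ 2 + 2) ^ (3 / 2 : ℝ) = √(r ^ 2 + 2) ^ 3 := by
      rw [Real.sqrt_eq_rpow, ← Real.rpow_natCast ((r ^ 2 + 2) ^ (1 / 2 : ℝ)) 3,
        ← Real.rpow_mul hy.le]
      norm_num
    have h2 : √(r ^ 2 + 2) ^ 2 = r ^ 2 + 2 := Real.sq_sqrt hy.le
    rw [h1, logProfile]
    generalize log (r ^ 2 + 2) = l at *
    generalize √(r ^ 2 + 2) = s at *
    rw [← h2]
    field_simp
  have hm : Measurable fun r : ℝ => (√(r ^ 2 + 2))⁻¹ / log (r ^ 2 + 2) ^ 2 := by fun_prop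
  refine IntegrableOn.congr_fun ?_ e measurableSet_Ioi
  have hc : Continuous fun r : ℝ => (√(r ^ 2 + 2))⁻¹ / log (r ^ 2 + 2) ^ 2 := by
    refine Continuous.div (Continuous.inv₀ (by fun_prop) fun r => by positivity) ?_
      fun r => pow_ne_zero 2 (log_sq_add_two_pos r).ne'
    exact (Continuous.log (by fun_prop) fun r => by positivity).pow 2
  rw [← Ioc_union_Ioi_eq_Ioi zero_le_one]
  refine IntegrableOn.union (hc.integrableOn_Icc.mono_set Ioc_subset_Icc_self) ?_
  refine ((integrableOn_mul_inv_log_sq.mono_set (Ioi_subset_Ioi zero_le_one))).mono'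
    hm.aestronglyMeasurable ?_
  filter_upwards [ae_restrict_mem measurableSet_Ioi] with r hr
  have hr1 : 1 < r := hr
  have hl := log_sq_add_two_pos r
  have hy : 0 < r ^ 2 + 2 := by positivity
  have hs := Real.sqrt_pos.mpr hy
  rw [Real.norm_eq_abs, abs_of_nonneg (by positivity)]
  gcongr
  rw [inv_eq_one_div, div_le_div_iff₀ hs hy, one_mul]
  have h2 : √(r ^ 2 + 2) * √(r ^ 2 + 2) = r ^ 2 + 2 := Real.mul_self_sqrt hy.le
  have h3 : √(r ^ 2 + 2) ≤ 2 * r := Real.sqrt_le_iff.mpr ⟨by positivity, by nlinarith⟩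
  calc r ^ 2 + 2 = √(r ^ 2 + 2) * √(r ^ 2 + 2) := h2.symm
    _ ≤ _ := by gcongr

/-- With the volume factor r² only one logarithm remains in the denominator, and the primitive is
half of log log(r²+2), which is unbounded. -/
theorem integral_ball_logProfile {R : ℝ} (hR : 0 ≤ R) :
    ∫ p in Metric.ball (0 : R3) R, logProfile ‖p‖ =
      3 * ((volume : Measure R3).real (Metric.ball 0 1) *
        ((log (log (R ^ 2 + 2)) - log (log 2)) / 2)) := by
  have h1 : ∫ p in Metric.ball (0 : R3) R, logProfile ‖p‖ =
      ∫ p : R3, (Iio R).indicator logProfile ‖p‖ := by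
    rw [← integral_indicator Metric.isOpen_ball.measurableSet]
    refine integral_congr_ae (Eventually.of_forall fun p => ?_)
    simp only [indicator, Metric.mem_ball, dist_zero_right, mem_Iio]
  have hd : ∀ r : ℝ, HasDerivAt (fun r : ℝ => log (log (r ^ 2 + 2)) / 2)
      (r / ((r ^ 2 + 2) * log (r ^ 2 + 2))) r := by
    intro r
    have h := ((hasDerivAt_log_sq_add_two r).log (log_sq_add_two_pos r).ne').div_const 2
    refine h.congr_deriv ?_
    field_simp
  have hc : Continuous fun r : ℝ => r / ((r ^ 2 + 2) * log (r ^ 2 + 2)) := by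
    refine Continuous.div (by fun_prop) (Continuous.mul (by fun_prop)
      (Continuous.log (by fun_prop) fun r => by positivity)) fun r => ?_
    have := log_sq_add_two_pos r
    positivity
  have h2 : ∫ r in Ioi (0 : ℝ), r ^ 2 * (Iio R).indicator logProfile r =
      (log (log (R ^ 2 + 2)) - log (log 2)) / 2 := by
    have e : ∀ r : ℝ, r ^ 2 * (Iio R).indicator logProfile r =
        (Iio R).indicator (fun r => r / ((r ^ 2 + 2) * log (r ^ 2 + 2))) r := by
      intro r
      by_cases hr : r ∈ Iio R
      · rw [indicator_of_mem hr, indicator_of_mem hr, logProfile]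
        rcases eq_or_ne r 0 with h | h
        · simp [h]
        · have := (log_sq_add_two_pos r).ne'
          field_simp
      · rw [indicator_of_notMem hr, indicator_of_notMem hr, mul_zero]
    simp_rw [e]
    rw [setIntegral_indicator measurableSet_Iio, Ioi_inter_Iio, ← integral_Ioc_eq_integral_Ioo,
      ← intervalIntegral.integral_of_le hR,
      intervalIntegral.integral_eq_sub_of_hasDerivAt (fun r _ => hd r)
        (hc.intervalIntegrable 0 R)]
    norm_num
    ring
  rw [h1, integral_fun_norm_addHaar, finrank_euclideanSpace_fin]
  simp only [smul_eq_mul, nsmul_eq_mul, Nat.reduceSub, Nat.cast_ofNat]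
  rw [h2]

theorem exists_mem_Hs_not_hasValueAtZero : ∃ F ∈ Hs (3 / 2), ∀ c, ¬ HasValueAtZero F c := by
  have hm : Measurable fun p : R3 => logProfile ‖p‖ := by
    unfold logProfile
    fun_prop
  have hi : Integrable fun p : R3 => (‖p‖ ^ 2 + 2) ^ (3 / 2 : ℝ) * logProfile ‖p‖ ^ 2 := by
    refine (integrable_fun_norm_addHaar (volume : Measure R3)
      (f := fun r => (r ^ 2 + 2) ^ (3 / 2 : ℝ) * logProfile r ^ 2)).mpr ?_
    rw [finrank_euclideanSpace_fin]
    exact integrableOn_sq_mul_logProfile_sq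
  have hf : MemLp (fun p : R3 => (((‖p‖ ^ 2 + 2) ^ (3 / 2 / 2 : ℝ) : ℝ) : ℂ) *
      (logProfile ‖p‖ : ℂ)) 2 := by
    have hmm : Measurable fun p : R3 => (((‖p‖ ^ 2 + 2) ^ (3 / 2 / 2 : ℝ) : ℝ) : ℂ) *
      (logProfile ‖p‖ : ℂ) := by fun_prop
    rw [memLp_two_iff_integrable_sq_norm hmm.aestronglyMeasurable]
    refine hi.congr (Eventually.of_forall fun p => ?_)
    simp only
    rw [norm_mul, mul_pow, Complex.norm_real, Complex.norm_real, Real.norm_eq_abs,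
      Real.norm_eq_abs, sq_abs, sq_abs, ← Real.rpow_natCast ((‖p‖ ^ 2 + 2) ^ (3 / 2 / 2 : ℝ)) 2,
      ← Real.rpow_mul (by positivity)]
    norm_num
  have hl : MemLp (fun p : R3 => (logProfile ‖p‖ : ℂ)) 2 := by
    have hmm : Measurable fun p : R3 => (logProfile ‖p‖ : ℂ) := by fun_prop
    refine hf.of_le hmm.aestronglyMeasurable (Eventually.of_forall fun p => ?_)
    rw [norm_mul, Complex.norm_real ((‖p‖ ^ 2 + 2) ^ (3 / 2 / 2 : ℝ)), Real.norm_eq_abs,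
      abs_of_nonneg (by positivity)]
    refine le_mul_of_one_le_left (norm_nonneg _) (Real.one_le_rpow ?_ (by norm_num))
    nlinarith [sq_nonneg ‖p‖]
  obtain ⟨F, hF⟩ := exists_hat_eq hl
  refine ⟨F, ?_, fun c hc => ?_⟩
  · rw [mem_Hs_iff (by norm_num) two_pos]
    refine hf.ae_eq ?_
    filter_upwards [hF] with p hp
    rw [hp]
  · have h1 := (Complex.continuous_re.tendsto _).comp hc
    refine not_tendsto_nhds_of_tendsto_atTop ?_ _ h1
    set V := (volume : Measure R3).real (Metric.ball 0 1) with hV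
    have hV0 : 0 < V := by
      rw [hV, Measure.real, ENNReal.toReal_pos_iff]
      exact ⟨Metric.measure_ball_pos _ _ one_pos, measure_ball_lt_top⟩
    have h2 : Tendsto (fun R : ℝ => gam * (3 * (V *
        ((log (log (R ^ 2 + 2)) - log (log 2)) / 2)))) atTop atTop := by
      have h3 : Tendsto (fun R : ℝ => log (log (R ^ 2 + 2))) atTop atTop :=
        Real.tendsto_log_atTop.comp (Real.tendsto_log_atTop.comp
          (tendsto_atTop_add_const_right _ _ (tendsto_pow_atTop two_ne_zero)))
      exact (((((tendsto_atTop_add_const_right _ (-log (log 2)) h3)).atTop_div_const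
        two_pos).const_mul_atTop hV0).const_mul_atTop three_pos).const_mul_atTop gam_pos
    refine h2.congr' ?_
    filter_upwards [eventually_ge_atTop 0] with R hR
    have h4 : ∫ p in Metric.ball (0 : R3) R, hat F p =
        ((∫ p in Metric.ball (0 : R3) R, logProfile ‖p‖ : ℝ) : ℂ) := by
      rw [integral_congr_ae (ae_restrict_of_ae hF), integral_complex_ofReal]
    rw [Function.comp_apply, h4, ← Complex.ofReal_mul, Complex.ofReal_re,
      integral_ball_logProfile hR, gam]

theorem D0_ssubset_Hs (α lam : ℝ) : D0 (3 / 2) α lam ⊂ Hs (3 / 2) := by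
  refine ⟨fun F hF => hF.1, fun h => ?_⟩
  obtain ⟨F, hF, hn⟩ := exists_mem_Hs_not_hasValueAtZero
  obtain ⟨-, c, hc, -⟩ := h hF
  exact hn c hc

end Strict

end PointInteraction

end

theorem mainTheorem4 (α lam : ℝ) (hα : 0 ≤ α) (hlam : 0 < lam) :
    -- the domain of `(-Δ_α)^{3/4}`
    PointInteraction.fracPowDomain (PointInteraction.PointLaplacian α) (3 / 4) =
      {g : PointInteraction.L2 | ∃ F ∈ PointInteraction.D0 (3 / 2) α lam, ∃ c : ℂ,
        PointInteraction.HasValueAtZero F c ∧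
        g =ᵐ[volume] (fun x => F x +
          c / (PointInteraction.coupling α lam : ℂ) * PointInteraction.green lam x)} ∧
    -- `D₀^{(3/2)}` is a linear subspace, strictly contained in `H^{3/2}`
    (∃ V : Submodule ℂ PointInteraction.L2,
      (V : Set PointInteraction.L2) = PointInteraction.D0 (3 / 2) α lam) ∧
    PointInteraction.D0 (3 / 2) α lam ⊂ PointInteraction.Hs (3 / 2) ∧
    -- no other combination of an `H^{3/2}` function and `G_λ` belongs to the domain
    (∀ F ∈ PointInteraction.Hs (3 / 2), ∀ q : ℂ,
      ∀ g ∈ PointInteraction.fracPowDomain (PointInteraction.PointLaplacian α) (3 / 4),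
        g =ᵐ[volume] (fun x => F x + q * PointInteraction.green lam x) →
        F ∈ PointInteraction.D0 (3 / 2) α lam ∧
        ∃ c : ℂ, PointInteraction.HasValueAtZero F c ∧
          q = c / (PointInteraction.coupling α lam : ℂ)) := by
  refine ⟨?_, PointInteraction.exists_submodule_eq_D0 hα hlam,
    PointInteraction.D0_ssubset_Hs α lam, fun F hF q g hg hgF =>
      PointInteraction.mem_D0_of_mem_fracPowDomain hα hlam hF hg hgF⟩
  ext g
  constructor
  · intro hg
    -- Some decomposition with an H^{3/2} regular part exists; the rigidity statement then forces F
    -- into the smaller space and fixes q.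
    obtain ⟨F, hF, q, hgF⟩ := PointInteraction.exists_regular_part hα hlam hg
    obtain ⟨hD, c, hc, rfl⟩ := PointInteraction.mem_D0_of_mem_fracPowDomain hα hlam hF hg hgF
    exact ⟨F, hD, c, hc, hgF⟩
  · rintro ⟨F, hF, c, hc, hgF⟩
    exact PointInteraction.mem_fracPowDomain_of_mem_D0 hα hlam hF hc hgF
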